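/- Let $\tau\in\mathbb R$ and let $\widetilde{PSL}_2(\mathbb R,\tau)$ be $\{(x,y,t)\in\mathbb R^3:\ x^2+y^2<1\}$ with the Riemannian metric $$\lambda^2(dx^2+dy^2)+\Big(2\tau\big(\tfrac{\lambda_y}{\lambda}dx-\tfrac{\lambda_x}{\lambda}dy\big)+dt\Big)^2,\qquad \lambda=\frac{2}{1-(x^2+y^2)} .$$ Let $R=\{(0,0)\}\times\mathbb R$. A rotational $H$-surface is a surface generated by rotating about $R$, by the maps $(z,t)\mapsto(e^{i\theta}z,t)$, a smooth regular curve of the plane $\{y=0\}$ defined on an open interval (the curve may meet $R$, but only orthogonally), which has constant mean curvature $H$ with respect to a continuous unit normal field. The neck of a surface is the set of its points closest to $R$, and distances are Riemannian. **Theorem.** Let $0<H\le 1/2$. There is a one-parameter family $\mathfrak H_d$ of complete rotational $H$-surfaces, where $d$ ranges over $\mathbb R$ if $H<1/2$ and over $d<0$ if $H=1/2$, such that: 1. For $d>-2H$, $\mathfrak H_d$ is a properly embedded annulus, symmetric with respect to the slice $\{t=0\}$ (that is, invariant under $(x,y,t)\mapsto(x,y,-t)$). Its neck is the circle in the slice $\{t=0\}$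 at distance $\rho_1>0$ from $R$, where $$\rho_1=\operatorname{arcosh}\frac{2dH+\sqrt{1-4H^2+d^2}}{1-4H^2}\ \text{ if } H<\tfrac12,\qquad \rho_1=\operatorname{arcosh}\frac{1+d^2}{-2d}\ \text{ if } H=\tfrac12 .$$ 2. For $d=-2H$, $\mathfrak H_{-2H}=:S^H$ is an entire vertical graph $t=u(x,y)$ over the unit disk, contained in $\{t\ge0\}$ and tangent to the slice $\{t=0\}$ at $(0,0,0)$. 3. For $d<-2H$, $\mathfrak H_d$ is a properly immersed annulus that is not embedded (two sheets pass through a common point with different tangent planes). It is symmetric with respect to $\{t=0\}$, and its neck is the circle in $\{t=0\}$ at distance $\rho_1>0$ from $R$, with $\rho_1$ given by the same formulas. 4. Every $\mathfrak H_d$ is unbounded in the $t$-coordinate. As $d\to-2H$ with $d>-2H$, and also with $d<-2H$, $\mathfrak H_d$ tends to the union of $S^H$ and its reflection in the slice $\{t=0\}$, in the Hausdorff sense on compact subsets of the space. Every rotational $H$-surface is, up to an isometry of the space, contained in some $\mathfrak H_d$ of the family. -/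

import Mathlib

open Set Filter Topology
open scoped ContDiff

noncomputable section

namespace PSL2Tilde

/-! ### The ambient space

The space is the open solid cylinder `x² + y² < 1` in the coordinates `(x, y, t)`, with the metric
`λ² (dx² + dy²) + (2τ (λ_y/λ dx - λ_x/λ dy) + dt)²`, where `λ = 2 / (1 - (x² + y²))`. -/

/-- Coordinate triples `(x, y, t) = (p 0, p 1, p 2)`; also used for tangent vectors. -/
abbrev Pt : Type := Fin 3 → ℝ

/-- The coordinate domain `𝔻 × ℝ`. -/
def ambient : Set Pt := {p | p 0 ^ 2 + p 1 ^ 2 < 1}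

/-- The conformal factor of the hyperbolic disk. -/
def lam (p : Pt) : ℝ := 2 / (1 - (p 0 ^ 2 + p 1 ^ 2))

/-- The one-form `2τ (λ_y/λ dx - λ_x/λ dy) + dt`, written with `λ_x = x λ²` and `λ_y = y λ²`. -/
def connForm (τ : ℝ) (p v : Pt) : ℝ := 2 * τ * lam p * (p 1 * v 0 - p 0 * v 1) + v 2

/-- The Riemannian metric. -/
def metric (τ : ℝ) (p v w : Pt) : ℝ :=
  lam p ^ 2 * (v 0 * w 0 + v 1 * w 1) + connForm τ p v * connForm τ p w

/-- The Gram matrix of the metric in the coordinate frame. -/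
def gram (τ : ℝ) (p : Pt) : Matrix (Fin 3) (Fin 3) ℝ :=
  Matrix.of fun i j => metric τ p (Pi.single i 1) (Pi.single j 1)

/-- Partial derivative in the `i`-th coordinate. -/
def pderiv (i : Fin 3) (f : Pt → ℝ) (p : Pt) : ℝ := fderiv ℝ f p (Pi.single i 1)

/-- Christoffel symbols `Γᵏᵢⱼ` of the Levi-Civita connection. -/
def christoffel (τ : ℝ) (p : Pt) (k i j : Fin 3) : ℝ :=
  1 / 2 * ∑ l, (gram τ p)⁻¹ k l *
    (pderiv i (fun q => gram τ q j l) p + pderiv j (fun q => gram τ q i l) p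
      - pderiv l (fun q => gram τ q i j) p)

/-- Ambient isometries: diffeomorphisms of the space that preserve the metric. (Smoothness of the
inverse follows, since an isometry has invertible differential.) -/
structure IsIsometry (τ : ℝ) (φ : Pt → Pt) : Prop where
  smooth : ContDiffOn ℝ ∞ φ ambient
  bij : BijOn φ ambient ambient
  preserves : ∀ p ∈ ambient, ∀ v w : Pt,
    metric τ (φ p) (fderiv ℝ φ p v) (fderiv ℝ φ p w) = metric τ p v w

/-- Riemannian length of the restriction of a curve to `[0, T]`. -/
def curveLength (τ : ℝ) (γ : ℝ → Pt) (T : ℝ) : ℝ :=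
  ∫ s in (0 : ℝ)..T, √(metric τ (γ s) (deriv γ s) (deriv γ s))

/-- The rotational axis `{(0, 0)} × ℝ`. -/
def axis : Set Pt := {p | p 0 = 0 ∧ p 1 = 0}

/-- Riemannian distance from a point of the space to the axis: the infimum of the lengths of
`C¹` curves in the space that join the point to the axis. -/
def distAxis (τ : ℝ) (p : Pt) : ℝ :=
  sInf {L | ∃ γ : ℝ → Pt, ContDiff ℝ 1 γ ∧ (∀ s ∈ Icc (0 : ℝ) 1, γ s ∈ ambient) ∧
    γ 0 = p ∧ γ 1 ∈ axis ∧ L = curveLength τ γ 1}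

/-- Reflection in the slice `{t = 0}` (not an isometry of the space when `τ ≠ 0`). -/
def reflect (p : Pt) : Pt := ![p 0, p 1, -p 2]

/-! ### Immersed surfaces and their mean curvature -/

/-- `∂_v X` for a parametrization `X` and a parameter direction `v`. -/
def dX (X : ℝ × ℝ → Pt) (v q : ℝ × ℝ) : Pt := fderiv ℝ X q v

/-- Coefficient of the first fundamental form. -/
def firstForm (τ : ℝ) (X : ℝ × ℝ → Pt) (q v w : ℝ × ℝ) : ℝ :=
  metric τ (X q) (dX X v q) (dX X w q)

/-- The ambient covariant derivative `∇_{∂_v X} (∂_w X)` along the surface. -/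
def covDeriv (τ : ℝ) (X : ℝ × ℝ → Pt) (q v w : ℝ × ℝ) : Pt := fun k =>
  dX (dX X w) v q k + ∑ i, ∑ j, christoffel τ (X q) k i j * dX X v q i * dX X w q j

/-- Coefficient of the second fundamental form with respect to the normal vector `n`. -/
def secondForm (τ : ℝ) (X : ℝ × ℝ → Pt) (n : Pt) (q v w : ℝ × ℝ) : ℝ :=
  metric τ (X q) (covDeriv τ X q v w) n

/-- Mean curvature (half the trace of the second fundamental form with respect to the first) of
the parametrized surface `X` at the parameter `q`, with respect to the unit normal `n`. -/
def meanCurvature (τ : ℝ) (X : ℝ × ℝ → Pt) (n : Pt) (q : ℝ × ℝ) : ℝ :=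
  (secondForm τ X n q (1, 0) (1, 0) * firstForm τ X q (0, 1) (0, 1)
      - 2 * secondForm τ X n q (1, 0) (0, 1) * firstForm τ X q (1, 0) (0, 1)
      + secondForm τ X n q (0, 1) (0, 1) * firstForm τ X q (1, 0) (1, 0)) /
    (2 * (firstForm τ X q (1, 0) (1, 0) * firstForm τ X q (0, 1) (0, 1)
      - firstForm τ X q (1, 0) (0, 1) ^ 2))

/-- `n` is a unit normal vector of `X` at `q`. -/
def IsUnitNormalAt (τ : ℝ) (X : ℝ × ℝ → Pt) (n : Pt) (q : ℝ × ℝ) : Prop :=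
  metric τ (X q) n n = 1 ∧ ∀ v, metric τ (X q) (dX X v q) n = 0

/-- `X` is a smooth immersion of the open set `U` of the plane into the space, with constant mean
curvature `H` with respect to some continuous unit normal field. -/
structure IsHImmersion (τ H : ℝ) (U : Set (ℝ × ℝ)) (X : ℝ × ℝ → Pt) : Prop where
  isOpen : IsOpen U
  smooth : ContDiffOn ℝ ∞ X U
  maps : MapsTo X U ambient
  immersion : ∀ q ∈ U, Function.Injective (fderiv ℝ X q)
  cmc : ∃ N : ℝ × ℝ → Pt, ContinuousOn N U ∧
    ∀ q ∈ U, IsUnitNormalAt τ X (N q) q ∧ meanCurvature τ X (N q) q = H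

/-- Completeness of the metric induced by `X` on `U`: every `C¹` curve `[0, ∞) → U` that leaves
each compact subset of `U` for good has infinite length. -/
def IsCompleteOn (τ : ℝ) (U : Set (ℝ × ℝ)) (X : ℝ × ℝ → Pt) : Prop :=
  ∀ γ : ℝ → ℝ × ℝ, ContDiff ℝ 1 γ → (∀ s, 0 ≤ s → γ s ∈ U) →
    (∀ K ⊆ U, IsCompact K → ∀ᶠ s in atTop, γ s ∉ K) →
    Tendsto (fun T => curveLength τ (X ∘ γ) T) atTop atTop

/-! ### Rotational surfaces -/

/-- The surface obtained by rotating the curve `s ↦ (x s, 0, t s)` of the `xt`-plane about the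
axis. -/
def rotMap (x t : ℝ → ℝ) (q : ℝ × ℝ) : Pt :=
  ![x q.1 * Real.cos q.2, x q.1 * Real.sin q.2, t q.1]

/-- `S` is a rotational surface of constant mean curvature `H`: it is generated by a smooth regular
curve `s ↦ (x s, 0, t s)` of the `xt`-plane, defined on an open interval `I`, which may meet the
axis `x = 0` but only orthogonally (so that the surface has a tangent plane there), and there
is a continuous unit normal field along the surface with respect to which the mean curvature is
`H`. (At parameters with `x s = 0` the map `rotMap x t` is not an immersion, and the formula
for the mean curvature is used at the other parameters; these are dense.) -/
def IsRotationalHSurface (τ H : ℝ) (S : Set Pt) : Prop :=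
  ∃ (I : Set ℝ) (x t : ℝ → ℝ),
    IsOpen I ∧ I.OrdConnected ∧ I.Nonempty ∧
    ContDiffOn ℝ ∞ x I ∧ ContDiffOn ℝ ∞ t I ∧
    (∀ s ∈ I, |x s| < 1) ∧
    (∀ s ∈ I, deriv x s ≠ 0 ∨ deriv t s ≠ 0) ∧
    (∀ s ∈ I, x s = 0 → deriv t s = 0) ∧
    (∃ N : ℝ × ℝ → Pt, ContinuousOn N (I ×ˢ univ) ∧
      ∀ q ∈ I ×ˢ (univ : Set ℝ), IsUnitNormalAt τ (rotMap x t) (N q) q ∧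
        (x q.1 ≠ 0 → meanCurvature τ (rotMap x t) (N q) q = H)) ∧
    S = rotMap x t '' (I ×ˢ univ)

/-! ### Annuli and entire graphs -/

/-- The lift to the universal cover `ℝ × ℝ` of a map defined on the annulus `ℝ × (ℝ / 2πℤ)`. -/
def lift (Y : ℝ × Real.Angle → Pt) (q : ℝ × ℝ) : Pt := Y (q.1, (q.2 : Real.Angle))

/-- `Y` is a complete, proper immersion of the annulus `ℝ × (ℝ / 2πℤ)` with constant mean curvature
`H`. Immersion, curvature and completeness are local or invariant under Riemannian coverings, and
are stated on the universal cover. -/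
structure IsProperHAnnulus (τ H : ℝ) (Y : ℝ × Real.Angle → Pt) : Prop where
  immersion : IsHImmersion τ H univ (lift Y)
  complete : IsCompleteOn τ univ (lift Y)
  proper : ∀ K ⊆ ambient, IsCompact K → IsCompact (Y ⁻¹' K)

/-- `S` is a complete properly embedded annulus of constant mean curvature `H`. (An injective
proper immersion is an embedding.) -/
def IsProperlyEmbeddedHAnnulus (τ H : ℝ) (S : Set Pt) : Prop :=
  ∃ Y, IsProperHAnnulus τ H Y ∧ Function.Injective Y ∧ S = range Y

/-- `S` is a complete properly immersed annulus of constant mean curvature `H` which is not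
embedded: two sheets of the surface pass through a common point with different tangent planes. -/
def IsProperlyImmersedNonembeddedHAnnulus (τ H : ℝ) (S : Set Pt) : Prop :=
  ∃ Y, IsProperHAnnulus τ H Y ∧ S = range Y ∧
    ∃ p q : ℝ × ℝ, lift Y p = lift Y q ∧
      range (fderiv ℝ (lift Y) p) ≠ range (fderiv ℝ (lift Y) q)

/-- The open unit disk in the parameter plane. -/
def disk : Set (ℝ × ℝ) := {q | q.1 ^ 2 + q.2 ^ 2 < 1}

/-- The vertical graph of a function on the disk, as a parametrized surface. -/
def graphMap (u : ℝ × ℝ → ℝ) (q : ℝ × ℝ) : Pt := ![q.1, q.2, u q]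

/-- `S` is the entire vertical graph of `u`, is complete and has constant mean curvature `H`. -/
def IsEntireHGraph (τ H : ℝ) (u : ℝ × ℝ → ℝ) (S : Set Pt) : Prop :=
  IsHImmersion τ H disk (graphMap u) ∧ IsCompleteOn τ disk (graphMap u) ∧
    S = graphMap u '' disk

/-! ### Notions used for the family -/

/-- The admissible parameters `d`: all reals when `H < 1/2`, the negative reals when `H = 1/2`. -/
def Admissible (H d : ℝ) : Prop := H < 1 / 2 ∨ (H = 1 / 2 ∧ d < 0)

/-- The neck: the set of points of `S` that are closest to the axis. -/
def neck (τ : ℝ) (S : Set Pt) : Set Pt := {p ∈ S | ∀ q ∈ S, distAxis τ p ≤ distAxis τ q}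

/-- The explicit value of the neck distance. -/
def neckDistance (H d : ℝ) : ℝ :=
  if H < 1 / 2 then
    Real.arcosh ((2 * d * H + √(1 - 4 * H ^ 2 + d ^ 2)) / (1 - 4 * H ^ 2))
  else Real.arcosh ((1 + d ^ 2) / (-2 * d))

/-- The neck of `S` is the horizontal circle, in the slice `{t = 0}`, of the points at
distance `R > 0` from the axis. -/
def HasNeckAt (τ : ℝ) (S : Set Pt) (R : ℝ) : Prop :=
  0 < R ∧ neck τ S = {p ∈ ambient | p 2 = 0 ∧ distAxis τ p = R}

/-- The sets `F d` tend to `S` along the filter `l`: convergence in the Hausdorff sense on every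
compact subset of the space. -/
def TendsLocallyHausdorff (F : ℝ → Set Pt) (l : Filter ℝ) (S : Set Pt) : Prop :=
  ∀ K ⊆ ambient, IsCompact K → ∀ ε > 0, ∀ᶠ d in l,
    (∀ p ∈ F d ∩ K, ∃ q ∈ S, dist p q < ε) ∧ (∀ q ∈ S ∩ K, ∃ p ∈ F d, dist q p < ε)

end PSL2Tilde

end

noncomputable section
namespace PSL2Tilde

/-! ### The second fundamental form without Christoffel symbols -/

/-! Vertical translations are isometries, and the resulting flux integrates the mean curvature
equation once. For a profile curve (x, t) put λ = `cf x` and W² = t'² + λ²x'²(1 + 4τ²x²). The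
derivative of λxt'/W is x' times a quantity `curvJ` (`hasDerivAt_firstInt`), and the mean curvature
is ±`curvJ`/(2λ²x) (`meanCurvature_rotMap`). With ρ the distance to the axis, (cosh ρ)' = λ²xx'.
Hence constant mean curvature H gives λxt'/W = 2H cosh ρ + d up to orientation, and the constant d
is the parameter of the family. Conversely this equation gives mean curvature H when the zeros of x'
are isolated (`IsGenerating.curvJ_eq`).

Put c = cosh ρ. Since λ|x| = sinh ρ and |t'| ≤ W, the equation forces Q(c) = c² − 1 − (2Hc + d)² ≥
0. Here Q(c) = (c − c₁)((1 − 4H²)(c − c₁) + 2√(1 − 4H² + d²)) with c₁ = `neckCosh H d`, and the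
second factor is positive for c ≥ 1, so c ≥ c₁. For d ≠ −2H the substitution c = c₁ + s² removes the
square root singularity at the neck: x is smooth and even in s, t is smooth and odd, and t' has the
sign of 2Hc + d. If d > −2H, then t is injective and the annulus is embedded. If d < −2H, then t
first decreases away from the neck and later tends to infinity, so the half profile returns to
height 0 and crosses its mirror image there. If d = −2H, then c₁ = 1 and the profile reaches the
axis; written in the variable x² + y² it is a smooth entire graph.

Completeness holds because both ρ and t are controlled by arc length (`exists_cyl_of_length_le`).
The degeneration follows from a bound on the slopes, uniform for d near −2H, and dominated
convergence (`eventually_profile_close`). For the classification, the first integral yields d, and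
then t = ±T(v) + C with v = √(c − c₁) and T the model height, on each interval where x' ≠ 0. Since
x' vanishes at most once, the pieces fit together (`IsGenerating.subset_profile`). -/

/-- Directional derivative of `connForm` in the base point. -/
def dconn (τ : ℝ) (p u v : Pt) : ℝ :=
  2 * τ * (lam p ^ 2 * (p 0 * u 0 + p 1 * u 1) * (p 1 * v 0 - p 0 * v 1)
    + lam p * (u 1 * v 0 - u 0 * v 1))

/-- Directional derivative of `metric` in the base point. -/
def dmetric (τ : ℝ) (p u v w : Pt) : ℝ :=
  2 * lam p ^ 3 * (p 0 * u 0 + p 1 * u 1) * (v 0 * w 0 + v 1 * w 1)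
    + dconn τ p u v * connForm τ p w + connForm τ p v * dconn τ p u w

theorem lam_pos {p : Pt} (hp : p ∈ ambient) : 0 < lam p := by
  have : p 0 ^ 2 + p 1 ^ 2 < 1 := hp
  exact div_pos two_pos (by linarith)

theorem hasFDerivAt_lam {p : Pt} (hp : p ∈ ambient) :
    HasFDerivAt lam (lam p ^ 2 • (p 0 • ContinuousLinearMap.proj (R := ℝ) (φ := fun _ : Fin 3 => ℝ) 0
      + p 1 • ContinuousLinearMap.proj (R := ℝ) (φ := fun _ : Fin 3 => ℝ) 1)) p := by
  have h1 : 1 - (p 0 ^ 2 + p 1 ^ 2) ≠ 0 := by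
    have : p 0 ^ 2 + p 1 ^ 2 < 1 := hp
    linarith
  have h0 := hasFDerivAt_apply (𝕜 := ℝ) (F' := fun _ : Fin 3 => ℝ) 0 p
  have h1' := hasFDerivAt_apply (𝕜 := ℝ) (F' := fun _ : Fin 3 => ℝ) 1 p
  have hd : HasDerivAt (fun y : ℝ => 2 / (1 - y)) (2 / (1 - (p 0 ^ 2 + p 1 ^ 2)) ^ 2)
      (p 0 ^ 2 + p 1 ^ 2) := by
    refine ((hasDerivAt_const (p 0 ^ 2 + p 1 ^ 2) (2 : ℝ)).div
      ((hasDerivAt_id (p 0 ^ 2 + p 1 ^ 2)).const_sub 1) h1).congr_deriv ?_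
    simp
  have h2 := hd.comp_hasFDerivAt p ((h0.pow 2).add (h1'.pow 2))
  refine h2.congr_fderiv ?_
  ext v
  simp [lam]
  field_simp

theorem hasFDerivAt_connForm (τ : ℝ) {p : Pt} (hp : p ∈ ambient) (v : Pt) :
    DifferentiableAt ℝ (fun q => connForm τ q v) p ∧
      ∀ u, fderiv ℝ (fun q => connForm τ q v) p u = dconn τ p u v := by
  have h0 := hasFDerivAt_apply (𝕜 := ℝ) (F' := fun _ : Fin 3 => ℝ) 0 p
  have h1 := hasFDerivAt_apply (𝕜 := ℝ) (F' := fun _ : Fin 3 => ℝ) 1 p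
  have h := (((hasFDerivAt_lam hp).const_mul (2 * τ)).mul
    ((h1.mul_const (v 0)).sub (h0.mul_const (v 1)))).add_const (v 2)
  refine ⟨h.differentiableAt, fun u => ?_⟩
  have := h.fderiv
  simp only [connForm]
  erw [this]
  simp [dconn]
  ring

theorem fderiv_metric (τ : ℝ) {p : Pt} (hp : p ∈ ambient) (u v w : Pt) :
    fderiv ℝ (fun q => metric τ q v w) p u = dmetric τ p u v w := by
  obtain ⟨dv, hv⟩ := hasFDerivAt_connForm τ hp v
  obtain ⟨dw, hw⟩ := hasFDerivAt_connForm τ hp w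
  have h := (((hasFDerivAt_lam hp).pow 2).mul_const (v 0 * w 0 + v 1 * w 1)).add
    (dv.hasFDerivAt.mul dw.hasFDerivAt)
  have := h.fderiv
  simp only [metric]
  erw [this]
  simp [dmetric, hv, hw]
  ring

theorem pderiv_gram (τ : ℝ) {p : Pt} (hp : p ∈ ambient) (i j l : Fin 3) :
    pderiv i (fun q => gram τ q j l) p
      = dmetric τ p (Pi.single i 1) (Pi.single j 1) (Pi.single l 1) := by
  simp only [pderiv, gram, Matrix.of_apply]
  exact fderiv_metric τ hp _ _ _

theorem det_gram (τ : ℝ) (p : Pt) : (gram τ p).det = lam p ^ 4 := by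
  simp [Matrix.det_fin_three, gram, metric, connForm]
  ring

theorem metric_eq_gram (τ : ℝ) (p v w : Pt) :
    metric τ p v w = ∑ k, (∑ m, w m * gram τ p m k) * v k := by
  simp [Fin.sum_univ_three, gram, metric, connForm]
  ring

theorem dmetric_expand (τ : ℝ) (p u v w : Pt) :
    dmetric τ p u v w = ∑ l, w l * ∑ i, ∑ j, u i * v j *
      dmetric τ p (Pi.single i 1) (Pi.single j 1) (Pi.single l 1) := by
  simp [Fin.sum_univ_three, dmetric, dconn, connForm]
  ring

theorem dmetric_symm (τ : ℝ) (p u v w : Pt) : dmetric τ p u v w = dmetric τ p u w v := by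
  simp only [dmetric]; ring

theorem metric_symm (τ : ℝ) (p v w : Pt) : metric τ p v w = metric τ p w v := by
  simp only [metric]; ring

/-- Koszul's formula: pairing with n cancels the inverse Gram matrix, so second fundamental forms
can be computed without inverting it. -/
theorem metric_christoffel (τ : ℝ) {p : Pt} (hp : p ∈ ambient) (a v w n : Pt) :
    metric τ p (fun k => a k + ∑ i, ∑ j, christoffel τ p k i j * v i * w j) n
      = metric τ p a n + 1 / 2 * (dmetric τ p v w n + dmetric τ p w v n - dmetric τ p n v w) := by
  have hdet : IsUnit (gram τ p).det := by
    rw [det_gram]; exact (pow_ne_zero _ (lam_pos hp).ne').isUnit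
  -- Christoffel symbols of the first kind contracted with v and w; the inverse Gram matrix raises
  -- the index.
  set B : Fin 3 → ℝ := fun l => ∑ i, ∑ j, v i * w j * (1 / 2 *
    (dmetric τ p (Pi.single i 1) (Pi.single j 1) (Pi.single l 1)
      + dmetric τ p (Pi.single j 1) (Pi.single i 1) (Pi.single l 1)
      - dmetric τ p (Pi.single l 1) (Pi.single i 1) (Pi.single j 1))) with hB
  have hk : ∀ k, ∑ i, ∑ j, christoffel τ p k i j * v i * w j
      = ((gram τ p)⁻¹.mulVec B) k := by
    intro k
    simp only [christoffel, pderiv_gram τ hp, Matrix.mulVec, dotProduct, hB, Fin.sum_univ_three]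
    ring
  have hadd : metric τ p (fun k => a k + ∑ i, ∑ j, christoffel τ p k i j * v i * w j) n
      = metric τ p a n + metric τ p ((gram τ p)⁻¹.mulVec B) n := by
    have : (fun k => a k + ∑ i, ∑ j, christoffel τ p k i j * v i * w j)
        = fun k => a k + ((gram τ p)⁻¹.mulVec B) k := by
      ext k; rw [hk]
    rw [this]
    simp only [metric, connForm]; ring
  have hn : metric τ p ((gram τ p)⁻¹.mulVec B) n = ∑ l, n l * B l := by
    have : metric τ p ((gram τ p)⁻¹.mulVec B) n
        = dotProduct (Matrix.vecMul n (gram τ p)) ((gram τ p)⁻¹.mulVec B) := metric_eq_gram _ _ _ _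
    rw [this, Matrix.dotProduct_mulVec, Matrix.vecMul_vecMul, Matrix.mul_nonsing_inv _ hdet,
      Matrix.vecMul_one]
    rfl
  rw [hadd, hn, dmetric_expand τ p v w n, dmetric_expand τ p w v n, dmetric_symm τ p n v w,
    dmetric_symm τ p n w v]
  have h3 : dmetric τ p n v w = ∑ l, n l * ∑ i, ∑ j, v i * w j *
      dmetric τ p (Pi.single l 1) (Pi.single i 1) (Pi.single j 1) := by
    simp [Fin.sum_univ_three, dmetric, dconn, connForm]
    ring
  rw [h3]
  simp only [hB, Fin.sum_univ_three]
  ring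

theorem secondForm_eq (τ : ℝ) {X : ℝ × ℝ → Pt} {q : ℝ × ℝ} (hq : X q ∈ ambient) (n : Pt)
    (v w : ℝ × ℝ) :
    secondForm τ X n q v w = metric τ (X q) (dX (dX X w) v q) n
      + 1 / 2 * (dmetric τ (X q) (dX X v q) (dX X w q) n + dmetric τ (X q) (dX X w q) (dX X v q) n
        - dmetric τ (X q) n (dX X v q) (dX X w q)) :=
  metric_christoffel τ hq _ _ _ _

/-! ### Rotations and the derivatives of a rotational parametrization -/

/-- Rotation about the axis. -/
def rot (θ : ℝ) (v : Pt) : Pt :=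
  ![v 0 * Real.cos θ - v 1 * Real.sin θ, v 0 * Real.sin θ + v 1 * Real.cos θ, v 2]

theorem rot_normSq (θ : ℝ) (v : Pt) : rot θ v 0 ^ 2 + rot θ v 1 ^ 2 = v 0 ^ 2 + v 1 ^ 2 := by
  simp only [rot, Matrix.cons_val_zero, Matrix.cons_val_one]
  linear_combination (v 0 ^ 2 + v 1 ^ 2) * Real.sin_sq_add_cos_sq θ

theorem rot_dot (θ : ℝ) (v w : Pt) :
    rot θ v 0 * rot θ w 0 + rot θ v 1 * rot θ w 1 = v 0 * w 0 + v 1 * w 1 := by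
  simp only [rot, Matrix.cons_val_zero, Matrix.cons_val_one]
  linear_combination (v 0 * w 0 + v 1 * w 1) * Real.sin_sq_add_cos_sq θ

theorem rot_cross (θ : ℝ) (v w : Pt) :
    rot θ v 1 * rot θ w 0 - rot θ v 0 * rot θ w 1 = v 1 * w 0 - v 0 * w 1 := by
  simp only [rot, Matrix.cons_val_zero, Matrix.cons_val_one]
  linear_combination (v 1 * w 0 - v 0 * w 1) * Real.sin_sq_add_cos_sq θ

theorem rot_two (θ : ℝ) (v : Pt) : rot θ v 2 = v 2 := rfl

theorem lam_rot (θ : ℝ) (p : Pt) : lam (rot θ p) = lam p := by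
  simp only [lam, rot_normSq]

theorem connForm_rot (τ θ : ℝ) (p v : Pt) : connForm τ (rot θ p) (rot θ v) = connForm τ p v := by
  simp only [connForm, lam_rot, rot_cross, rot_two]

/-- The metric sees the horizontal components only through inner products and the area form, both
rotation invariant. All computations on `rotMap` therefore reduce to angle 0. -/
theorem metric_rot (τ θ : ℝ) (p v w : Pt) :
    metric τ (rot θ p) (rot θ v) (rot θ w) = metric τ p v w := by
  simp only [metric, connForm_rot, lam_rot, rot_dot]

theorem dconn_rot (τ θ : ℝ) (p u v : Pt) :
    dconn τ (rot θ p) (rot θ u) (rot θ v) = dconn τ p u v := by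
  simp only [dconn, lam_rot, rot_dot, rot_cross]

theorem dmetric_rot (τ θ : ℝ) (p u v w : Pt) :
    dmetric τ (rot θ p) (rot θ u) (rot θ v) (rot θ w) = dmetric τ p u v w := by
  simp only [dmetric, connForm_rot, dconn_rot, lam_rot, rot_dot]

theorem rotMap_eq_rot (x t : ℝ → ℝ) (q : ℝ × ℝ) :
    rotMap x t q = rot q.2 ![x q.1, 0, t q.1] := by
  ext i; fin_cases i <;> simp [rotMap, rot]

theorem hasFDerivAt_vec {f0 f1 f2 : ℝ × ℝ → ℝ} {g0 g1 g2 : ℝ × ℝ →L[ℝ] ℝ} {q : ℝ × ℝ}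
    (h0 : HasFDerivAt f0 g0 q) (h1 : HasFDerivAt f1 g1 q) (h2 : HasFDerivAt f2 g2 q) :
    HasFDerivAt (fun q => (![f0 q, f1 q, f2 q] : Pt))
      (ContinuousLinearMap.pi ![g0, g1, g2]) q := by
  rw [hasFDerivAt_pi]
  intro i
  fin_cases i
  · exact h0
  · exact h1
  · exact h2

theorem dX_vec {f0 f1 f2 : ℝ × ℝ → ℝ} {g0 g1 g2 : ℝ × ℝ →L[ℝ] ℝ} {q : ℝ × ℝ}
    (h0 : HasFDerivAt f0 g0 q) (h1 : HasFDerivAt f1 g1 q) (h2 : HasFDerivAt f2 g2 q)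
    (v : ℝ × ℝ) :
    dX (fun q => (![f0 q, f1 q, f2 q] : Pt)) v q = ![g0 v, g1 v, g2 v] := by
  rw [dX, (hasFDerivAt_vec h0 h1 h2).fderiv]
  ext i; fin_cases i <;> rfl

theorem hasFDerivAt_comp_fst {f : ℝ → ℝ} {f' : ℝ} {q : ℝ × ℝ} (h : HasDerivAt f f' q.1) :
    HasFDerivAt (fun q : ℝ × ℝ => f q.1) (f' • ContinuousLinearMap.fst ℝ ℝ ℝ) q :=
  h.comp_hasFDerivAt q hasFDerivAt_fst

theorem hasFDerivAt_comp_snd {f : ℝ → ℝ} {f' : ℝ} {q : ℝ × ℝ} (h : HasDerivAt f f' q.2) :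
    HasFDerivAt (fun q : ℝ × ℝ => f q.2) (f' • ContinuousLinearMap.snd ℝ ℝ ℝ) q :=
  h.comp_hasFDerivAt q hasFDerivAt_snd

/-- The value is kept in the form of a rotated vector so that `metric_rot` and `dmetric_rot` can
eliminate the angle. -/
theorem dX_rotMap {x t : ℝ → ℝ} {q : ℝ × ℝ} {x' t' : ℝ} (hx : HasDerivAt x x' q.1)
    (ht : HasDerivAt t t' q.1) (v : ℝ × ℝ) :
    dX (rotMap x t) v q = rot q.2 ![x' * v.1, x q.1 * v.2, t' * v.1] := by
  have hc := hasFDerivAt_comp_snd (Real.hasDerivAt_cos q.2)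
  have hs := hasFDerivAt_comp_snd (Real.hasDerivAt_sin q.2)
  have h := dX_vec ((hasFDerivAt_comp_fst hx).mul hc) ((hasFDerivAt_comp_fst hx).mul hs)
    (hasFDerivAt_comp_fst ht) v
  refine Eq.trans h ?_
  ext i; fin_cases i <;> simp [rot] <;> ring

theorem dX_dX_rotMap {x t : ℝ → ℝ} {q : ℝ × ℝ} (hx : ∀ᶠ s in 𝓝 q.1, DifferentiableAt ℝ x s)
    (ht : ∀ᶠ s in 𝓝 q.1, DifferentiableAt ℝ t s) {x'' t'' : ℝ}
    (hx2 : HasDerivAt (deriv x) x'' q.1) (ht2 : HasDerivAt (deriv t) t'' q.1) (v w : ℝ × ℝ) :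
    dX (dX (rotMap x t) w) v q = rot q.2 ![x'' * w.1 * v.1 - x q.1 * w.2 * v.2,
      deriv x q.1 * (w.1 * v.2 + w.2 * v.1), t'' * w.1 * v.1] := by
  have hev : dX (rotMap x t) w =ᶠ[𝓝 q] fun q =>
      ![deriv x q.1 * w.1 * Real.cos q.2 - x q.1 * w.2 * Real.sin q.2,
        deriv x q.1 * w.1 * Real.sin q.2 + x q.1 * w.2 * Real.cos q.2, deriv t q.1 * w.1] := by
    filter_upwards [continuous_fst.continuousAt.eventually hx,
      continuous_fst.continuousAt.eventually ht] with r h1 h2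
    rw [dX_rotMap h1.hasDerivAt h2.hasDerivAt]
    rfl
  have hc := hasFDerivAt_comp_snd (Real.hasDerivAt_cos q.2)
  have hs := hasFDerivAt_comp_snd (Real.hasDerivAt_sin q.2)
  have hx1 := hasFDerivAt_comp_fst hx.self_of_nhds.hasDerivAt
  have hx2' := hasFDerivAt_comp_fst hx2
  have ht2' := hasFDerivAt_comp_fst ht2
  have h := dX_vec (((hx2'.mul_const w.1).mul hc).sub ((hx1.mul_const w.2).mul hs))
    (((hx2'.mul_const w.1).mul hs).add ((hx1.mul_const w.2).mul hc)) (ht2'.mul_const w.1) v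
  rw [dX, hev.fderiv_eq]
  refine Eq.trans h ?_
  ext i; fin_cases i <;> simp [rot] <;> ring

/-! ### Mean curvature of a rotational surface -/

/-- The conformal factor as a function of the signed distance to the axis in the disk. -/
def cf (x : ℝ) : ℝ := 2 / (1 - x ^ 2)

/-- `1 + 4τ²x²`. -/
def ee (τ x : ℝ) : ℝ := 1 + 4 * τ ^ 2 * x ^ 2

/-- Square of the length of the unnormalized normal vector of a rotational surface. -/
def nsq (τ x x' t' : ℝ) : ℝ := t' ^ 2 + cf x ^ 2 * x' ^ 2 * ee τ x

/-- Unnormalized normal vector of a rotational surface at rotation angle `0`. -/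
def nvec (τ x x' t' : ℝ) : Pt := ![-t' / cf x, 2 * τ * x * x', cf x * x' * ee τ x]

/-- Derivative of the first integral, divided by `x'`. -/
def curvJ (τ x x' t' x'' t'' : ℝ) : ℝ :=
  cf x ^ 2 * (1 + x ^ 2) * t' / (2 * √(nsq τ x x' t'))
    + cf x ^ 3 * x * (ee τ x * (x' * t'' - t' * x'')
      - t' * x' ^ 2 * x * (cf x * ee τ x + 4 * τ ^ 2)) / √(nsq τ x x' t') ^ 3

theorem ee_pos (τ x : ℝ) : 0 < ee τ x := by unfold ee; positivity

theorem one_sub_sq_pos {x : ℝ} (hx : |x| < 1) : 0 < 1 - x ^ 2 := by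
  have := (sq_lt_one_iff_abs_lt_one x).2 hx
  linarith

theorem cf_pos {x : ℝ} (hx : |x| < 1) : 0 < cf x := div_pos two_pos (one_sub_sq_pos hx)

theorem cf_mul {x : ℝ} (hx : |x| < 1) : cf x * (1 - x ^ 2) = 2 :=
  div_mul_cancel₀ _ (one_sub_sq_pos hx).ne'

theorem nsq_pos {τ x x' t' : ℝ} (hx : |x| < 1) (h : x' ≠ 0 ∨ t' ≠ 0) : 0 < nsq τ x x' t' := by
  have h1 := cf_pos hx
  have h2 := ee_pos τ x
  unfold nsq
  rcases h with h | h <;> positivity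

theorem lam_vec (x t : ℝ) : lam ![x, 0, t] = cf x := by simp [lam, cf]

theorem rot_smul (θ k : ℝ) (v : Pt) : rot θ (k • v) = k • rot θ v := by
  ext i; fin_cases i <;> simp [rot] <;> ring

theorem metric_smul_right (τ k : ℝ) (p v w : Pt) : metric τ p v (k • w) = k * metric τ p v w := by
  simp [metric, connForm]; ring

theorem rotMap_mem {x t : ℝ → ℝ} {q : ℝ × ℝ} (hx : |x q.1| < 1) : rotMap x t q ∈ ambient := by
  change rotMap x t q 0 ^ 2 + rotMap x t q 1 ^ 2 < 1
  rw [rotMap_eq_rot, rot_normSq]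
  have := one_sub_sq_pos hx
  simp; linarith

theorem isUnitNormalAt_rotMap (τ : ℝ) {x t : ℝ → ℝ} {q : ℝ × ℝ} {x' t' : ℝ}
    (hx : HasDerivAt x x' q.1) (ht : HasDerivAt t t' q.1) (h1 : |x q.1| < 1)
    (h2 : x' ≠ 0 ∨ t' ≠ 0) {k : ℝ} (hk : k ^ 2 = 1) :
    IsUnitNormalAt τ (rotMap x t)
      (rot q.2 ((k / √(nsq τ (x q.1) x' t')) • nvec τ (x q.1) x' t')) q := by
  have hL := cf_pos h1
  have hW := nsq_pos (τ := τ) h1 h2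
  have hLm := cf_mul h1
  have hW2 := Real.sq_sqrt hW.le
  have hW1 := Real.sqrt_pos.2 hW
  set L := cf (x q.1) with hLdef
  set W := √(nsq τ (x q.1) x' t') with hWdef
  constructor
  · rw [rotMap_eq_rot, metric_rot]
    have : metric τ ![x q.1, 0, t q.1] (nvec τ (x q.1) x' t') (nvec τ (x q.1) x' t')
        = nsq τ (x q.1) x' t' := by
      simp only [metric, connForm, lam_vec, nvec, nsq, ← hLdef, ee]
      simp
      field_simp
      ring
    rw [metric_smul_right, metric_symm, metric_smul_right, this, ← hW2]
    field_simp
    exact hk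
  · intro v
    rw [dX_rotMap hx ht, rotMap_eq_rot, metric_rot, metric_smul_right]
    have : metric τ ![x q.1, 0, t q.1] ![x' * v.1, x q.1 * v.2, t' * v.1]
        (nvec τ (x q.1) x' t') = 0 := by
      simp only [metric, connForm, lam_vec, nvec, ← hLdef, ee]
      simp
      field_simp
      ring
    rw [this, mul_zero]

/-- The same `curvJ` appears in the derivative of the first integral; this coincidence is what makes
the equation integrable. The factor k allows for both orientations. -/
theorem meanCurvature_rotMap (τ : ℝ) {x t : ℝ → ℝ} {q : ℝ × ℝ}
    (hx : ∀ᶠ s in 𝓝 q.1, DifferentiableAt ℝ x s)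
    (ht : ∀ᶠ s in 𝓝 q.1, DifferentiableAt ℝ t s) {x'' t'' : ℝ}
    (hx2 : HasDerivAt (deriv x) x'' q.1) (ht2 : HasDerivAt (deriv t) t'' q.1)
    (h1 : |x q.1| < 1) (h0 : x q.1 ≠ 0) (h2 : deriv x q.1 ≠ 0 ∨ deriv t q.1 ≠ 0) (k : ℝ) :
    meanCurvature τ (rotMap x t) (rot q.2 ((k / √(nsq τ (x q.1) (deriv x q.1) (deriv t q.1))) •
        nvec τ (x q.1) (deriv x q.1) (deriv t q.1))) q
      = k * curvJ τ (x q.1) (deriv x q.1) (deriv t q.1) x'' t'' / (2 * cf (x q.1) ^ 2 * x q.1) := by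
  have hL := cf_pos h1
  have hW := nsq_pos (τ := τ) h1 h2
  have hLm := cf_mul h1
  have hW2 := Real.sq_sqrt hW.le
  have hW1 := Real.sqrt_pos.2 hW
  have hxd := hx.self_of_nhds.hasDerivAt
  have htd := ht.self_of_nhds.hasDerivAt
  simp only [meanCurvature, secondForm_eq τ (rotMap_mem (t := t) h1), firstForm,
    dX_dX_rotMap hx ht hx2 ht2, dX_rotMap hxd htd]
  rw [rotMap_eq_rot]
  simp only [metric_rot, dmetric_rot]
  simp only [curvJ]
  set x0 := x q.1
  set a := deriv x q.1
  set b := deriv t q.1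
  set W := √(nsq τ x0 a b) with hWdef
  have hWs : W ^ 2 = b ^ 2 + cf x0 ^ 2 * a ^ 2 * (1 + 4 * τ ^ 2 * x0 ^ 2) := hW2
  simp only [metric, connForm, dmetric, dconn, lam_vec, nvec, ee]
  set L := cf x0 with hLdef
  have hy : 1 - x0 ^ 2 ≠ 0 := (one_sub_sq_pos h1).ne'
  have hLe : L = 2 / (1 - x0 ^ 2) := rfl
  set m := k / W with hm
  have hk : k = m * W := by rw [hm]; field_simp
  rw [hk]
  -- D is EG − F². Splitting off D and the odd powers of W leaves an identity involving W² only,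
  -- which is rational in the data.
  have hden : ∀ D : ℝ, D = L ^ 2 * x0 ^ 2 * W ^ 2 → ∀ N A B : ℝ,
      N * 2 = m * x0 * (A * W ^ 2 + 2 * B) → N / (2 * D) = m * W * (A / (2 * W) + B / W ^ 3) /
        (2 * L ^ 2 * x0) := by
    rintro D rfl N A B h
    have : N = m * x0 * (A * W ^ 2 + 2 * B) / 2 := by linarith
    rw [this]
    field_simp
  simp
  apply hden
  · rw [hWs]; ring
  · rw [hWs, hLe]
    field_simp
    ring

/-! ### Generating curves and the first integral -/

/-- The first integral: the flux of the vertical Killing field. -/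
def firstInt (τ x x' t' : ℝ) : ℝ := cf x * x * t' / √(nsq τ x x' t')

/-- A smooth regular curve in the disk, on an open set of parameters. -/
structure IsGenerating (I : Set ℝ) (x t : ℝ → ℝ) : Prop where
  isOpen : IsOpen I
  smooth_x : ContDiffOn ℝ ∞ x I
  smooth_t : ContDiffOn ℝ ∞ t I
  lt_one : ∀ s ∈ I, |x s| < 1
  regular : ∀ s ∈ I, deriv x s ≠ 0 ∨ deriv t s ≠ 0

theorem contDiffOn_deriv {f : ℝ → ℝ} {I : Set ℝ} (hI : IsOpen I) (hf : ContDiffOn ℝ ∞ f I) :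
    ContDiffOn ℝ ∞ (deriv f) I :=
  hf.deriv_of_isOpen hI (by simp)

theorem hasDerivAt_of_contDiffOn {f : ℝ → ℝ} {I : Set ℝ} (hI : IsOpen I)
    (hf : ContDiffOn ℝ ∞ f I) {s : ℝ} (hs : s ∈ I) : HasDerivAt f (deriv f s) s :=
  ((hf.contDiffAt (hI.mem_nhds hs)).differentiableAt (by simp)).hasDerivAt

theorem eventually_differentiableAt {f : ℝ → ℝ} {I : Set ℝ} (hI : IsOpen I)
    (hf : ContDiffOn ℝ ∞ f I) {s : ℝ} (hs : s ∈ I) : ∀ᶠ y in 𝓝 s, DifferentiableAt ℝ f y := by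
  filter_upwards [hI.mem_nhds hs] with y hy
  exact (hasDerivAt_of_contDiffOn hI hf hy).differentiableAt

theorem hasDerivAt_cf {x : ℝ → ℝ} {s x' : ℝ} (hx : HasDerivAt x x' s) (h1 : |x s| < 1) :
    HasDerivAt (fun s => cf (x s)) (cf (x s) ^ 2 * x s * x') s := by
  have h := one_sub_sq_pos h1
  refine ((hasDerivAt_const s (2 : ℝ)).div ((hx.pow 2).const_sub 1) h.ne').congr_deriv ?_
  simp only [cf, Pi.pow_apply]
  field_simp
  push_cast
  ring

/-- Divisibility of the derivative by x' is the point: (cosh ρ)' carries the same factor, so the two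
can be compared. -/
theorem hasDerivAt_firstInt (τ : ℝ) {x t : ℝ → ℝ} {s x'' t'' : ℝ}
    (hx : HasDerivAt x (deriv x s) s)
    (hx2 : HasDerivAt (deriv x) x'' s) (ht2 : HasDerivAt (deriv t) t'' s)
    (h1 : |x s| < 1) (h2 : deriv x s ≠ 0 ∨ deriv t s ≠ 0) :
    HasDerivAt (fun s => firstInt τ (x s) (deriv x s) (deriv t s))
      (deriv x s * curvJ τ (x s) (deriv x s) (deriv t s) x'' t'') s := by
  have hW := nsq_pos (τ := τ) h1 h2
  have hW1 := Real.sqrt_pos.2 hW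
  have hW2 := Real.sq_sqrt hW.le
  have hL := hasDerivAt_cf hx h1
  have hL0 := cf_pos h1
  have hLm := cf_mul h1
  have hE : HasDerivAt (fun s => ee τ (x s)) (8 * τ ^ 2 * x s * deriv x s) s := by
    refine (((hx.pow 2).const_mul (4 * τ ^ 2)).const_add 1).congr_deriv ?_
    push_cast; ring
  have hn := (ht2.pow 2).add (((hL.pow 2).mul (hx2.pow 2)).mul hE)
  have hsq := hn.sqrt (by simpa [nsq] using hW.ne')
  have h := ((hL.mul hx).mul ht2).div hsq (by simpa [nsq] using hW1.ne')
  refine h.congr_deriv ?_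
  simp only [Pi.add_apply, Pi.mul_apply, Pi.pow_apply]
  simp only [curvJ]
  change _ / (√(nsq τ (x s) (deriv x s) (deriv t s))) ^ 2 = _
  change (_ * √(nsq τ (x s) (deriv x s) (deriv t s)) -
    _ * (_ / (2 * √(nsq τ (x s) (deriv x s) (deriv t s))))) / _ = _
  have hW3 : √(nsq τ (x s) (deriv x s) (deriv t s)) ^ 2 = deriv t s ^ 2
    + cf (x s) ^ 2 * deriv x s ^ 2 * (1 + 4 * τ ^ 2 * x s ^ 2) := hW2
  simp only [ee]
  set W := √(nsq τ (x s) (deriv x s) (deriv t s))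
  have hy : 1 - x s ^ 2 ≠ 0 := (one_sub_sq_pos h1).ne'
  have hLe : cf (x s) = 2 / (1 - x s ^ 2) := rfl
  have key : ∀ A B C D : ℝ, 2 * A * W ^ 2 - B * C = D * W ^ 2 →
     (A * W - B * (C / (2 * W))) / W ^ 2 = D / (2 * W) := by
    intro A B C D h
    field_simp
    linarith
  have key2 : ∀ A B : ℝ, deriv x s * (A / (2 * W) + B / W ^ 3)
      = (deriv x s * (A + 2 * B / W ^ 2)) / (2 * W) := by
    intro A B; field_simp
  rw [key2]
  apply key
  have key3 : ∀ A B : ℝ, deriv x s * (A + 2 * B / W ^ 2) * W ^ 2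
    = deriv x s * (A * W ^ 2 + 2 * B) := by
    intro A B; field_simp
  rw [key3, hW3, hLe]
  simp only [Nat.cast_ofNat, Nat.add_one_sub_one, pow_one]
  field_simp
  ring

/-- Serves to divide by x or by x' where these have isolated zeros, and to recover the quotient
identity at the zeros by continuity. -/
theorem eq_zero_of_eventually_punctured {f : ℝ → ℝ} {s : ℝ} (hf : ContinuousAt f s)
    (h : ∀ᶠ y in 𝓝[≠] s, f y = 0) : f s = 0 :=
  tendsto_nhds_unique (hf.tendsto.mono_left nhdsWithin_le_nhds)
    (tendsto_const_nhds.congr' (h.mono fun _ hy => hy.symm))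

theorem continuousOn_cf {I : Set ℝ} {x : ℝ → ℝ} (hx : ContinuousOn x I)
    (h1 : ∀ s ∈ I, |x s| < 1) : ContinuousOn (fun s => cf (x s)) I :=
  continuousOn_const.div (by fun_prop) fun s hs => (one_sub_sq_pos (h1 s hs)).ne'

namespace IsGenerating

theorem continuousOn_nsq {I : Set ℝ} {x t : ℝ → ℝ} (h : IsGenerating I x t) (τ : ℝ) :
    ContinuousOn (fun s => nsq τ (x s) (deriv x s) (deriv t s)) I := by
  have c1 := h.smooth_x.continuousOn
  have c2 := (contDiffOn_deriv h.isOpen h.smooth_x).continuousOn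
  have c3 := (contDiffOn_deriv h.isOpen h.smooth_t).continuousOn
  have c4 := continuousOn_cf c1 h.lt_one
  unfold nsq ee
  fun_prop

theorem continuousOn_curvJ {I : Set ℝ} {x t : ℝ → ℝ} (h : IsGenerating I x t) (τ : ℝ) :
    ContinuousOn (fun s => curvJ τ (x s) (deriv x s) (deriv t s) (deriv (deriv x) s)
      (deriv (deriv t) s)) I := by
  have c1 := h.smooth_x.continuousOn
  have c2 := (contDiffOn_deriv h.isOpen h.smooth_x)
  have c3 := (contDiffOn_deriv h.isOpen h.smooth_t)
  have c4 := continuousOn_cf c1 h.lt_one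
  have c5 := (contDiffOn_deriv h.isOpen c2).continuousOn
  have c6 := (contDiffOn_deriv h.isOpen c3).continuousOn
  have c2' := c2.continuousOn
  have c3' := c3.continuousOn
  have c7 := (h.continuousOn_nsq τ).sqrt
  have c8 : ∀ s ∈ I, √(nsq τ (x s) (deriv x s) (deriv t s)) ≠ 0 := fun s hs =>
    (Real.sqrt_pos.2 (nsq_pos (h.lt_one s hs) (h.regular s hs))).ne'
  unfold curvJ ee
  refine ContinuousOn.add (ContinuousOn.div (by fun_prop) (by fun_prop) ?_)
    (ContinuousOn.div (by fun_prop) (by fun_prop) ?_)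
  · intro s hs; exact mul_ne_zero two_ne_zero (c8 s hs)
  · intro s hs; exact pow_ne_zero _ (c8 s hs)

theorem hasDerivAt_firstInt {I : Set ℝ} {x t : ℝ → ℝ} (h : IsGenerating I x t) (τ : ℝ) {s : ℝ}
    (hs : s ∈ I) : HasDerivAt (fun s => firstInt τ (x s) (deriv x s) (deriv t s))
      (deriv x s * curvJ τ (x s) (deriv x s) (deriv t s) (deriv (deriv x) s)
        (deriv (deriv t) s)) s :=
  PSL2Tilde.hasDerivAt_firstInt τ (hasDerivAt_of_contDiffOn h.isOpen h.smooth_x hs)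
    (hasDerivAt_of_contDiffOn h.isOpen (contDiffOn_deriv h.isOpen h.smooth_x) hs)
    (hasDerivAt_of_contDiffOn h.isOpen (contDiffOn_deriv h.isOpen h.smooth_t) hs)
    (h.lt_one s hs) (h.regular s hs)

end IsGenerating

/-- Hyperbolic cosine of the distance to the axis, as a function of the signed distance in the
disk. -/
def ch (x : ℝ) : ℝ := (1 + x ^ 2) / (1 - x ^ 2)

theorem hasDerivAt_ch {x : ℝ → ℝ} {s x' : ℝ} (hx : HasDerivAt x x' s) (h1 : |x s| < 1) :
    HasDerivAt (fun s => ch (x s)) (cf (x s) ^ 2 * x s * x') s := by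
  have h := one_sub_sq_pos h1
  refine (((hx.pow 2).const_add 1).div ((hx.pow 2).const_sub 1) h.ne').congr_deriv ?_
  simp only [cf, Pi.pow_apply]
  field_simp
  push_cast
  ring

/-- If the first integral has the form `2H cosh ρ + d` and the derivative of `x` has isolated zeros,
then the curvature quantity `curvJ` is the one of a surface of mean curvature `H`. -/
theorem IsGenerating.curvJ_eq {I : Set ℝ} {x t : ℝ → ℝ} (h : IsGenerating I x t) {τ H d : ℝ}
    (hP : ∀ s ∈ I, firstInt τ (x s) (deriv x s) (deriv t s) = 2 * H * ch (x s) + d)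
    (hx' : ∀ s ∈ I, ∀ᶠ y in 𝓝[≠] s, deriv x y ≠ 0) {s : ℝ} (hs : s ∈ I) :
    curvJ τ (x s) (deriv x s) (deriv t s) (deriv (deriv x) s) (deriv (deriv t) s)
      = 2 * H * cf (x s) ^ 2 * x s := by
  have hI := h.isOpen
  have hc : ContinuousOn (fun s => curvJ τ (x s) (deriv x s) (deriv t s) (deriv (deriv x) s)
      (deriv (deriv t) s) - 2 * H * cf (x s) ^ 2 * x s) I := by
    have c1 := h.smooth_x.continuousOn
    have c4 := continuousOn_cf c1 h.lt_one
    exact (h.continuousOn_curvJ τ).sub (by fun_prop)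
  -- Both sides of `hP` have derivatives that are multiples of x'; the factor is cancelled off its
  -- isolated zeros.
  have := eq_zero_of_eventually_punctured (hc.continuousAt (hI.mem_nhds hs)) (by
    filter_upwards [hx' s hs, nhdsWithin_le_nhds (hI.mem_nhds hs)] with y hy hyI
    have h1 := h.hasDerivAt_firstInt τ hyI
    have h2 := ((hasDerivAt_ch (hasDerivAt_of_contDiffOn hI h.smooth_x hyI)
      (h.lt_one y hyI)).const_mul (2 * H)).add_const d
    have h3 := h1.unique (h2.congr_of_eventuallyEq (by
      filter_upwards [hI.mem_nhds hyI] with z hz using hP z hz))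
    have : deriv x y * (curvJ τ (x y) (deriv x y) (deriv t y) (deriv (deriv x) y)
      (deriv (deriv t) y) - 2 * H * cf (x y) ^ 2 * x y) = 0 := by linarith
    simpa [hy] using this)
  exact sub_eq_zero.1 this

/-- The unit normal field along a rotational surface. -/
def normalField (τ : ℝ) (x t : ℝ → ℝ) (q : ℝ × ℝ) : Pt :=
  rot q.2 ((1 / √(nsq τ (x q.1) (deriv x q.1) (deriv t q.1))) •
    nvec τ (x q.1) (deriv x q.1) (deriv t q.1))

theorem IsGenerating.continuousOn_normalField {I : Set ℝ} {x t : ℝ → ℝ} (h : IsGenerating I x t)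
    (τ : ℝ) : ContinuousOn (normalField τ x t) (I ×ˢ univ) := by
  have hf : MapsTo (Prod.fst : ℝ × ℝ → ℝ) (I ×ˢ univ) I := fun q hq => hq.1
  have c1 := h.smooth_x.continuousOn.comp continuousOn_fst hf
  have c2 := (contDiffOn_deriv h.isOpen h.smooth_x).continuousOn.comp continuousOn_fst hf
  have c3 := (contDiffOn_deriv h.isOpen h.smooth_t).continuousOn.comp continuousOn_fst hf
  have c4 := (continuousOn_cf h.smooth_x.continuousOn h.lt_one).comp continuousOn_fst hf
  have c5 : ContinuousOn (fun q : ℝ × ℝ => 1 / √(nsq τ (x q.1) (deriv x q.1) (deriv t q.1)))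
      (I ×ˢ univ) := by
    refine continuousOn_const.div ((h.continuousOn_nsq τ).sqrt.comp continuousOn_fst hf) ?_
    intro q hq
    exact (Real.sqrt_pos.2 (nsq_pos (h.lt_one _ hq.1) (h.regular _ hq.1))).ne'
  have c6 : ContinuousOn (fun q : ℝ × ℝ => -deriv t q.1 / cf (x q.1)) (I ×ˢ univ) :=
    c3.neg.div c4 fun q hq => (cf_pos (h.lt_one _ hq.1)).ne'
  simp only [Function.comp_def] at c1 c2 c3 c4
  have hcos : ContinuousOn (fun q : ℝ × ℝ => Real.cos q.2) (I ×ˢ univ) := by fun_prop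
  have hsin : ContinuousOn (fun q : ℝ × ℝ => Real.sin q.2) (I ×ˢ univ) := by fun_prop
  have c7 : ContinuousOn (fun q : ℝ × ℝ => 2 * τ * x q.1 * deriv x q.1) (I ×ˢ univ) :=
    (continuousOn_const.mul c1).mul c2
  have c8 : ContinuousOn (fun q : ℝ × ℝ => cf (x q.1) * deriv x q.1 * ee τ (x q.1))
      (I ×ˢ univ) :=
    (c4.mul c2).mul (continuousOn_const.add (continuousOn_const.mul (c1.pow 2)))
  rw [continuousOn_pi]
  intro i
  fin_cases i
  · exact (((c5.mul c6).mul hcos).sub ((c5.mul c7).mul hsin)).congr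
      fun q _ => by simp [normalField, rot, nvec]
  · exact (((c5.mul c6).mul hsin).add ((c5.mul c7).mul hcos)).congr
      fun q _ => by simp [normalField, rot, nvec]
  · exact (c5.mul c8).congr fun q _ => by simp [normalField, rot, nvec]

theorem IsGenerating.isUnitNormalAt {I : Set ℝ} {x t : ℝ → ℝ} (h : IsGenerating I x t)
    (τ : ℝ) {q : ℝ × ℝ} (hq : q.1 ∈ I) :
    IsUnitNormalAt τ (rotMap x t) (normalField τ x t q) q :=
  isUnitNormalAt_rotMap τ (hasDerivAt_of_contDiffOn h.isOpen h.smooth_x hq)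
    (hasDerivAt_of_contDiffOn h.isOpen h.smooth_t hq) (h.lt_one _ hq) (h.regular _ hq) (by norm_num)

theorem IsGenerating.meanCurvature_smul {I : Set ℝ} {x t : ℝ → ℝ} (h : IsGenerating I x t)
    (τ k : ℝ) {q : ℝ × ℝ} (hq : q.1 ∈ I) (h0 : x q.1 ≠ 0) :
    meanCurvature τ (rotMap x t) (k • normalField τ x t q) q
      = k * curvJ τ (x q.1) (deriv x q.1) (deriv t q.1) (deriv (deriv x) q.1)
        (deriv (deriv t) q.1) / (2 * cf (x q.1) ^ 2 * x q.1) := by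
  have e : k • normalField τ x t q = rot q.2 ((k / √(nsq τ (x q.1) (deriv x q.1) (deriv t q.1))) •
    nvec τ (x q.1) (deriv x q.1) (deriv t q.1)) := by
    rw [normalField, ← rot_smul, smul_smul, mul_one_div]
  rw [e]
  exact meanCurvature_rotMap τ (eventually_differentiableAt h.isOpen h.smooth_x hq)
    (eventually_differentiableAt h.isOpen h.smooth_t hq)
    (hasDerivAt_of_contDiffOn h.isOpen (contDiffOn_deriv h.isOpen h.smooth_x) hq)
    (hasDerivAt_of_contDiffOn h.isOpen (contDiffOn_deriv h.isOpen h.smooth_t) hq)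
    (h.lt_one _ hq) h0 (h.regular _ hq) k

theorem IsGenerating.meanCurvature_eq {I : Set ℝ} {x t : ℝ → ℝ} (h : IsGenerating I x t)
    {τ H : ℝ} {q : ℝ × ℝ} (hq : q.1 ∈ I) (h0 : x q.1 ≠ 0)
    (hJ : curvJ τ (x q.1) (deriv x q.1) (deriv t q.1) (deriv (deriv x) q.1) (deriv (deriv t) q.1)
      = 2 * H * cf (x q.1) ^ 2 * x q.1) :
    meanCurvature τ (rotMap x t) (normalField τ x t q) q = H := by
  have := h.meanCurvature_smul τ 1 hq h0
  rw [one_smul, one_mul, hJ] at this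
  rw [this]
  have := (cf_pos (h.lt_one _ hq)).ne'
  field_simp

theorem IsGenerating.isRotationalHSurface {I : Set ℝ} {x t : ℝ → ℝ} (h : IsGenerating I x t)
    {τ H : ℝ} (hc : I.OrdConnected) (hne : I.Nonempty) (h0 : ∀ s ∈ I, x s = 0 → deriv t s = 0)
    (hJ : ∀ s ∈ I, curvJ τ (x s) (deriv x s) (deriv t s) (deriv (deriv x) s) (deriv (deriv t) s)
      = 2 * H * cf (x s) ^ 2 * x s) :
    IsRotationalHSurface τ H (rotMap x t '' (I ×ˢ univ)) :=
  ⟨I, x, t, h.isOpen, hc, hne, h.smooth_x, h.smooth_t, h.lt_one, h.regular, h0,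
    ⟨normalField τ x t, h.continuousOn_normalField τ, fun _ hq =>
      ⟨h.isUnitNormalAt τ hq.1, fun hx => h.meanCurvature_eq hq.1 hx (hJ _ hq.1)⟩⟩, rfl⟩

theorem contDiffOn_rotMap {I : Set ℝ} {x t : ℝ → ℝ} (hx : ContDiffOn ℝ ∞ x I)
    (ht : ContDiffOn ℝ ∞ t I) : ContDiffOn ℝ ∞ (rotMap x t) (I ×ˢ univ) := by
  have hf : MapsTo (Prod.fst : ℝ × ℝ → ℝ) (I ×ˢ univ) I := fun q hq => hq.1
  have c1 := hx.comp contDiffOn_fst hf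
  have c2 := ht.comp contDiffOn_fst hf
  simp only [Function.comp_def] at c1 c2
  rw [contDiffOn_pi]
  intro i
  fin_cases i
  · exact c1.mul (Real.contDiff_cos.comp contDiff_snd).contDiffOn
  · exact c1.mul (Real.contDiff_sin.comp contDiff_snd).contDiffOn
  · exact c2

theorem rot_injective (θ : ℝ) : Function.Injective (rot θ) := by
  intro v w h
  have h0 := congrFun h 0
  have h1 := congrFun h 1
  have h2 := congrFun h 2
  simp only [rot, Matrix.cons_val_zero, Matrix.cons_val_one, Matrix.cons_val] at h0 h1 h2
  have hs := Real.sin_sq_add_cos_sq θ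
  ext i; fin_cases i
  · simp only [Fin.zero_eta]
    linear_combination Real.cos θ * h0 + Real.sin θ * h1 - (v 0 - w 0) * hs
  · simp only [Fin.mk_one]
    linear_combination -Real.sin θ * h0 + Real.cos θ * h1 - (v 1 - w 1) * hs
  · exact h2

theorem IsGenerating.isHImmersion {I : Set ℝ} {x t : ℝ → ℝ} (h : IsGenerating I x t)
    {τ H : ℝ} (h0 : ∀ s ∈ I, x s ≠ 0)
    (hJ : ∀ s ∈ I, curvJ τ (x s) (deriv x s) (deriv t s) (deriv (deriv x) s) (deriv (deriv t) s)
      = 2 * H * cf (x s) ^ 2 * x s) :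
    IsHImmersion τ H (I ×ˢ univ) (rotMap x t) where
  isOpen := h.isOpen.prod isOpen_univ
  smooth := contDiffOn_rotMap h.smooth_x h.smooth_t
  maps q hq := rotMap_mem (h.lt_one _ hq.1)
  immersion q hq := by
    have e := dX_rotMap (hasDerivAt_of_contDiffOn h.isOpen h.smooth_x hq.1)
      (hasDerivAt_of_contDiffOn h.isOpen h.smooth_t hq.1)
    intro v w hvw
    have e1 := rot_injective _ ((e v).symm.trans (hvw.trans (e w)))
    have a0 := congrFun e1 0
    have a1 := congrFun e1 1
    have a2 := congrFun e1 2
    simp [h0 _ hq.1] at a0 a1 a2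
    ext
    · rcases h.regular _ hq.1 with h' | h'
      · simpa [h'] using a0
      · simpa [h'] using a2
    · exact a1
  cmc := ⟨normalField τ x t, h.continuousOn_normalField τ, fun _ hq =>
      ⟨h.isUnitNormalAt τ hq.1, h.meanCurvature_eq hq.1 (h0 _ hq.1) (hJ _ hq.1)⟩⟩

/-! ### Mean curvature of a rotationally symmetric graph -/

/-- Square of the length of the unnormalized normal vector of the graph of `U (x² + y²)`, where `u`
is the value of the derivative of `U` at `w = x² + y²`. -/
def graphNsq (τ w u : ℝ) : ℝ := 1 + 4 * τ ^ 2 * w + w * u ^ 2 * (1 - w) ^ 2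

/-- Unnormalized normal vector of a rotationally symmetric graph. -/
def graphNvec (τ a b u : ℝ) : Pt :=
  ![-(2 * τ * b + a * u * (1 - (a ^ 2 + b ^ 2))) * (1 - (a ^ 2 + b ^ 2)) / 2,
    -(-2 * τ * a + b * u * (1 - (a ^ 2 + b ^ 2))) * (1 - (a ^ 2 + b ^ 2)) / 2,
    1 + 4 * τ ^ 2 * (a ^ 2 + b ^ 2)]

theorem graphNsq_pos {τ w u : ℝ} (hw : 0 ≤ w) : 0 < graphNsq τ w u := by
  unfold graphNsq; positivity

theorem hasFDerivAt_normSq (q : ℝ × ℝ) : HasFDerivAt (fun q : ℝ × ℝ => q.1 ^ 2 + q.2 ^ 2)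
    ((2 * q.1) • ContinuousLinearMap.fst ℝ ℝ ℝ + (2 * q.2) • ContinuousLinearMap.snd ℝ ℝ ℝ) q := by
  have h1 := hasFDerivAt_comp_fst (q := q) (hasDerivAt_pow 2 q.1)
  have h2 := hasFDerivAt_comp_snd (q := q) (hasDerivAt_pow 2 q.2)
  refine (h1.add h2).congr_fderiv ?_
  ext <;> simp

theorem hasFDerivAt_radial {U : ℝ → ℝ} {q : ℝ × ℝ} {u : ℝ}
    (hU : HasDerivAt U u (q.1 ^ 2 + q.2 ^ 2)) :
    HasFDerivAt (fun q : ℝ × ℝ => U (q.1 ^ 2 + q.2 ^ 2))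
      (u • ((2 * q.1) • ContinuousLinearMap.fst ℝ ℝ ℝ
        + (2 * q.2) • ContinuousLinearMap.snd ℝ ℝ ℝ)) q :=
  hU.comp_hasFDerivAt q (hasFDerivAt_normSq q)

theorem dX_graphMap {U : ℝ → ℝ} {q : ℝ × ℝ} {u : ℝ} (hU : HasDerivAt U u (q.1 ^ 2 + q.2 ^ 2))
    (v : ℝ × ℝ) : dX (graphMap fun q => U (q.1 ^ 2 + q.2 ^ 2)) v q
      = ![v.1, v.2, u * (2 * q.1 * v.1 + 2 * q.2 * v.2)] := by
  refine (dX_vec hasFDerivAt_fst hasFDerivAt_snd (hasFDerivAt_radial hU) v).trans ?_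
  ext i; fin_cases i <;> simp
  ring

theorem dX_dX_graphMap {U U' : ℝ → ℝ} {q : ℝ × ℝ} {u2 : ℝ}
    (hU : ∀ᶠ w in 𝓝 (q.1 ^ 2 + q.2 ^ 2), HasDerivAt U (U' w) w)
    (hU' : HasDerivAt U' u2 (q.1 ^ 2 + q.2 ^ 2)) (v w : ℝ × ℝ) :
    dX (dX (graphMap fun q => U (q.1 ^ 2 + q.2 ^ 2)) w) v q
      = ![0, 0, u2 * (2 * q.1 * v.1 + 2 * q.2 * v.2) * (2 * q.1 * w.1 + 2 * q.2 * w.2)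
        + U' (q.1 ^ 2 + q.2 ^ 2) * (2 * v.1 * w.1 + 2 * v.2 * w.2)] := by
  have hev : dX (graphMap fun q => U (q.1 ^ 2 + q.2 ^ 2)) w =ᶠ[𝓝 q] fun q =>
      ![w.1, w.2, U' (q.1 ^ 2 + q.2 ^ 2) * (2 * q.1 * w.1 + 2 * q.2 * w.2)] := by
    have hc : ContinuousAt (fun q : ℝ × ℝ => q.1 ^ 2 + q.2 ^ 2) q := by fun_prop
    filter_upwards [hc.eventually hU] with r hr
    exact dX_graphMap hr w
  rw [dX, hev.fderiv_eq]
  have h1 : HasFDerivAt (fun q : ℝ × ℝ => 2 * q.1 * w.1 + 2 * q.2 * w.2)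
      ((2 * w.1) • ContinuousLinearMap.fst ℝ ℝ ℝ + (2 * w.2) • ContinuousLinearMap.snd ℝ ℝ ℝ) q := by
    refine (((hasFDerivAt_fst.const_mul 2).mul_const w.1).add
      ((hasFDerivAt_snd.const_mul 2).mul_const w.2)).congr_fderiv ?_
    ext <;> simp <;> ring
  refine (dX_vec (hasFDerivAt_const _ _) (hasFDerivAt_const _ _)
    ((hasFDerivAt_radial hU').mul h1) v).trans ?_
  ext i; fin_cases i <;> simp
  ring

theorem isUnitNormalAt_graphMap (τ : ℝ) {U : ℝ → ℝ} {q : ℝ × ℝ} {u : ℝ} (hq : q ∈ disk)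
    (hU : HasDerivAt U u (q.1 ^ 2 + q.2 ^ 2)) :
    IsUnitNormalAt τ (graphMap fun q => U (q.1 ^ 2 + q.2 ^ 2))
      ((1 / √(graphNsq τ (q.1 ^ 2 + q.2 ^ 2) u)) • graphNvec τ q.1 q.2 u) q := by
  have hy : 1 - (q.1 ^ 2 + q.2 ^ 2) ≠ 0 := by
    have : q.1 ^ 2 + q.2 ^ 2 < 1 := hq
    linarith
  have hW := graphNsq_pos (τ := τ) (u := u) (show 0 ≤ q.1 ^ 2 + q.2 ^ 2 by positivity)
  have hW2 := Real.sq_sqrt hW.le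
  have hW1 := Real.sqrt_pos.2 hW
  set p := graphMap (fun q => U (q.1 ^ 2 + q.2 ^ 2)) q
  have hlam : lam p = 2 / (1 - (q.1 ^ 2 + q.2 ^ 2)) := rfl
  have p0 : p 0 = q.1 := rfl
  have p1 : p 1 = q.2 := rfl
  constructor
  · have : metric τ p (graphNvec τ q.1 q.2 u) (graphNvec τ q.1 q.2 u)
        = graphNsq τ (q.1 ^ 2 + q.2 ^ 2) u := by
      simp only [metric, connForm, hlam, p0, p1, graphNvec, graphNsq]
      simp
      field_simp
      ring
    rw [metric_smul_right, metric_symm, metric_smul_right, this]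
    nth_rw 3 [← hW2]
    field_simp
  · intro v
    rw [dX_graphMap hU, metric_smul_right]
    have : metric τ p ![v.1, v.2, u * (2 * q.1 * v.1 + 2 * q.2 * v.2)]
        (graphNvec τ q.1 q.2 u) = 0 := by
      simp only [metric, connForm, hlam, p0, p1, graphNvec]
      simp
      field_simp
      ring
    rw [this, mul_zero]

/-- `rotMap` is not an immersion on the axis, so the tip of the graph needs this separate formula.
The large bracket is the derivative in w of w·u/√(`graphNsq`), with u = U'(w). -/
theorem meanCurvature_graphMap (τ : ℝ) {U U' : ℝ → ℝ} {q : ℝ × ℝ} {u u2 w : ℝ} (hq : q ∈ disk)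
    (hw : q.1 ^ 2 + q.2 ^ 2 = w) (hu : U' w = u)
    (hU : ∀ᶠ w in 𝓝 w, HasDerivAt U (U' w) w) (hU' : HasDerivAt U' u2 w) :
    meanCurvature τ (graphMap fun q => U (q.1 ^ 2 + q.2 ^ 2))
      ((1 / √(graphNsq τ w u)) • graphNvec τ q.1 q.2 u) q
      = (1 - w) ^ 2 / 2 * (u / √(graphNsq τ w u) + w * (u2 / √(graphNsq τ w u)
        - u * (4 * τ ^ 2 + u ^ 2 * (1 - w) ^ 2 + 2 * w * u * u2 * (1 - w) ^ 2
          - 2 * w * u ^ 2 * (1 - w)) / (2 * √(graphNsq τ w u) ^ 3))) := by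
  subst hw hu
  have hq' : q.1 ^ 2 + q.2 ^ 2 < 1 := hq
  have hy : 1 - (q.1 ^ 2 + q.2 ^ 2) ≠ 0 := by linarith
  have hW := graphNsq_pos (τ := τ) (u := U' (q.1 ^ 2 + q.2 ^ 2))
    (show 0 ≤ q.1 ^ 2 + q.2 ^ 2 by positivity)
  have hW2 := Real.sq_sqrt hW.le
  have hW1 := Real.sqrt_pos.2 hW
  have hp : graphMap (fun q => U (q.1 ^ 2 + q.2 ^ 2)) q ∈ ambient := hq
  simp only [meanCurvature, secondForm_eq τ hp, firstForm, dX_dX_graphMap hU hU',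
    dX_graphMap hU.self_of_nhds]
  set p := graphMap (fun q => U (q.1 ^ 2 + q.2 ^ 2)) q
  have hlam : lam p = 2 / (1 - (q.1 ^ 2 + q.2 ^ 2)) := rfl
  have p0 : p 0 = q.1 := rfl
  have p1 : p 1 = q.2 := rfl
  set u := U' (q.1 ^ 2 + q.2 ^ 2)
  set W := √(graphNsq τ (q.1 ^ 2 + q.2 ^ 2) u)
  obtain ⟨a, b⟩ := q
  simp only at *
  have hWs : W ^ 2 = 1 + 4 * τ ^ 2 * (a ^ 2 + b ^ 2)
    + (a ^ 2 + b ^ 2) * u ^ 2 * (1 - (a ^ 2 + b ^ 2)) ^ 2 := hW2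
  simp only [metric, connForm, dmetric, dconn, hlam, p0, p1, graphNvec]
  clear_value W u
  -- Again D is EG − F², here λ⁴W²; what remains is a rational identity.
  have hden : ∀ D : ℝ, D = 16 * W ^ 2 / (1 - (a ^ 2 + b ^ 2)) ^ 4 → ∀ N B : ℝ,
      N * (1 - (a ^ 2 + b ^ 2)) ^ 2 * W = 8 * (2 * (u + (a ^ 2 + b ^ 2) * u2) *
        (1 + 4 * τ ^ 2 * (a ^ 2 + b ^ 2) + (a ^ 2 + b ^ 2) * u ^ 2 * (1 - (a ^ 2 + b ^ 2)) ^ 2)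
        - (a ^ 2 + b ^ 2) * (u * B)) →
      N / (2 * D) = (1 - (a ^ 2 + b ^ 2)) ^ 2 / 2 * (u / W + (a ^ 2 + b ^ 2) *
        (u2 / W - u * B / (2 * W ^ 3))) := by
    rintro D rfl N B h
    rw [← hWs] at h
    have hN : N = 8 * (2 * (u + (a ^ 2 + b ^ 2) * u2) * W ^ 2 - (a ^ 2 + b ^ 2) * (u * B))
      / ((1 - (a ^ 2 + b ^ 2)) ^ 2 * W) := by
      rw [← h]; field_simp
    rw [hN]
    field_simp
    ring
  simp
  apply hden
  · rw [hWs]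
    field_simp
    ring
  · field_simp
    ring

/-! ### Lengths of curves and the distance to the axis -/

/-- A curve in the space that is continuously differentiable on `[0, T]`. -/
structure IsPath (γ : ℝ → Pt) (T : ℝ) : Prop where
  nonneg : 0 ≤ T
  differentiableAt : ∀ s ∈ Icc 0 T, DifferentiableAt ℝ γ s
  continuousOn : ContinuousOn (deriv γ) (Icc 0 T)
  mem : ∀ s ∈ Icc 0 T, γ s ∈ ambient

/-- The Riemannian norm of a tangent vector. -/
def nrm (τ : ℝ) (p v : Pt) : ℝ := √(metric τ p v v)

theorem nrm_nonneg (τ : ℝ) (p v : Pt) : 0 ≤ nrm τ p v := Real.sqrt_nonneg _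

theorem abs_connForm_le_nrm (τ : ℝ) (p v : Pt) : |connForm τ p v| ≤ nrm τ p v := by
  refine Real.abs_le_sqrt ?_
  have : metric τ p v v = (lam p * v 0) ^ 2 + (lam p * v 1) ^ 2 + connForm τ p v ^ 2 := by
    simp only [metric]; ring
  rw [this]
  have := sq_nonneg (lam p * v 0)
  have := sq_nonneg (lam p * v 1)
  linarith

/-- Cauchy–Schwarz in the horizontal part. Different choices of (a, b) control the radius, the angle
and the height along a curve. -/
theorem abs_lam_mul_le_nrm (τ : ℝ) (p v : Pt) {a b : ℝ} (hab : a ^ 2 + b ^ 2 ≤ 1) :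
    |lam p * (a * v 0 + b * v 1)| ≤ nrm τ p v := by
  refine Real.abs_le_sqrt ?_
  have h1 : metric τ p v v = lam p ^ 2 * (v 0 ^ 2 + v 1 ^ 2) + connForm τ p v ^ 2 := by
    simp only [metric]; ring
  have h2 : (a * v 0 + b * v 1) ^ 2 ≤ v 0 ^ 2 + v 1 ^ 2 := by
    nlinarith [sq_nonneg (a * v 1 - b * v 0), sq_nonneg (v 0), sq_nonneg (v 1)]
  rw [h1, mul_pow]
  have := mul_le_mul_of_nonneg_left h2 (sq_nonneg (lam p))
  have := sq_nonneg (connForm τ p v)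
  linarith

/-- The form dt is the connection form minus 2τλ(y dx − x dy), and (y, −x) has length less than 1,
so both parts are bounded by the norm. -/
theorem abs_two_le_nrm (τ : ℝ) {p : Pt} (hp : p ∈ ambient) (v : Pt) :
    |v 2| ≤ (1 + 2 * |τ|) * nrm τ p v := by
  have h1 := abs_connForm_le_nrm τ p v
  have h2 := abs_lam_mul_le_nrm τ p v (a := p 1) (b := -p 0) (by
    have : p 0 ^ 2 + p 1 ^ 2 < 1 := hp
    nlinarith)
  have e : v 2 = connForm τ p v - 2 * τ * (lam p * (p 1 * v 0 + -p 0 * v 1)) := by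
    simp only [connForm]; ring
  rw [e]
  refine (abs_sub _ _).trans ?_
  rw [abs_mul, abs_mul, abs_two]
  nlinarith [mul_le_mul_of_nonneg_left h2 (abs_nonneg τ)]

theorem continuousOn_lam : ContinuousOn lam ambient := fun _ hp =>
  (hasFDerivAt_lam hp).continuousAt.continuousWithinAt

theorem continuousOn_nrm (τ : ℝ) {γ v : ℝ → Pt} {S : Set ℝ} (hγ : ContinuousOn γ S)
    (hv : ContinuousOn v S) (hmem : ∀ s ∈ S, γ s ∈ ambient) :
    ContinuousOn (fun s => nrm τ (γ s) (v s)) S := by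
  have hl : ContinuousOn (fun s => lam (γ s)) S := continuousOn_lam.comp hγ hmem
  have g : ∀ i, ContinuousOn (fun s => γ s i) S := fun i => (continuousOn_pi.1 hγ) i
  have d : ∀ i, ContinuousOn (fun s => v s i) S := fun i => (continuousOn_pi.1 hv) i
  have hc : ContinuousOn (fun s => connForm τ (γ s) (v s)) S :=
    ((continuousOn_const.mul hl).mul (((g 1).mul (d 0)).sub ((g 0).mul (d 1)))).add (d 2)
  exact (((hl.pow 2).mul (((d 0).mul (d 0)).add ((d 1).mul (d 1)))).add (hc.mul hc)).sqrt

namespace IsPath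

theorem continuousOn_speed {γ : ℝ → Pt} {T : ℝ} (h : IsPath γ T) (τ : ℝ) :
    ContinuousOn (fun s => nrm τ (γ s) (deriv γ s)) (Icc 0 T) :=
  continuousOn_nrm τ (fun s hs => (h.differentiableAt s hs).continuousAt.continuousWithinAt)
    h.continuousOn h.mem

/-- The calibration argument behind every lower bound on length: it is applied to `hdist`, to the
height and to the angle. -/
theorem sub_le_curveLength {γ : ℝ → Pt} {T : ℝ} (h : IsPath γ T) (τ : ℝ) {g g' : ℝ → ℝ} {C : ℝ}
    (hg : ∀ s ∈ Icc 0 T, HasDerivAt g (g' s) s)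
    (hle : ∀ s ∈ Icc 0 T, g' s ≤ C * nrm τ (γ s) (deriv γ s)) :
    g T - g 0 ≤ C * curveLength τ γ T := by
  have := intervalIntegral.sub_le_integral_of_hasDeriv_right_of_le h.nonneg
    (fun s hs => (hg s hs).continuousAt.continuousWithinAt)
    (fun s hs => (hg s (Ioo_subset_Icc_self hs)).hasDerivWithinAt)
    (((h.continuousOn_speed τ).const_mul C).integrableOn_compact isCompact_Icc)
    (fun s hs => hle s (Ioo_subset_Icc_self hs))
  rwa [intervalIntegral.integral_const_mul] at this

end IsPath

/-- Distance to the axis as a function of the (signed) radius in the disk. -/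
def hdist (r : ℝ) : ℝ := Real.log ((1 + r) / (1 - r))

/-- Euclidean distance to the axis. -/
def rad (p : Pt) : ℝ := √(p 0 ^ 2 + p 1 ^ 2)

theorem rad_nonneg (p : Pt) : 0 ≤ rad p := Real.sqrt_nonneg _

theorem rad_sq (p : Pt) : rad p ^ 2 = p 0 ^ 2 + p 1 ^ 2 := Real.sq_sqrt (by positivity)

theorem rad_lt_one {p : Pt} (hp : p ∈ ambient) : rad p < 1 := by
  have : p 0 ^ 2 + p 1 ^ 2 < 1 := hp
  rw [← rad_sq] at this
  nlinarith [rad_nonneg p]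

/-- The radius is not differentiable on the axis. Unit linear functionals are, they never exceed the
radius, and a suitable one attains it at p. -/
theorem exists_rad_eq (p : Pt) : ∃ a b : ℝ, a ^ 2 + b ^ 2 = 1 ∧ a * p 0 + b * p 1 = rad p := by
  rcases (rad_nonneg p).eq_or_lt with h | h
  · have h2 := rad_sq p
    rw [← h] at h2
    have : p 0 = 0 := by nlinarith [sq_nonneg (p 0), sq_nonneg (p 1)]
    exact ⟨1, 0, by norm_num, by simp [this, ← h]⟩
  · refine ⟨p 0 / rad p, p 1 / rad p, ?_, ?_⟩
    · rw [div_pow, div_pow, ← add_div, ← rad_sq]; field_simp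
    · have := rad_sq p
      field_simp
      linarith

theorem abs_dot_le_rad (p : Pt) {a b : ℝ} (hab : a ^ 2 + b ^ 2 = 1) :
    |a * p 0 + b * p 1| ≤ rad p := by
  refine Real.abs_le_sqrt ?_
  nlinarith [sq_nonneg (a * p 1 - b * p 0)]

theorem hasDerivAt_hdist {r : ℝ} (hr : |r| < 1) : HasDerivAt hdist (cf r) r := by
  obtain ⟨h1, h2⟩ := abs_lt.1 hr
  have a1 : 1 + r ≠ 0 := by linarith
  have a2 : 1 - r ≠ 0 := by linarith
  have := (((hasDerivAt_id r).const_add 1).div ((hasDerivAt_id r).const_sub 1) a2).log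
    (div_ne_zero a1 a2)
  refine this.congr_deriv ?_
  have a3 : 1 - r ^ 2 ≠ 0 := by
    have : 1 - r ^ 2 = (1 + r) * (1 - r) := by ring
    rw [this]; exact mul_ne_zero a1 a2
  simp [cf]
  field_simp
  ring

theorem strictMonoOn_hdist : StrictMonoOn hdist (Ioo (-1) 1) := by
  intro a ha b hb hab
  refine Real.log_lt_log (div_pos (by linarith [ha.1]) (by linarith [ha.2])) ?_
  rw [div_lt_div_iff₀ (by linarith [ha.2]) (by linarith [hb.2])]
  nlinarith

theorem hdist_zero : hdist 0 = 0 := by simp [hdist]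

theorem hdist_nonneg {r : ℝ} (h0 : 0 ≤ r) (h1 : r < 1) : 0 ≤ hdist r := by
  rw [← hdist_zero]
  exact strictMonoOn_hdist.monotoneOn ⟨by norm_num, by norm_num⟩ ⟨by linarith, h1⟩ h0

theorem arcosh_ch {r : ℝ} (h0 : 0 ≤ r) (h1 : r < 1) : Real.arcosh (ch r) = hdist r := by
  have h2 : 0 < 1 - r := by linarith
  have h3 : 0 < 1 + r := by linarith
  have h4 : 1 - r ^ 2 ≠ 0 := by nlinarith
  have : ch r = Real.cosh (hdist r) := by
    rw [hdist, Real.cosh_log (div_pos h3 h2), ch]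
    field_simp
    ring
  rw [this, Real.arcosh_cosh (hdist_nonneg h0 h1)]

/-- Since |ax + by| is at most the radius, the derivative `cf` of `hdist` at ax + by is at most λ,
so `hdist (ax + by)` is 1-Lipschitz. Oddness of `hdist` gives the second sign. -/
theorem IsPath.hdist_sub_le {γ : ℝ → Pt} {T : ℝ} (h : IsPath γ T) (τ : ℝ) {a b : ℝ}
    (hab : a ^ 2 + b ^ 2 = 1) :
    |hdist (a * γ T 0 + b * γ T 1) - hdist (a * γ 0 0 + b * γ 0 1)| ≤ curveLength τ γ T := by
  have key : ∀ a b : ℝ, a ^ 2 + b ^ 2 = 1 →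
      hdist (a * γ T 0 + b * γ T 1) - hdist (a * γ 0 0 + b * γ 0 1) ≤ curveLength τ γ T := by
    intro a b hab
    have := h.sub_le_curveLength τ (C := 1) (g := fun s => hdist (a * γ s 0 + b * γ s 1))
      (g' := fun s => cf (a * γ s 0 + b * γ s 1) * (a * deriv γ s 0 + b * deriv γ s 1)) ?_ ?_
    · simpa using this
    · intro s hs
      have d := hasDerivAt_pi.1 (h.differentiableAt s hs).hasDerivAt
      have hr := (abs_dot_le_rad (γ s) hab).trans_lt (rad_lt_one (h.mem s hs))
      exact HasDerivAt.comp (h₂ := hdist) (h := fun s => a * γ s 0 + b * γ s 1) s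
        (hasDerivAt_hdist hr) (((d 0).const_mul a).add ((d 1).const_mul b))
    · intro s hs
      have hr := (abs_dot_le_rad (γ s) hab).trans_lt (rad_lt_one (h.mem s hs))
      have hle := abs_lam_mul_le_nrm τ (γ s) (deriv γ s) hab.le
      have hcl : cf (a * γ s 0 + b * γ s 1) ≤ lam (γ s) := by
        have h1 : γ s 0 ^ 2 + γ s 1 ^ 2 < 1 := h.mem s hs
        refine div_le_div_of_nonneg_left zero_le_two (by linarith) ?_
        have := sq_le_sq' (abs_le.1 (abs_dot_le_rad (γ s) hab)).1
          (abs_le.1 (abs_dot_le_rad (γ s) hab)).2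
        rw [rad_sq] at this
        linarith
      rw [one_mul]
      refine le_trans (le_abs_self _) (le_trans ?_ hle)
      rw [abs_mul, abs_mul, abs_of_pos (cf_pos hr), abs_of_pos (lam_pos (h.mem s hs))]
      exact mul_le_mul_of_nonneg_right hcl (abs_nonneg _)
  have hodd : ∀ y : ℝ, |y| < 1 → hdist (-y) = -hdist y := by
    intro y hy
    simp only [hdist, sub_neg_eq_add, ← sub_eq_add_neg]
    rw [← Real.log_inv, inv_div]
  rw [abs_le]
  constructor
  · have := key (-a) (-b) (by linarith)
    have e : ∀ s ∈ Icc (0 : ℝ) T, hdist (-a * γ s 0 + -b * γ s 1)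
        = -hdist (a * γ s 0 + b * γ s 1) := by
      intro s hs
      rw [← hodd _ ((abs_dot_le_rad (γ s) hab).trans_lt (rad_lt_one (h.mem s hs)))]
      congr 1; ring
    rw [e T ⟨h.nonneg, le_rfl⟩, e 0 ⟨le_rfl, h.nonneg⟩] at this
    linarith
  · exact key a b hab

/-- The horizontal radial segment realizes the distance: the connection form vanishes along it, so
its length is the hyperbolic one. The lower bound is `IsPath.hdist_sub_le` in the direction of p. -/
theorem distAxis_eq (τ : ℝ) {p : Pt} (hp : p ∈ ambient) : distAxis τ p = hdist (rad p) := by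
  have hr0 := rad_nonneg p
  have hr1 := rad_lt_one hp
  refine IsLeast.csInf_eq ⟨?_, ?_⟩
  · have hb : ∀ s ∈ Icc (0 : ℝ) 1, |(1 - s) * rad p| < 1 := by
      intro s hs
      rw [abs_of_nonneg (mul_nonneg (by linarith [hs.2]) hr0)]
      nlinarith [hs.1, hs.2]
    have hrad : ∀ s : ℝ, ((1 - s) * p 0) ^ 2 + ((1 - s) * p 1) ^ 2 = ((1 - s) * rad p) ^ 2 := by
      intro s; rw [mul_pow _ (rad p), rad_sq]; ring
    refine ⟨fun s => ![(1 - s) * p 0, (1 - s) * p 1, p 2], ?_, ?_, ?_, ?_, ?_⟩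
    · rw [contDiff_pi]
      intro i
      fin_cases i
      · exact (contDiff_const.sub contDiff_id).mul contDiff_const
      · exact (contDiff_const.sub contDiff_id).mul contDiff_const
      · exact contDiff_const
    · intro s hs
      change ((1 - s) * p 0) ^ 2 + ((1 - s) * p 1) ^ 2 < 1
      rw [hrad]
      exact (sq_lt_one_iff_abs_lt_one _).2 (hb s hs)
    · ext i; fin_cases i <;> simp
    · constructor <;> simp
    · have hd : ∀ s : ℝ, deriv (fun s : ℝ => (![(1 - s) * p 0, (1 - s) * p 1, p 2] : Pt)) s
          = ![-p 0, -p 1, 0] := by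
        intro s
        refine HasDerivAt.deriv ?_
        rw [hasDerivAt_pi]
        intro i
        fin_cases i
        · simpa using ((hasDerivAt_id s).const_sub 1).mul_const (p 0)
        · simpa using ((hasDerivAt_id s).const_sub 1).mul_const (p 1)
        · exact hasDerivAt_const _ _
      have hsp : ∀ s ∈ uIcc (0 : ℝ) 1, √(metric τ ![(1 - s) * p 0, (1 - s) * p 1, p 2]
          ![-p 0, -p 1, 0] ![-p 0, -p 1, 0]) = cf ((1 - s) * rad p) * rad p := by
        intro s hs
        rw [uIcc_of_le zero_le_one] at hs
        have hc := cf_pos (hb s hs)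
        have hl : lam ![(1 - s) * p 0, (1 - s) * p 1, p 2] = cf ((1 - s) * rad p) := by
          simp only [lam, cf, Matrix.cons_val_zero, Matrix.cons_val_one]
          rw [hrad]
        have : metric τ ![(1 - s) * p 0, (1 - s) * p 1, p 2]
          ![-p 0, -p 1, 0] ![-p 0, -p 1, 0] = (cf ((1 - s) * rad p) * rad p) ^ 2 := by
          simp only [metric, connForm, hl]
          simp
          rw [mul_pow, rad_sq]
          ring
        rw [this, Real.sqrt_sq (by positivity)]
      simp only [curveLength, hd]
      rw [intervalIntegral.integral_congr hsp]
      have hcont : ContinuousOn (fun s => cf ((1 - s) * rad p) * rad p) (uIcc 0 1) := by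
        rw [uIcc_of_le zero_le_one]
        refine ContinuousOn.mul ?_ continuousOn_const
        exact continuousOn_cf (x := fun s => (1 - s) * rad p) (by fun_prop) hb
      rw [intervalIntegral.integral_eq_sub_of_hasDerivAt (f := fun s => -hdist ((1 - s) * rad p))
        (f' := fun s => cf ((1 - s) * rad p) * rad p) ?_ hcont.intervalIntegrable]
      · simp [hdist_zero]
      · intro s hs
        rw [uIcc_of_le zero_le_one] at hs
        have h1 : HasDerivAt (fun s => (1 - s) * rad p) (-rad p) s := by
          simpa using ((hasDerivAt_id s).const_sub 1).mul_const (rad p)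
        exact (HasDerivAt.comp (h₂ := hdist) (h := fun s => (1 - s) * rad p) s
          (hasDerivAt_hdist (hb s hs)) h1).neg.congr_deriv (by ring)
  · rintro L ⟨γ, hγ, hmem, h0, h1, rfl⟩
    obtain ⟨a, b, hab, hdot⟩ := exists_rad_eq p
    have hP : IsPath γ 1 := ⟨zero_le_one, fun s _ => hγ.differentiable (by norm_num) s,
      (hγ.continuous_deriv (by norm_num)).continuousOn, hmem⟩
    have := hP.hdist_sub_le τ hab
    rw [h0, h1.1, h1.2, hdot] at this
    simp only [mul_zero, add_zero, hdist_zero, zero_sub, abs_neg] at this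
    exact (le_abs_self _).trans this

/-! ### Completeness -/

theorem curveLength_eq (τ : ℝ) (γ : ℝ → Pt) (T : ℝ) :
    curveLength τ γ T = ∫ s in (0 : ℝ)..T, nrm τ (γ s) (deriv γ s) := rfl

theorem curveLength_mono {τ : ℝ} {γ : ℝ → Pt} {S T : ℝ} (hS : 0 ≤ S) (hST : S ≤ T)
    (h : IsPath γ T) : curveLength τ γ S ≤ curveLength τ γ T := by
  have hi := h.continuousOn_speed τ
  rw [curveLength_eq, curveLength_eq]
  refine intervalIntegral.integral_mono_interval le_rfl hS hST
    (Eventually.of_forall fun s => nrm_nonneg _ _ _) ?_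
  refine ContinuousOn.intervalIntegrable ?_
  rwa [uIcc_of_le h.nonneg]

theorem tendsto_curveLength {τ : ℝ} {γ : ℝ → Pt} (h : ∀ T, 0 ≤ T → IsPath γ T)
    (hb : ∀ M, ¬∀ T, 0 ≤ T → curveLength τ γ T ≤ M) :
    Tendsto (fun T => curveLength τ γ T) atTop atTop := by
  rw [tendsto_atTop]
  intro M
  obtain ⟨T, hT⟩ := not_forall.1 (hb M)
  obtain ⟨hT0, hTM⟩ := Classical.not_imp.1 hT
  filter_upwards [eventually_ge_atTop T] with S hS
  exact (not_le.1 hTM).le.trans (curveLength_mono hT0 hS (h S (hT0.trans hS)))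

/-- The compact set of points of radius at most `R` and height at most `M`. -/
def cyl (R M : ℝ) : Set Pt := {p | rad p ≤ R ∧ |p 2| ≤ M}

theorem continuous_rad : Continuous rad := by unfold rad; fun_prop

theorem isCompact_cyl (R M : ℝ) : IsCompact (cyl R M) := by
  refine Metric.isCompact_of_isClosed_isBounded ?_ ?_
  · exact (isClosed_le continuous_rad continuous_const).inter
      (isClosed_le (continuous_abs.comp (continuous_apply 2)) continuous_const)
  · refine (Metric.isBounded_closedBall (x := (0 : Pt)) (r := max R M)).subset ?_
    rintro p ⟨h1, h2⟩
    have h0 : 0 ≤ max R M := (rad_nonneg p).trans (h1.trans (le_max_left _ _))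
    rw [mem_closedBall_zero_iff, pi_norm_le_iff_of_nonneg h0]
    have a0 : |p 0| ≤ rad p := Real.abs_le_sqrt (by nlinarith [sq_nonneg (p 1)])
    have a1 : |p 1| ≤ rad p := Real.abs_le_sqrt (by nlinarith [sq_nonneg (p 0)])
    intro i
    fin_cases i
    · exact a0.trans (h1.trans (le_max_left _ _))
    · exact a1.trans (h1.trans (le_max_left _ _))
    · exact h2.trans (le_max_right _ _)

theorem exists_subset_cyl {K : Set Pt} (hK : IsCompact K) (hKa : K ⊆ ambient) :
    ∃ R M : ℝ, 0 ≤ R ∧ R < 1 ∧ K ⊆ cyl R M := by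
  rcases K.eq_empty_or_nonempty with rfl | hne
  · exact ⟨0, 0, le_rfl, zero_lt_one, empty_subset _⟩
  obtain ⟨p, hp, hmax⟩ := hK.exists_isMaxOn hne continuous_rad.continuousOn
  obtain ⟨q, hq, hmax'⟩ := hK.exists_isMaxOn hne
    (f := fun p : Pt => |p 2|) (by fun_prop)
  exact ⟨rad p, |q 2|, rad_nonneg p, rad_lt_one (hKa hp), fun r hr => ⟨hmax hr, hmax' hr⟩⟩

/-- Bounded length bounds both the distance to the axis and the height, hence confines the curve to
a compact part of the space. -/
theorem exists_cyl_of_length_le {τ : ℝ} {γ : ℝ → Pt} (h : ∀ T, 0 ≤ T → IsPath γ T) {M : ℝ}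
    (hM : ∀ T, 0 ≤ T → curveLength τ γ T ≤ M) :
    ∃ R B : ℝ, R < 1 ∧ ∀ s, 0 ≤ s → γ s ∈ cyl R B := by
  set D := hdist (rad (γ 0)) + M
  -- This quotient is the radius at which `hdist` takes the value D.
  have hlt : (Real.exp D - 1) / (Real.exp D + 1) < 1 := by
    have := Real.exp_pos D
    rw [div_lt_one (by linarith)]; linarith
  refine ⟨(Real.exp D - 1) / (Real.exp D + 1), |γ 0 2| + (1 + 2 * |τ|) * M, hlt,
    fun s hs => ⟨?_, ?_⟩⟩
  · obtain ⟨a, b, hab, hdot⟩ := exists_rad_eq (γ s)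
    have h1 := (abs_le.1 ((h s hs).hdist_sub_le τ hab)).2
    have m0 := (h s hs).mem 0 ⟨le_rfl, hs⟩
    have ms := (h s hs).mem s ⟨hs, le_rfl⟩
    have h2 : hdist (a * γ 0 0 + b * γ 0 1) ≤ hdist (rad (γ 0)) := by
      have h3 := abs_dot_le_rad (γ 0) hab
      have h4 := rad_lt_one m0
      exact strictMonoOn_hdist.monotoneOn ⟨by linarith [(abs_le.1 h3).1],
        by linarith [(abs_le.1 h3).2]⟩ ⟨by linarith [rad_nonneg (γ 0)], h4⟩ (abs_le.1 h3).2
    rw [hdot] at h1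
    have h5 : hdist (rad (γ s)) ≤ D := by linarith [hM s hs]
    have r0 := rad_nonneg (γ s)
    have r1 := rad_lt_one ms
    have h6 := Real.exp_le_exp.2 h5
    rw [hdist, Real.exp_log (div_pos (by linarith) (by linarith)),
      div_le_iff₀ (by linarith)] at h6
    rw [le_div_iff₀ (by linarith [Real.exp_pos D])]
    nlinarith
  · have key : ∀ σ : ℝ, |σ| = 1 → σ * γ s 2 - σ * γ 0 2 ≤ (1 + 2 * |τ|) * curveLength τ γ s := by
      intro σ hσ
      refine (h s hs).sub_le_curveLength τ (g := fun s => σ * γ s 2)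
        (g' := fun s => σ * deriv γ s 2) ?_ ?_
      · intro u hu
        exact (hasDerivAt_pi.1 ((h s hs).differentiableAt u hu).hasDerivAt 2).const_mul σ
      · intro u hu
        refine (le_abs_self _).trans ?_
        rw [abs_mul, hσ, one_mul]
        exact abs_two_le_nrm τ ((h s hs).mem u hu) _
    have k1 := key 1 (by simp)
    have k2 := key (-1) (by simp)
    have h2 : (1 + 2 * |τ|) * curveLength τ γ s ≤ (1 + 2 * |τ|) * M :=
      mul_le_mul_of_nonneg_left (hM s hs) (by positivity)
    have h3 := le_abs_self (γ 0 2)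
    have h4 := neg_abs_le (γ 0 2)
    rw [abs_le]
    constructor <;> linarith

theorem deriv_comp_path {U : Set (ℝ × ℝ)} {X : ℝ × ℝ → Pt} (hU : IsOpen U)
    (hX : ContDiffOn ℝ ∞ X U) {γ : ℝ → ℝ × ℝ} (hγ : ContDiff ℝ 1 γ) {s : ℝ} (hs : γ s ∈ U) :
    HasDerivAt (X ∘ γ) (dX X (deriv γ s) (γ s)) s := by
  have h1 : HasFDerivAt X (fderiv ℝ X (γ s)) (γ s) :=
    ((hX.contDiffAt (hU.mem_nhds hs)).differentiableAt (by simp)).hasFDerivAt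
  exact h1.comp_hasDerivAt s (hγ.differentiable (by norm_num) s).hasDerivAt

theorem isPath_comp {U : Set (ℝ × ℝ)} {X : ℝ × ℝ → Pt} (hU : IsOpen U) (hX : ContDiffOn ℝ ∞ X U)
    (hmaps : MapsTo X U ambient) {γ : ℝ → ℝ × ℝ} (hγ : ContDiff ℝ 1 γ)
    (hγU : ∀ s, 0 ≤ s → γ s ∈ U) {T : ℝ} (hT : 0 ≤ T) : IsPath (X ∘ γ) T where
  nonneg := hT
  differentiableAt s hs := (deriv_comp_path hU hX hγ (hγU s hs.1)).differentiableAt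
  continuousOn := by
    have h1 : ContinuousOn (fderiv ℝ X) U := hX.continuousOn_fderiv_of_isOpen hU (by simp)
    have h2 : ContinuousOn (fun s => fderiv ℝ X (γ s)) (Icc 0 T) :=
      h1.comp hγ.continuous.continuousOn fun s hs => hγU s hs.1
    exact (h2.clm_apply (hγ.continuous_deriv (by norm_num)).continuousOn).congr
      fun s hs => (deriv_comp_path hU hX hγ (hγU s hs.1)).deriv
  mem s hs := hmaps (hγU s hs.1)

/-- If the length stayed bounded, the curve would remain in the compact preimage of a cylinder,
which it was assumed to leave. -/
theorem isCompleteOn_of_proper (τ : ℝ) {U : Set (ℝ × ℝ)} {X : ℝ × ℝ → Pt} (hU : IsOpen U)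
    (hX : ContDiffOn ℝ ∞ X U) (hmaps : MapsTo X U ambient)
    (hproper : ∀ R B : ℝ, R < 1 → IsCompact (U ∩ X ⁻¹' cyl R B)) : IsCompleteOn τ U X := by
  intro γ hγ hγU hesc
  refine tendsto_curveLength (fun T hT => isPath_comp hU hX hmaps hγ hγU hT) fun M hM => ?_
  obtain ⟨R, B, hR, hK⟩ := exists_cyl_of_length_le
    (fun T hT => isPath_comp hU hX hmaps hγ hγU hT) hM
  obtain ⟨s, h1, h2⟩ := ((hesc _ inter_subset_left (hproper R B hR)).and
    (eventually_ge_atTop 0)).exists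
  exact h1 ⟨hγU s h2, hK s h2⟩

/-! ### Rotational annuli -/

/-- The annulus obtained by rotating a curve about the axis. -/
def annulus (x t : ℝ → ℝ) (q : ℝ × Real.Angle) : Pt :=
  ![x q.1 * q.2.cos, x q.1 * q.2.sin, t q.1]

theorem lift_annulus (x t : ℝ → ℝ) : lift (annulus x t) = rotMap x t := by
  ext q i
  fin_cases i <;> simp [lift, annulus, rotMap]

theorem rad_rotMap (x t : ℝ → ℝ) (q : ℝ × ℝ) : rad (rotMap x t q) = |x q.1| := by
  rw [rad, rotMap_eq_rot, rot_normSq]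
  simp [Real.sqrt_sq_eq_abs]

theorem range_annulus (x t : ℝ → ℝ) : range (annulus x t) = rotMap x t '' (univ ×ˢ univ) := by
  rw [← lift_annulus, univ_prod_univ, image_univ]
  ext p
  constructor
  · rintro ⟨⟨s, θ⟩, rfl⟩
    induction θ using Real.Angle.induction_on with
    | _ θ => exact ⟨(s, θ), rfl⟩
  · rintro ⟨q, rfl⟩
    exact ⟨_, rfl⟩

/-- On the universal cover the preimage of a cylinder is not compact, since the angle is free. But
λx|θ'| is at most the speed, with λ ≥ 2 and x ≥ r, so the length also bounds the angle. -/
theorem isCompleteOn_rotMap (τ : ℝ) {x t : ℝ → ℝ} (h : IsGenerating univ x t) {r : ℝ} (hr : 0 < r)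
    (hrx : ∀ s, r ≤ x s) (hproper : ∀ R < 1, ∃ S, ∀ s, x s ≤ R → |s| ≤ S) :
    IsCompleteOn τ univ (rotMap x t) := by
  intro γ hγ hγU hesc
  have hX : ContDiffOn ℝ ∞ (rotMap x t) univ := by
    rw [← univ_prod_univ]; exact contDiffOn_rotMap h.smooth_x h.smooth_t
  have hmaps : MapsTo (rotMap x t) univ ambient := fun q _ => rotMap_mem (h.lt_one _ (mem_univ _))
  have hpath := fun T hT => isPath_comp isOpen_univ hX hmaps hγ hγU (T := T) hT
  refine tendsto_curveLength hpath fun M hM => ?_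
  obtain ⟨R, B, hR, hK⟩ := exists_cyl_of_length_le hpath hM
  obtain ⟨S, hS⟩ := hproper R hR
  have hθ : ∀ T, 0 ≤ T → ∀ σ : ℝ, |σ| = 1 → σ * (γ T).2 - σ * (γ 0).2 ≤ 1 / (2 * r) * M := by
    intro T hT σ hσ
    have h0 := (hpath T hT).sub_le_curveLength τ (C := 1 / (2 * r))
      (g := fun s => σ * (γ s).2) (g' := fun s => σ * (deriv γ s).2) ?_ ?_
    · exact h0.trans (mul_le_mul_of_nonneg_left (hM T hT) (by positivity))
    · intro s _
      have := (hasFDerivAt_snd (𝕜 := ℝ) (E := ℝ) (F := ℝ) (p := γ s)).comp_hasDerivAt s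
        (hγ.differentiable (by norm_num) s).hasDerivAt
      exact this.const_mul σ
    · intro s _
      rw [(deriv_comp_path isOpen_univ hX hγ (mem_univ _)).deriv]
      have hn := abs_lam_mul_le_nrm τ (rotMap x t (γ s)) (dX (rotMap x t) (deriv γ s) (γ s))
        (a := -Real.sin (γ s).2) (b := Real.cos (γ s).2) (by nlinarith [Real.sin_sq_add_cos_sq (γ s).2])
      have e : -Real.sin (γ s).2 * dX (rotMap x t) (deriv γ s) (γ s) 0
          + Real.cos (γ s).2 * dX (rotMap x t) (deriv γ s) (γ s) 1
          = x (γ s).1 * (deriv γ s).2 := by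
        rw [dX_rotMap (hasDerivAt_of_contDiffOn isOpen_univ h.smooth_x (mem_univ _))
          (hasDerivAt_of_contDiffOn isOpen_univ h.smooth_t (mem_univ _))]
        simp only [rot, Matrix.cons_val_zero, Matrix.cons_val_one]
        linear_combination (x (γ s).1 * (deriv γ s).2) * Real.sin_sq_add_cos_sq (γ s).2
      have hl : 2 ≤ lam (rotMap x t (γ s)) := by
        rw [rotMap_eq_rot, lam_rot, lam_vec, cf, le_div_iff₀ (one_sub_sq_pos (h.lt_one _ (mem_univ _)))]
        nlinarith [sq_nonneg (x (γ s).1)]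
      rw [e] at hn
      have h2 : 2 * r * |(deriv γ s).2| ≤ |lam (rotMap x t (γ s)) * (x (γ s).1 * (deriv γ s).2)| := by
        rw [abs_mul, abs_mul, abs_of_pos (show 0 < lam (rotMap x t (γ s)) by linarith),
          abs_of_pos (show 0 < x (γ s).1 from hr.trans_le (hrx _)), ← mul_assoc]
        exact mul_le_mul_of_nonneg_right (mul_le_mul hl (hrx _) hr.le (by linarith)) (abs_nonneg _)
      refine (le_abs_self _).trans ?_
      rw [abs_mul, hσ, one_mul, div_mul_eq_mul_div, one_mul, le_div_iff₀ (by positivity)]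
      rw [mul_comm]
      exact h2.trans hn
  set A := |(γ 0).2| + 1 / (2 * r) * M
  have hc : IsCompact (Icc (-S) S ×ˢ Icc (-A) A) := isCompact_Icc.prod isCompact_Icc
  obtain ⟨s, h1, h2⟩ := ((hesc _ (subset_univ _) hc).and (eventually_ge_atTop 0)).exists
  refine h1 ⟨abs_le.1 (hS _ ?_), ?_⟩
  · have := (hK s h2).1
    rw [Function.comp_apply, rad_rotMap] at this
    exact (le_abs_self _).trans this
  · have k1 := hθ s h2 1 (by simp)
    have k2 := hθ s h2 (-1) (by simp)
    have h3 := le_abs_self (γ 0).2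
    have h4 := neg_abs_le (γ 0).2
    constructor <;> simp only [A] <;> linarith

instance : CompactSpace Real.Angle :=
  have : Fact (0 < 2 * Real.pi) := ⟨Real.two_pi_pos⟩
  inferInstanceAs (CompactSpace (AddCircle (2 * Real.pi)))

theorem isProperHAnnulus_annulus {τ H : ℝ} {x t : ℝ → ℝ} (h : IsGenerating univ x t)
    {r : ℝ} (hr : 0 < r) (hrx : ∀ s, r ≤ x s) (hproper : ∀ R < 1, ∃ S, ∀ s, x s ≤ R → |s| ≤ S)
    (hJ : ∀ s, curvJ τ (x s) (deriv x s) (deriv t s) (deriv (deriv x) s) (deriv (deriv t) s)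
      = 2 * H * cf (x s) ^ 2 * x s) : IsProperHAnnulus τ H (annulus x t) where
  immersion := by
    rw [lift_annulus, ← univ_prod_univ]
    exact h.isHImmersion (fun s _ => (hr.trans_le (hrx s)).ne') fun s _ => hJ s
  complete := by
    rw [lift_annulus]
    exact isCompleteOn_rotMap τ h hr hrx hproper
  proper K hKa hK := by
    obtain ⟨R, M, hR0, hR, hKc⟩ := exists_subset_cyl hK hKa
    obtain ⟨S, hS⟩ := hproper R hR
    have hx := continuousOn_univ.1 h.smooth_x.continuousOn
    have ht := continuousOn_univ.1 h.smooth_t.continuousOn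
    have hcont : Continuous (annulus x t) := by
      refine continuous_pi fun i => ?_
      fin_cases i
      · exact (hx.comp continuous_fst).mul (Real.Angle.continuous_cos.comp continuous_snd)
      · exact (hx.comp continuous_fst).mul (Real.Angle.continuous_sin.comp continuous_snd)
      · exact ht.comp continuous_fst
    refine IsCompact.of_isClosed_subset ((isCompact_Icc (a := -S) (b := S)).prod
      (isCompact_univ (X := Real.Angle))) (hK.isClosed.preimage hcont) ?_
    rintro ⟨s, θ⟩ hq
    refine ⟨abs_le.1 (hS s ?_), mem_univ _⟩
    induction θ using Real.Angle.induction_on with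
    | _ θ =>
      have h1 := (hKc hq).1
      have h2 : annulus x t (s, (θ : Real.Angle)) = rotMap x t (s, θ) := by
        rw [← lift_annulus]; rfl
      rw [h2, rad_rotMap] at h1
      exact (le_abs_self _).trans h1

theorem annulus_injective {x t : ℝ → ℝ} (hx : ∀ s, x s ≠ 0) (ht : Function.Injective t) :
    Function.Injective (annulus x t) := by
  rintro ⟨s, θ⟩ ⟨s', θ'⟩ h
  have h0 := congrFun h 0
  have h1 := congrFun h 1
  have h2 := congrFun h 2
  simp only [annulus, Matrix.cons_val_zero, Matrix.cons_val_one, Matrix.cons_val] at h0 h1 h2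
  obtain rfl := ht h2
  have c := mul_left_cancel₀ (hx s) h0
  have d := mul_left_cancel₀ (hx s) h1
  induction θ using Real.Angle.induction_on with
  | _ θ =>
    induction θ' using Real.Angle.induction_on with
    | _ θ' =>
      rw [Real.Angle.cos_sin_inj (by simpa using c) (by simpa using d)]

/-! ### Isometries -/

/-- The vertical translations (`δ = 1`) and the half-turns about horizontal lines (`δ = -1`). -/
def vertIso (δ C : ℝ) (p : Pt) : Pt := ![p 0, δ * p 1, δ * p 2 + C]

/-- For δ = −1 the sign change of y reverses y dx − x dy along with dt, so the connection form is
multiplied by δ and its products are preserved. -/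
theorem isIsometry_vertIso (τ C : ℝ) {δ : ℝ} (hδ : δ * δ = 1) : IsIsometry τ (vertIso δ C) := by
  have hsmooth : ContDiff ℝ ∞ (vertIso δ C) := by
    rw [contDiff_pi]
    intro i
    fin_cases i
    · exact contDiff_apply ℝ ℝ 0
    · exact contDiff_const.mul (contDiff_apply ℝ ℝ 1)
    · exact (contDiff_const.mul (contDiff_apply ℝ ℝ 2)).add contDiff_const
  have hmem : ∀ δ' C' : ℝ, δ' * δ' = 1 → MapsTo (vertIso δ' C') ambient ambient := by
    intro δ' C' h p hp
    have hp' : p 0 ^ 2 + p 1 ^ 2 < 1 := hp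
    change p 0 ^ 2 + (δ' * p 1) ^ 2 < 1
    have : (δ' * p 1) ^ 2 = p 1 ^ 2 := by linear_combination p 1 ^ 2 * h
    rw [this]; exact hp'
  have hinv : ∀ p, vertIso δ C (vertIso δ (-δ * C) p) = p ∧
      vertIso δ (-δ * C) (vertIso δ C p) = p := by
    intro p
    constructor <;> ext i <;> fin_cases i <;> simp [vertIso]
    · linear_combination p 1 * hδ
    · linear_combination (p 2 - C) * hδ
    · linear_combination p 1 * hδ
    · linear_combination p 2 * hδ
  refine ⟨hsmooth.contDiffOn, ⟨hmem δ C hδ, ?_, ?_⟩, ?_⟩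
  · intro p _ q _ hpq
    rw [← (hinv p).2, hpq, (hinv q).2]
  · intro p hp
    exact ⟨_, hmem δ (-δ * C) hδ hp, (hinv p).1⟩
  · intro p _ v w
    have hd : ∀ v, fderiv ℝ (vertIso δ C) p v = ![v 0, δ * v 1, δ * v 2] := by
      intro v
      have h0 := hasFDerivAt_apply (𝕜 := ℝ) (F' := fun _ : Fin 3 => ℝ) 0 p
      have h1 := hasFDerivAt_apply (𝕜 := ℝ) (F' := fun _ : Fin 3 => ℝ) 1 p
      have h2 := hasFDerivAt_apply (𝕜 := ℝ) (F' := fun _ : Fin 3 => ℝ) 2 p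
      have h : HasFDerivAt (vertIso δ C) (ContinuousLinearMap.pi
          ![ContinuousLinearMap.proj (R := ℝ) (φ := fun _ : Fin 3 => ℝ) 0,
            δ • ContinuousLinearMap.proj (R := ℝ) (φ := fun _ : Fin 3 => ℝ) 1,
            δ • ContinuousLinearMap.proj (R := ℝ) (φ := fun _ : Fin 3 => ℝ) 2]) p := by
        rw [hasFDerivAt_pi]
        intro i
        fin_cases i
        · exact h0
        · exact h1.const_mul δ
        · exact (h2.const_mul δ).add_const C
      rw [h.fderiv]
      ext i; fin_cases i <;> simp
    rw [hd, hd]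
    have hl : lam (vertIso δ C p) = lam p := by
      simp only [lam, vertIso, Matrix.cons_val_zero, Matrix.cons_val_one]
      have : (δ * p 1) ^ 2 = p 1 ^ 2 := by linear_combination p 1 ^ 2 * hδ
      rw [this]
    have hc : ∀ v : Pt, connForm τ (vertIso δ C p) ![v 0, δ * v 1, δ * v 2]
        = δ * connForm τ p v := by
      intro v
      simp only [connForm, hl]
      simp [vertIso]
      ring
    simp only [metric, hl, hc]
    simp
    linear_combination (lam p ^ 2 * v 1 * w 1 + connForm τ p v * connForm τ p w) * hδ

/-! ### The entire graph -/

/-- Derivative of the height of the entire graph with respect to the squared radius. -/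
def slope (τ H w : ℝ) : ℝ := 2 * H * √(1 + 4 * τ ^ 2 * w) / ((1 - w) * √(1 - 4 * H ^ 2 * w))

/-- Height of the entire graph as a function of the squared radius. -/
def height (τ H w : ℝ) : ℝ := ∫ y in (0 : ℝ)..w, slope τ H y

/-- An open interval containing `[0, 1)` on which `slope` is smooth. -/
def slopeDom (τ H : ℝ) : Set ℝ := {w | w < 1 ∧ 0 < 1 + 4 * τ ^ 2 * w ∧ 0 < 1 - 4 * H ^ 2 * w}

theorem isOpen_slopeDom (τ H : ℝ) : IsOpen (slopeDom τ H) := by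
  have h1 : IsOpen {w : ℝ | w < 1} := isOpen_lt (by fun_prop) (by fun_prop)
  have h2 : IsOpen {w : ℝ | 0 < 1 + 4 * τ ^ 2 * w} := isOpen_lt (by fun_prop) (by fun_prop)
  have h3 : IsOpen {w : ℝ | 0 < 1 - 4 * H ^ 2 * w} := isOpen_lt (by fun_prop) (by fun_prop)
  exact h1.inter (h2.inter h3)

theorem ordConnected_slopeDom (τ H : ℝ) : (slopeDom τ H).OrdConnected := by
  refine ⟨fun a ha b hb w hw => ⟨hw.2.trans_lt hb.1, ?_, ?_⟩⟩
  · have := ha.2.1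
    nlinarith [hw.1, sq_nonneg τ]
  · have := hb.2.2
    nlinarith [hw.2, sq_nonneg H]

theorem mem_slopeDom (τ : ℝ) {H w : ℝ} (hH : 4 * H ^ 2 ≤ 1) (h0 : 0 ≤ w) (h1 : w < 1) :
    w ∈ slopeDom τ H :=
  ⟨h1, by positivity, by nlinarith⟩

theorem contDiffOn_slope (τ H : ℝ) : ContDiffOn ℝ ∞ (slope τ H) (slopeDom τ H) := by
  unfold slope
  refine ContDiffOn.div ?_ ?_ ?_
  · exact contDiffOn_const.mul
      (ContDiffOn.sqrt (by fun_prop) fun w hw => hw.2.1.ne')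
  · exact ContDiffOn.mul (by fun_prop) (ContDiffOn.sqrt (by fun_prop) fun w hw => hw.2.2.ne')
  · intro w hw
    exact mul_ne_zero (sub_pos.2 hw.1).ne' (Real.sqrt_pos.2 hw.2.2).ne'

theorem hasDerivAt_integral_of_continuousOn {f : ℝ → ℝ} {S : Set ℝ} (hS : IsOpen S)
    (hc : S.OrdConnected) (hf : ContinuousOn f S) {a w : ℝ} (ha : a ∈ S) (hw : w ∈ S) :
    HasDerivAt (fun w => ∫ y in a..w, f y) (f w) w :=
  intervalIntegral.integral_hasDerivAt_right
    ((hf.mono (hc.uIcc_subset ha hw)).intervalIntegrable)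
    (hf.stronglyMeasurableAtFilter hS w hw) (hf.continuousAt (hS.mem_nhds hw))

theorem contDiffOn_integral {f : ℝ → ℝ} {S : Set ℝ} (hS : IsOpen S)
    (hc : S.OrdConnected) (hf : ContDiffOn ℝ ∞ f S) {a : ℝ} (ha : a ∈ S) :
    ContDiffOn ℝ ∞ (fun w => ∫ y in a..w, f y) S := by
  have hd : ∀ w ∈ S, HasDerivAt (fun w => ∫ y in a..w, f y) (f w) w := fun w hw =>
    hasDerivAt_integral_of_continuousOn hS hc hf.continuousOn ha hw
  rw [contDiffOn_infty_iff_deriv_of_isOpen hS]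
  exact ⟨fun w hw => (hd w hw).differentiableAt.differentiableWithinAt,
    hf.congr fun w hw => (hd w hw).deriv⟩

theorem zero_mem_slopeDom (τ H : ℝ) : (0 : ℝ) ∈ slopeDom τ H := by simp [slopeDom]

theorem hasDerivAt_height {τ H w : ℝ} (hw : w ∈ slopeDom τ H) :
    HasDerivAt (height τ H) (slope τ H w) w :=
  hasDerivAt_integral_of_continuousOn (isOpen_slopeDom τ H) (ordConnected_slopeDom τ H)
    (contDiffOn_slope τ H).continuousOn (zero_mem_slopeDom τ H) hw

/-- Smoothness on a two-sided neighbourhood of 0 is what makes the graph smooth across the axis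
after composition with x² + y². -/
theorem contDiffOn_height (τ H : ℝ) : ContDiffOn ℝ ∞ (height τ H) (slopeDom τ H) :=
  contDiffOn_integral (isOpen_slopeDom τ H) (ordConnected_slopeDom τ H)
    (contDiffOn_slope τ H) (zero_mem_slopeDom τ H)

theorem height_zero (τ H : ℝ) : height τ H 0 = 0 := by simp [height]

theorem sqrt_graphNsq_slope {τ H w : ℝ} (hw : w ∈ slopeDom τ H) :
    √(graphNsq τ w (slope τ H w)) = √(1 + 4 * τ ^ 2 * w) / √(1 - 4 * H ^ 2 * w) := by
  have h1 := sub_pos.2 hw.1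
  have h2 := Real.sqrt_pos.2 hw.2.1
  have h3 := Real.sqrt_pos.2 hw.2.2
  have h4 := Real.sq_sqrt hw.2.1.le
  have h5 := Real.sq_sqrt hw.2.2.le
  rw [← Real.sqrt_sq (div_pos h2 h3).le]
  congr 1
  simp only [graphNsq, slope]
  nth_rw 1 [← h4]
  generalize √(1 + 4 * τ ^ 2 * w) = e at *
  generalize √(1 - 4 * H ^ 2 * w) = G at *
  field_simp
  linear_combination h5

/-- The equation from which `slope` is found: w·u/√(`graphNsq`) must be 2Hw/(1 − w), whose
derivative is 2H/(1 − w)². -/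
theorem slope_div {τ H w : ℝ} (hw : w ∈ slopeDom τ H) :
    slope τ H w / √(graphNsq τ w (slope τ H w)) = 2 * H / (1 - w) := by
  have h1 := sub_pos.2 hw.1
  have h2 := Real.sqrt_pos.2 hw.2.1
  have h3 := Real.sqrt_pos.2 hw.2.2
  rw [sqrt_graphNsq_slope hw, slope]
  generalize √(1 + 4 * τ ^ 2 * w) = e at *
  generalize √(1 - 4 * H ^ 2 * w) = G at *
  field_simp

/-- The height function of the entire graph on the disk. -/
def graphFun (τ H : ℝ) (q : ℝ × ℝ) : ℝ := height τ H (q.1 ^ 2 + q.2 ^ 2)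

/-- The derivative of `slope` is never computed; the expression containing it is found by
differentiating the identity `slope_div`. -/
theorem meanCurvature_graphFun {τ H : ℝ} (hH : 4 * H ^ 2 ≤ 1) {q : ℝ × ℝ} (hq : q ∈ disk) :
    meanCurvature τ (graphMap (graphFun τ H))
      ((1 / √(graphNsq τ (q.1 ^ 2 + q.2 ^ 2) (slope τ H (q.1 ^ 2 + q.2 ^ 2)))) •
        graphNvec τ q.1 q.2 (slope τ H (q.1 ^ 2 + q.2 ^ 2))) q = H := by
  have hJ := isOpen_slopeDom τ H
  obtain ⟨w, hw⟩ : ∃ w, q.1 ^ 2 + q.2 ^ 2 = w := ⟨_, rfl⟩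
  have hw1 : w < 1 := hw ▸ hq
  have hwJ : w ∈ slopeDom τ H := mem_slopeDom τ hH (hw ▸ by positivity) hw1
  have hd2 := hasDerivAt_of_contDiffOn hJ (contDiffOn_slope τ H) hwJ
  have := meanCurvature_graphMap τ (U := height τ H) (U' := slope τ H) hq hw rfl
    (by filter_upwards [hJ.mem_nhds hwJ] with y hy using hasDerivAt_height hy) hd2
  unfold graphFun
  rw [hw, this]
  set u2 := deriv (slope τ H) w
  have hpos : 0 < graphNsq τ w (slope τ H w) := graphNsq_pos (hw ▸ by positivity)
  have hsq := Real.sqrt_pos.2 hpos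
  have hN : HasDerivAt (fun w => graphNsq τ w (slope τ H w))
      (4 * τ ^ 2 + slope τ H w ^ 2 * (1 - w) ^ 2 + 2 * w * slope τ H w * u2 * (1 - w) ^ 2
        - 2 * w * slope τ H w ^ 2 * (1 - w)) w := by
    refine ((((hasDerivAt_id w).const_mul (4 * τ ^ 2)).const_add 1).add
      (((hasDerivAt_id w).mul (hd2.pow 2)).mul
        (((hasDerivAt_id w).const_sub 1).pow 2))).congr_deriv ?_
    simp
    ring
  have h1 := hd2.div (hN.sqrt hpos.ne') hsq.ne'
  have h2 : HasDerivAt (fun w => 2 * H / (1 - w)) (2 * H / (1 - w) ^ 2) w := by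
    refine ((hasDerivAt_const w (2 * H)).div ((hasDerivAt_id w).const_sub 1)
      (sub_pos.2 hw1).ne').congr_deriv ?_
    simp
  have h3 := h1.unique (h2.congr_of_eventuallyEq (by
    filter_upwards [hJ.mem_nhds hwJ] with y hy using slope_div hy))
  have h4 : ∀ N' : ℝ, u2 / √(graphNsq τ w (slope τ H w))
      - slope τ H w * N' / (2 * √(graphNsq τ w (slope τ H w)) ^ 3)
      = (u2 * √(graphNsq τ w (slope τ H w)) - slope τ H w *
        (N' / (2 * √(graphNsq τ w (slope τ H w))))) / √(graphNsq τ w (slope τ H w)) ^ 2 := by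
    intro N'; field_simp
  rw [h4, h3, slope_div hwJ]
  have := (sub_pos.2 hw1).ne'
  field_simp
  ring

theorem isOpen_disk : IsOpen disk := isOpen_lt (by fun_prop) continuous_const

theorem mapsTo_normSq {τ H : ℝ} (hH : 4 * H ^ 2 ≤ 1) :
    MapsTo (fun q : ℝ × ℝ => q.1 ^ 2 + q.2 ^ 2) disk (slopeDom τ H) := fun q hq =>
  mem_slopeDom τ hH (by positivity) hq

theorem contDiffOn_graphMap {τ H : ℝ} (hH : 4 * H ^ 2 ≤ 1) :
    ContDiffOn ℝ ∞ (graphMap (graphFun τ H)) disk := by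
  rw [contDiffOn_pi]
  intro i
  fin_cases i
  · exact contDiff_fst.contDiffOn
  · exact contDiff_snd.contDiffOn
  · exact (contDiffOn_height τ H).comp (f := fun q : ℝ × ℝ => q.1 ^ 2 + q.2 ^ 2)
      (ContDiff.contDiffOn (by fun_prop)) (mapsTo_normSq hH)

theorem isEntireHGraph_graphFun (τ : ℝ) {H : ℝ} (hH : 4 * H ^ 2 ≤ 1) :
    IsEntireHGraph τ H (graphFun τ H) (graphMap (graphFun τ H) '' disk) := by
  have hd : ∀ q ∈ disk, HasDerivAt (height τ H) (slope τ H (q.1 ^ 2 + q.2 ^ 2))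
      (q.1 ^ 2 + q.2 ^ 2) := fun q hq => hasDerivAt_height (mapsTo_normSq hH hq)
  refine ⟨⟨isOpen_disk, contDiffOn_graphMap hH, fun q hq => hq, ?_, ?_⟩, ?_, rfl⟩
  · intro q hq v w hvw
    have e1 := (dX_graphMap (hd q hq) v).symm.trans (hvw.trans (dX_graphMap (hd q hq) w))
    exact Prod.ext (congrFun e1 0) (congrFun e1 1)
  · refine ⟨_, ?_, fun q hq => ⟨isUnitNormalAt_graphMap τ hq (hd q hq),
      meanCurvature_graphFun hH hq⟩⟩
    have c0 : ContinuousOn (fun q : ℝ × ℝ => q.1 ^ 2 + q.2 ^ 2) disk := by fun_prop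
    have c1 : ContinuousOn (fun q : ℝ × ℝ => slope τ H (q.1 ^ 2 + q.2 ^ 2)) disk :=
      (contDiffOn_slope τ H).continuousOn.comp c0 (mapsTo_normSq hH)
    have c2 : ContinuousOn (fun q : ℝ × ℝ => graphNsq τ (q.1 ^ 2 + q.2 ^ 2)
        (slope τ H (q.1 ^ 2 + q.2 ^ 2))) disk := by
      unfold graphNsq
      exact (continuousOn_const.add (continuousOn_const.mul c0)).add
        ((c0.mul (c1.pow 2)).mul ((continuousOn_const.sub c0).pow 2))
    refine ContinuousOn.smul (continuousOn_const.div c2.sqrt fun q hq =>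
      (Real.sqrt_pos.2 (graphNsq_pos (by positivity))).ne') ?_
    rw [continuousOn_pi]
    intro i
    have a1 : ContinuousOn (fun q : ℝ × ℝ => q.1) disk := by fun_prop
    have a2 : ContinuousOn (fun q : ℝ × ℝ => q.2) disk := by fun_prop
    have c3 : ContinuousOn (fun q : ℝ × ℝ => 1 - (q.1 ^ 2 + q.2 ^ 2)) disk := by fun_prop
    fin_cases i
    · exact (((continuousOn_const.mul a2).add ((a1.mul c1).mul c3)).neg.mul c3).div_const 2
    · exact (((continuousOn_const.mul a1).add ((a2.mul c1).mul c3)).neg.mul c3).div_const 2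
    · exact continuousOn_const.add (continuousOn_const.mul c0)
  · refine isCompleteOn_of_proper τ isOpen_disk (contDiffOn_graphMap hH) (fun q hq => hq) ?_
    intro R B hR
    have hrad : ∀ q, rad (graphMap (graphFun τ H) q) ^ 2 = q.1 ^ 2 + q.2 ^ 2 := fun q => rad_sq _
    -- The condition 0 ≤ R empties the set for negative R, where R² carries no information and the
    -- cylinder is empty.
    have hcl : IsClosed {q : ℝ × ℝ | 0 ≤ R ∧ q.1 ^ 2 + q.2 ^ 2 ≤ R ^ 2} := by
      by_cases h : 0 ≤ R
      · simp only [h, true_and]; exact isClosed_le (by fun_prop) continuous_const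
      · simp [h]
    have hsub : {q : ℝ × ℝ | 0 ≤ R ∧ q.1 ^ 2 + q.2 ^ 2 ≤ R ^ 2} ⊆ disk := by
      rintro q ⟨h0, h1⟩
      change q.1 ^ 2 + q.2 ^ 2 < 1
      nlinarith
    have hcomp : IsCompact {q : ℝ × ℝ | 0 ≤ R ∧ q.1 ^ 2 + q.2 ^ 2 ≤ R ^ 2} := by
      refine IsCompact.of_isClosed_subset ((isCompact_Icc (a := (-1 : ℝ)) (b := 1)).prod
        (isCompact_Icc (a := (-1 : ℝ)) (b := 1))) hcl fun q hq => ?_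
      have h1 : q.1 ^ 2 + q.2 ^ 2 < 1 := hsub hq
      exact ⟨abs_le.1 ((sq_le_one_iff_abs_le_one _).1 (by linarith [sq_nonneg q.2])),
        abs_le.1 ((sq_le_one_iff_abs_le_one _).1 (by linarith [sq_nonneg q.1]))⟩
    have : disk ∩ graphMap (graphFun τ H) ⁻¹' cyl R B
        = {q : ℝ × ℝ | 0 ≤ R ∧ q.1 ^ 2 + q.2 ^ 2 ≤ R ^ 2} ∩
          graphMap (graphFun τ H) ⁻¹' cyl R B := by
      ext q
      constructor
      · rintro ⟨h1, h2⟩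
        have h3 := h2.1
        have h0 := rad_nonneg (graphMap (graphFun τ H) q)
        refine ⟨⟨h0.trans h3, ?_⟩, h2⟩
        rw [← hrad]
        exact pow_le_pow_left₀ h0 h3 2
      · rintro ⟨h1, h2⟩
        exact ⟨hsub h1, h2⟩
    rw [this]
    exact IsCompact.of_isClosed_subset hcomp
      (((contDiffOn_graphMap hH).continuousOn.mono hsub).preimage_isClosed_of_isClosed hcl
        (isCompact_cyl R B).isClosed) inter_subset_left

theorem slope_ge {τ H w : ℝ} (hH0 : 0 ≤ H) (hH : 4 * H ^ 2 ≤ 1) (h0 : 0 ≤ w) (h1 : w < 1) :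
    2 * H / (1 - w) ≤ slope τ H w := by
  have hJ := mem_slopeDom τ hH h0 h1
  have h2 : (1 : ℝ) ≤ √(1 + 4 * τ ^ 2 * w) := Real.one_le_sqrt.2 (by nlinarith [mul_nonneg (sq_nonneg τ) h0])
  have h3 : √(1 - 4 * H ^ 2 * w) ≤ 1 := by
    rw [Real.sqrt_le_one]; nlinarith [mul_nonneg (sq_nonneg H) h0]
  have h4 := Real.sqrt_pos.2 hJ.2.2
  have h5 := sub_pos.2 h1
  unfold slope
  rw [div_le_div_iff₀ h5 (mul_pos h5 h4)]
  have : √(1 - 4 * H ^ 2 * w) ≤ √(1 + 4 * τ ^ 2 * w) := h3.trans h2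
  nlinarith [mul_le_mul_of_nonneg_left this (mul_nonneg hH0 h5.le)]

/-- Integrates `slope_ge`. The logarithm gives both the nonnegativity of the height and its
divergence at the boundary of the disk. -/
theorem height_ge {τ H w : ℝ} (hH0 : 0 ≤ H) (hH : 4 * H ^ 2 ≤ 1) (h0 : 0 ≤ w) (h1 : w < 1) :
    -(2 * H) * Real.log (1 - w) ≤ height τ H w := by
  have hmono : MonotoneOn (fun w => height τ H w + 2 * H * Real.log (1 - w)) (Ico 0 1) := by
    have hd : ∀ y ∈ Ico (0 : ℝ) 1, HasDerivAt (fun w => height τ H w + 2 * H * Real.log (1 - w))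
        (slope τ H y - 2 * H / (1 - y)) y := by
      intro y hy
      have h2 := (((hasDerivAt_id y).const_sub 1).log (sub_pos.2 hy.2).ne').const_mul (2 * H)
      refine ((hasDerivAt_height (mem_slopeDom τ hH hy.1 hy.2)).add h2).congr_deriv ?_
      simp only [id]
      ring
    refine monotoneOn_of_hasDerivWithinAt_nonneg (convex_Ico 0 1)
      (fun y hy => (hd y hy).continuousAt.continuousWithinAt)
      (fun y hy => (hd y (interior_subset hy)).hasDerivWithinAt) fun y hy => ?_
    have := interior_subset hy
    exact sub_nonneg.2 (slope_ge hH0 hH this.1 this.2)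
  have := hmono ⟨le_rfl, zero_lt_one⟩ ⟨h0, h1⟩ h0
  simp only [height_zero, sub_zero, Real.log_one, mul_zero, add_zero] at this
  linarith

theorem height_nonneg {τ H w : ℝ} (hH0 : 0 ≤ H) (hH : 4 * H ^ 2 ≤ 1) (h0 : 0 ≤ w) (h1 : w < 1) :
    0 ≤ height τ H w := by
  refine le_trans ?_ (height_ge hH0 hH h0 h1)
  have := Real.log_nonpos (sub_pos.2 h1).le (by linarith)
  nlinarith

theorem fderiv_graphFun (τ H : ℝ) : fderiv ℝ (graphFun τ H) (0, 0) = 0 := by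
  have h := hasDerivAt_height (zero_mem_slopeDom τ H)
  have h2 := hasFDerivAt_radial (U := height τ H) (q := (0, 0)) (u := slope τ H 0)
    (by simpa using h)
  refine h2.fderiv.trans ?_
  ext <;> simp

theorem hasDerivAt_height_sq {τ H s : ℝ} (hs : s ^ 2 ∈ slopeDom τ H) :
    HasDerivAt (fun s => height τ H (s ^ 2)) (slope τ H (s ^ 2) * (2 * s)) s := by
  have := HasDerivAt.comp (h₂ := height τ H) (h := fun s => s ^ 2) s (hasDerivAt_height hs)
    (hasDerivAt_pow 2 s)
  exact this.congr_deriv (by norm_num)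

theorem sq_mem_slopeDom (τ : ℝ) {H s : ℝ} (hH : 4 * H ^ 2 ≤ 1) (hs : |s| < 1) :
    s ^ 2 ∈ slopeDom τ H :=
  mem_slopeDom τ hH (sq_nonneg s) ((sq_lt_one_iff_abs_lt_one s).2 hs)

/-- Identifies the graph as the member with constant −2H, so that `IsGenerating.curvJ_eq` applies to
its profile across the axis. -/
theorem firstInt_graph {τ H s : ℝ} (hH : 4 * H ^ 2 ≤ 1) (hs : |s| < 1) :
    firstInt τ s 1 (slope τ H (s ^ 2) * (2 * s)) = 2 * H * ch s + -2 * H := by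
  have hJ := sq_mem_slopeDom τ hH hs
  have h1 := one_sub_sq_pos hs
  have h2 := Real.sqrt_pos.2 hJ.2.1
  have h3 := Real.sqrt_pos.2 hJ.2.2
  have h4 := Real.sq_sqrt hJ.2.1.le
  have h5 := Real.sq_sqrt hJ.2.2.le
  have e : √(nsq τ s 1 (slope τ H (s ^ 2) * (2 * s)))
      = cf s * (√(1 + 4 * τ ^ 2 * s ^ 2) / √(1 - 4 * H ^ 2 * s ^ 2)) := by
    rw [← Real.sqrt_sq (mul_pos (cf_pos hs) (div_pos h2 h3)).le]
    congr 1
    simp only [nsq, slope, ee, cf]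
    nth_rw 2 [← h4]
    generalize √(1 + 4 * τ ^ 2 * s ^ 2) = e at *
    generalize √(1 - 4 * H ^ 2 * s ^ 2) = G at *
    field_simp
    linear_combination h5
  rw [firstInt, e, slope, cf, ch]
  generalize √(1 + 4 * τ ^ 2 * s ^ 2) = e at *
  generalize √(1 - 4 * H ^ 2 * s ^ 2) = G at *
  field_simp
  ring

theorem isGenerating_graph (τ : ℝ) {H : ℝ} (hH : 4 * H ^ 2 ≤ 1) :
    IsGenerating (Ioo (-1) 1) (fun s => s) (fun s => height τ H (s ^ 2)) where
  isOpen := isOpen_Ioo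
  smooth_x := contDiffOn_id
  smooth_t := (contDiffOn_height τ H).comp (contDiffOn_id.pow 2)
    fun _ hs => sq_mem_slopeDom τ hH (abs_lt.2 hs)
  lt_one _ hs := abs_lt.2 hs
  regular s _ := Or.inl (by simp)

theorem isRotationalHSurface_graph (τ : ℝ) {H : ℝ} (hH : 4 * H ^ 2 ≤ 1) :
    IsRotationalHSurface τ H (rotMap (fun s => s) (fun s => height τ H (s ^ 2)) ''
      (Ioo (-1) 1 ×ˢ univ)) := by
  have hd : ∀ s ∈ Ioo (-1 : ℝ) 1, deriv (fun s => height τ H (s ^ 2)) s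
      = slope τ H (s ^ 2) * (2 * s) := fun s hs =>
    (hasDerivAt_height_sq (sq_mem_slopeDom τ hH (abs_lt.2 hs))).deriv
  have hx : ∀ s : ℝ, deriv (fun s : ℝ => s) s = 1 := fun s => (hasDerivAt_id s).deriv
  refine (isGenerating_graph τ hH).isRotationalHSurface ordConnected_Ioo ⟨0, by simp⟩ ?_
    fun s hs => (isGenerating_graph τ hH).curvJ_eq (d := -2 * H) ?_ ?_ hs
  · intro s hs h0
    rw [hd s hs]
    rw [show s = 0 from h0]
    simp
  · intro s hs
    rw [hd s hs, hx]
    exact firstInt_graph hH (abs_lt.2 hs)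
  · intro s _
    exact Eventually.of_forall fun y => by rw [hx]; exact one_ne_zero

/-- The surface needs both parametrizations: the graph is an immersion at the tip, and the rotated
curve exhibits it as a rotational surface. -/
theorem graphMap_image_eq (τ H : ℝ) : graphMap (graphFun τ H) '' disk
    = rotMap (fun s => s) (fun s => height τ H (s ^ 2)) '' (Ioo (-1) 1 ×ˢ univ) := by
  ext p
  constructor
  · rintro ⟨q, hq, rfl⟩
    have hr := rad_sq (graphMap (graphFun τ H) q)
    have hr1 := rad_lt_one (show graphMap (graphFun τ H) q ∈ ambient from hq)
    have hr0 := rad_nonneg (graphMap (graphFun τ H) q)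
    set r := rad (graphMap (graphFun τ H) q)
    have hr' : r ^ 2 = q.1 ^ 2 + q.2 ^ 2 := hr
    obtain ⟨θ, h1, h2⟩ : ∃ θ : ℝ, r * Real.cos θ = q.1 ∧ r * Real.sin θ = q.2 := by
      refine ⟨Complex.arg ⟨q.1, q.2⟩, ?_⟩
      have : ‖(⟨q.1, q.2⟩ : ℂ)‖ = r := by
        rw [Complex.norm_def, Complex.normSq_mk, ← Real.sqrt_sq hr0, hr']
        congr 1; ring
      rw [← this]
      exact ⟨Complex.norm_mul_cos_arg _, Complex.norm_mul_sin_arg _⟩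
    refine ⟨(r, θ), ⟨⟨by linarith, hr1⟩, mem_univ _⟩, ?_⟩
    ext i
    fin_cases i
    · exact h1
    · exact h2
    · simp [rotMap, graphMap, graphFun, hr']
  · rintro ⟨⟨s, θ⟩, ⟨hs, -⟩, rfl⟩
    have e : (s * Real.cos θ) ^ 2 + (s * Real.sin θ) ^ 2 = s ^ 2 := by
      linear_combination s ^ 2 * Real.sin_sq_add_cos_sq θ
    refine ⟨(s * Real.cos θ, s * Real.sin θ), ?_, ?_⟩
    · change (s * Real.cos θ) ^ 2 + (s * Real.sin θ) ^ 2 < 1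
      rw [e]
      exact (sq_lt_one_iff_abs_lt_one s).2 (abs_lt.2 hs)
    · simp [rotMap, graphMap, graphFun, e]

/-! ### The profile curves -/

/-- Hyperbolic cosine of the neck distance. -/
def neckCosh (H d : ℝ) : ℝ :=
  if H < 1 / 2 then (2 * d * H + √(1 - 4 * H ^ 2 + d ^ 2)) / (1 - 4 * H ^ 2)
  else (1 + d ^ 2) / (-2 * d)

theorem neckDistance_eq (H d : ℝ) : neckDistance H d = Real.arcosh (neckCosh H d) := by
  unfold neckDistance neckCosh; split_ifs <;> rfl

/-- The discriminant `√(1 - 4H² + d²)`. -/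
def disc (H d : ℝ) : ℝ := √(1 - 4 * H ^ 2 + d ^ 2)

/-- Hyperbolic cosine of the distance to the axis along the profile curve. -/
def prC (H d s : ℝ) : ℝ := neckCosh H d + s ^ 2

/-- Radius along the profile curve. -/
def prX (H d s : ℝ) : ℝ := √((prC H d s - 1) / (prC H d s + 1))

/-- The positive factor `Q(c) / (c - c₁)` of `Q(c) = c² - 1 - (2Hc + d)²`. -/
def prQ (H d s : ℝ) : ℝ := (1 - 4 * H ^ 2) * s ^ 2 + 2 * disc H d

/-- Derivative of the height along the profile curve. -/
def prSlope (τ H d s : ℝ) : ℝ :=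
  2 * (2 * H * prC H d s + d) * √(ee τ (prX H d s)) /
    ((prC H d s + 1) * prX H d s * √(prQ H d s))

/-- Height along the profile curve. -/
def prT (τ H d s : ℝ) : ℝ := ∫ y in (0 : ℝ)..s, prSlope τ H d y

/-- The parameters of the family. -/
structure IsParam (H d : ℝ) : Prop where
  pos : 0 < H
  le : H ≤ 1 / 2
  adm : Admissible H d

namespace IsParam

variable {H d : ℝ}

theorem four_sq_le (h : IsParam H d) : 4 * H ^ 2 ≤ 1 := by nlinarith [h.pos, h.le]

theorem disc_pos (h : IsParam H d) : 0 < disc H d := by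
  refine Real.sqrt_pos.2 ?_
  rcases h.adm with h' | ⟨h', hd⟩
  · nlinarith [h.pos, sq_nonneg d]
  · rw [h']; nlinarith

theorem disc_sq (h : IsParam H d) : disc H d ^ 2 = 1 - 4 * H ^ 2 + d ^ 2 :=
  Real.sq_sqrt (by nlinarith [h.four_sq_le, sq_nonneg d])

/-- The left side is Q'(c₁)/2. Together with `neckCosh_sq`, which says Q(c₁) = 0, it lets the cases
H < 1/2 and H = 1/2 be treated alike in the factorization of Q. -/
theorem neckCosh_mul (h : IsParam H d) :
    (1 - 4 * H ^ 2) * neckCosh H d - 2 * H * d = disc H d := by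
  rcases h.adm with h' | ⟨h', hd⟩
  · have : 1 - 4 * H ^ 2 ≠ 0 := by nlinarith [h.pos]
    rw [neckCosh, if_pos h', disc]
    field_simp
    ring
  · have e : disc H d = -d := by
      rw [disc, h', ← Real.sqrt_sq (neg_pos.2 hd).le]
      congr 1; ring
    rw [e, h']; ring

theorem neckCosh_sq (h : IsParam H d) : neckCosh H d ^ 2 - 1 = (2 * H * neckCosh H d + d) ^ 2 := by
  rcases h.adm with h' | ⟨h', hd⟩
  · have h1 : 1 - 4 * H ^ 2 ≠ 0 := by nlinarith [h.pos]
    have h2 := h.neckCosh_mul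
    have h3 := h.disc_sq
    rw [← h2] at h3
    have : (1 - 4 * H ^ 2) * (neckCosh H d ^ 2 - 1 - (2 * H * neckCosh H d + d) ^ 2) = 0 := by
      linear_combination h3
    have := (mul_eq_zero.1 this).resolve_left h1
    linarith
  · have : d ≠ 0 := hd.ne
    rw [neckCosh, if_neg (by rw [h']; norm_num), h']
    field_simp
    ring

theorem neckCosh_pos (h : IsParam H d) : 0 < neckCosh H d := by
  rcases h.adm with h' | ⟨h', hd⟩
  · have h1 : 0 < 1 - 4 * H ^ 2 := by nlinarith [h.pos]
    rw [neckCosh, if_pos h']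
    refine div_pos ?_ h1
    have h2 := h.disc_sq
    have h3 := h.disc_pos
    change 0 < 2 * d * H + disc H d
    have h4 : |2 * d * H| < disc H d := by
      refine abs_lt_of_sq_lt_sq ?_ h3.le
      rw [h2]
      nlinarith [mul_pos h1 (show 0 < 1 + d ^ 2 by positivity)]
    linarith [(abs_lt.1 h4).1]
  · rw [neckCosh, if_neg (by rw [h']; norm_num)]
    exact div_pos (by positivity) (by linarith)

theorem one_le_neckCosh (h : IsParam H d) : 1 ≤ neckCosh H d := by
  nlinarith [h.neckCosh_pos, h.neckCosh_sq, sq_nonneg (2 * H * neckCosh H d + d)]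

theorem one_lt_neckCosh (h : IsParam H d) (hd : d ≠ -2 * H) : 1 < neckCosh H d := by
  refine lt_of_le_of_ne h.one_le_neckCosh fun e => hd ?_
  have := h.neckCosh_sq
  rw [← e] at this
  have : 2 * H * 1 + d = 0 := by
    rw [← sq_eq_zero_iff]; linarith
  linarith

theorem prQ_pos (h : IsParam H d) (s : ℝ) : 0 < prQ H d s := by
  have := h.disc_pos
  have := mul_nonneg (sub_nonneg.2 h.four_sq_le) (sq_nonneg s)
  unfold prQ; linarith

/-- Factorization of `c² - 1 - (2Hc + d)²` along the profile curve. -/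
theorem prC_sq (h : IsParam H d) (s : ℝ) :
    prC H d s ^ 2 - 1 = (2 * H * prC H d s + d) ^ 2 + s ^ 2 * prQ H d s := by
  unfold prC prQ
  linear_combination h.neckCosh_sq + 2 * s ^ 2 * h.neckCosh_mul

theorem neckCosh_le_prC (s : ℝ) : neckCosh H d ≤ prC H d s := by
  unfold prC; nlinarith [sq_nonneg s]

theorem one_le_prC (h : IsParam H d) (s : ℝ) : 1 ≤ prC H d s :=
  h.one_le_neckCosh.trans (neckCosh_le_prC s)

theorem one_lt_prC (h : IsParam H d) (hd : d ≠ -2 * H) (s : ℝ) : 1 < prC H d s :=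
  (h.one_lt_neckCosh hd).trans_le (neckCosh_le_prC s)

theorem prX_sq (h : IsParam H d) (s : ℝ) :
    prX H d s ^ 2 = (prC H d s - 1) / (prC H d s + 1) := by
  have := h.one_le_prC s
  exact Real.sq_sqrt (div_nonneg (by linarith) (by linarith))

theorem prX_nonneg (s : ℝ) : 0 ≤ prX H d s := Real.sqrt_nonneg _

theorem prX_pos (h : IsParam H d) (hd : d ≠ -2 * H) (s : ℝ) : 0 < prX H d s := by
  have := h.one_lt_prC hd s
  exact Real.sqrt_pos.2 (div_pos (by linarith) (by linarith))

theorem prX_lt_one (h : IsParam H d) (s : ℝ) : prX H d s < 1 := by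
  have := h.one_le_prC s
  have h2 := h.prX_sq s
  have h3 : (prC H d s - 1) / (prC H d s + 1) < 1 := by
    rw [div_lt_one (by linarith)]; linarith
  nlinarith [prX_nonneg (H := H) (d := d) s]

theorem abs_prX_lt_one (h : IsParam H d) (s : ℝ) : |prX H d s| < 1 := by
  rw [abs_of_nonneg (prX_nonneg s)]; exact h.prX_lt_one s

theorem cf_prX (h : IsParam H d) (s : ℝ) : cf (prX H d s) = prC H d s + 1 := by
  have := h.one_le_prC s
  have h1 : prC H d s + 1 ≠ 0 := by linarith
  rw [cf, h.prX_sq]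
  have : 1 - (prC H d s - 1) / (prC H d s + 1) = 2 / (prC H d s + 1) := by
    field_simp; ring
  rw [this]
  field_simp

theorem ch_prX (h : IsParam H d) (s : ℝ) : ch (prX H d s) = prC H d s := by
  have := h.one_le_prC s
  have h1 : prC H d s + 1 ≠ 0 := by linarith
  rw [ch, h.prX_sq]
  have h2 : 1 - (prC H d s - 1) / (prC H d s + 1) = 2 / (prC H d s + 1) := by
    field_simp; ring
  rw [h2]
  field_simp
  ring

theorem contDiff_prX (h : IsParam H d) (hd : d ≠ -2 * H) : ContDiff ℝ ∞ (prX H d) := by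
  have h1 : ContDiff ℝ ∞ (prC H d) := by unfold prC; fun_prop
  refine ContDiff.sqrt (ContDiff.div (by fun_prop) (by fun_prop) fun s => ?_) fun s => ?_
  · linarith [h.one_lt_prC hd s]
  · have := h.one_lt_prC hd s
    exact (div_pos (by linarith) (by linarith)).ne'

theorem contDiff_prSlope (h : IsParam H d) (hd : d ≠ -2 * H) (τ : ℝ) :
    ContDiff ℝ ∞ (prSlope τ H d) := by
  have h1 : ContDiff ℝ ∞ (prC H d) := by unfold prC; fun_prop
  have h2 := h.contDiff_prX hd
  have h3 : ContDiff ℝ ∞ (fun s => √(prQ H d s)) :=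
    ContDiff.sqrt (by unfold prQ; fun_prop) fun s => (h.prQ_pos s).ne'
  have h4 : ContDiff ℝ ∞ (fun s => √(ee τ (prX H d s))) :=
    ContDiff.sqrt (by unfold ee; fun_prop) fun s => (ee_pos _ _).ne'
  unfold prSlope
  refine ContDiff.div (by fun_prop) (by fun_prop) fun s => ?_
  have := h.one_lt_prC hd s
  have := h.prX_pos hd s
  have := Real.sqrt_pos.2 (h.prQ_pos s)
  positivity

theorem hasDerivAt_prT (h : IsParam H d) (hd : d ≠ -2 * H) (τ s : ℝ) :
    HasDerivAt (prT τ H d) (prSlope τ H d s) s :=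
  hasDerivAt_integral_of_continuousOn isOpen_univ ordConnected_univ
    (h.contDiff_prSlope hd τ).continuous.continuousOn (mem_univ _) (mem_univ _)

theorem contDiff_prT (h : IsParam H d) (hd : d ≠ -2 * H) (τ : ℝ) : ContDiff ℝ ∞ (prT τ H d) :=
  contDiffOn_univ.1 (contDiffOn_integral isOpen_univ ordConnected_univ
    (h.contDiff_prSlope hd τ).contDiffOn (mem_univ _))

theorem hasDerivAt_prX (h : IsParam H d) (hd : d ≠ -2 * H) (s : ℝ) :
    HasDerivAt (prX H d) (2 * s / ((prC H d s + 1) ^ 2 * prX H d s)) s := by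
  have h0 := h.one_lt_prC hd s
  have h1 : prC H d s + 1 ≠ 0 := by linarith
  have h2 : prC H d s - 1 ≠ 0 := by linarith
  have hc : HasDerivAt (prC H d) (2 * s) s :=
    ((hasDerivAt_pow 2 s).const_add _).congr_deriv (by norm_num)
  have := ((hc.sub_const 1).div (hc.add_const 1) h1).sqrt (div_ne_zero h2 h1)
  refine this.congr_deriv ?_
  change _ / (2 * prX H d s) = _
  have := (h.prX_pos hd s).ne'
  field_simp
  ring

/-- Since ((c + 1)x)² = c² − 1, the factorization `prC_sq` turns the sum of the two terms of `nsq`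
into a perfect square. -/
theorem sqrt_nsq (h : IsParam H d) (hd : d ≠ -2 * H) (τ s : ℝ) :
    √(nsq τ (prX H d s) (2 * s / ((prC H d s + 1) ^ 2 * prX H d s)) (prSlope τ H d s))
      = 2 * √(ee τ (prX H d s)) / √(prQ H d s) := by
  have h0 := h.one_lt_prC hd s
  have hx := h.prX_pos hd s
  have hq := Real.sqrt_pos.2 (h.prQ_pos s)
  have he := Real.sqrt_pos.2 (ee_pos τ (prX H d s))
  have hq2 := Real.sq_sqrt (h.prQ_pos s).le
  have he2 := Real.sq_sqrt (ee_pos τ (prX H d s)).le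
  have hC := h.prC_sq s
  have hX := h.prX_sq s
  rw [← Real.sqrt_sq (div_pos (mul_pos two_pos he) hq).le]
  congr 1
  rw [nsq, h.cf_prX, prSlope]
  nth_rw 2 [← he2]
  rw [← hq2] at hC
  have h1 : 0 < prC H d s + 1 := by linarith
  rw [eq_div_iff h1.ne'] at hX
  generalize √(ee τ (prX H d s)) = e at *
  generalize √(prQ H d s) = G at *
  generalize prX H d s = X at *
  generalize prC H d s = c at *
  have hm : (c + 1) ^ 2 * X ^ 2 = (2 * H * c + d) ^ 2 + s ^ 2 * G ^ 2 := by
    rw [← hC]; linear_combination (c + 1) * hX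
  have : (2 * (2 * H * c + d) * e / ((c + 1) * X * G)) ^ 2
      + (c + 1) ^ 2 * (2 * s / ((c + 1) ^ 2 * X)) ^ 2 * e ^ 2
      = 4 * e ^ 2 * ((2 * H * c + d) ^ 2 + s ^ 2 * G ^ 2) / ((c + 1) ^ 2 * X ^ 2 * G ^ 2) := by
    field_simp
    ring
  rw [this, ← hm]
  field_simp
  ring

theorem firstInt_profile (h : IsParam H d) (hd : d ≠ -2 * H) (τ s : ℝ) :
    firstInt τ (prX H d s) (2 * s / ((prC H d s + 1) ^ 2 * prX H d s)) (prSlope τ H d s)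
      = 2 * H * ch (prX H d s) + d := by
  have h0 := h.one_lt_prC hd s
  have hx := h.prX_pos hd s
  have hq := Real.sqrt_pos.2 (h.prQ_pos s)
  have he := Real.sqrt_pos.2 (ee_pos τ (prX H d s))
  have h1 : 0 < prC H d s + 1 := by linarith
  rw [firstInt, h.sqrt_nsq hd, h.cf_prX, h.ch_prX, prSlope]
  field_simp

/-- Gives t' ≠ 0 at the neck, the only place where x' vanishes, so the profile is regular there. -/
theorem two_mul_neckCosh_ne (h : IsParam H d) (hd : d ≠ -2 * H) : 2 * H * neckCosh H d + d ≠ 0 := by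
  intro e
  have := h.neckCosh_sq
  rw [e] at this
  nlinarith [h.one_lt_neckCosh hd]

theorem isGenerating_profile (h : IsParam H d) (hd : d ≠ -2 * H) (τ : ℝ) :
    IsGenerating univ (prX H d) (prT τ H d) where
  isOpen := isOpen_univ
  smooth_x := (h.contDiff_prX hd).contDiffOn
  smooth_t := (h.contDiff_prT hd τ).contDiffOn
  lt_one s _ := h.abs_prX_lt_one s
  regular s _ := by
    rw [(h.hasDerivAt_prX hd s).deriv, (h.hasDerivAt_prT hd τ s).deriv]
    have h0 := h.one_lt_prC hd s
    have hx := h.prX_pos hd s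
    have hq := Real.sqrt_pos.2 (h.prQ_pos s)
    have he := Real.sqrt_pos.2 (ee_pos τ (prX H d s))
    have h1 : 0 < prC H d s + 1 := by linarith
    rcases eq_or_ne s 0 with rfl | hs
    · right
      have := h.two_mul_neckCosh_ne hd
      have h3 : 2 * H * prC H d 0 + d ≠ 0 := by simpa [prC] using this
      unfold prSlope
      positivity
    · left; positivity

theorem curvJ_profile (h : IsParam H d) (hd : d ≠ -2 * H) (τ s : ℝ) :
    curvJ τ (prX H d s) (deriv (prX H d) s) (deriv (prT τ H d) s) (deriv (deriv (prX H d)) s)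
      (deriv (deriv (prT τ H d)) s) = 2 * H * cf (prX H d s) ^ 2 * prX H d s := by
  refine (h.isGenerating_profile hd τ).curvJ_eq (d := d) ?_ ?_ (mem_univ s)
  · intro s _
    rw [(h.hasDerivAt_prX hd s).deriv, (h.hasDerivAt_prT hd τ s).deriv]
    exact h.firstInt_profile hd τ s
  · intro s _
    have hne : ∀ y ≠ 0, deriv (prX H d) y ≠ 0 := by
      intro y hy
      rw [(h.hasDerivAt_prX hd y).deriv]
      have h0 := h.one_lt_prC hd y
      have hx := h.prX_pos hd y
      have h1 : 0 < prC H d y + 1 := by linarith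
      positivity
    rcases eq_or_ne s 0 with rfl | hs
    · filter_upwards [self_mem_nhdsWithin] with y hy using hne y hy
    · filter_upwards [nhdsWithin_le_nhds (isOpen_ne.mem_nhds hs)] with y hy using hne y hy

/-! ### Symmetry, properness and height of the profile curves -/

theorem prX_neg (s : ℝ) : prX H d (-s) = prX H d s := by simp [prX, prC]

theorem prT_zero (τ : ℝ) : prT τ H d 0 = 0 := by simp [prT]

theorem prT_neg (τ s : ℝ) : prT τ H d (-s) = -prT τ H d s := by
  have h1 : ∀ s, prSlope τ H d (-s) = prSlope τ H d s := by
    intro s; simp only [prSlope, prX_neg, prC, prQ, neg_sq]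
  have := intervalIntegral.integral_comp_neg (fun y => prSlope τ H d y) (a := 0) (b := s)
  simp only [h1, neg_zero] at this
  rw [prT, prT, this, intervalIntegral.integral_symm]

/-- Follows from s² ≤ c. The bound does not involve d, so a compact set meets all members in one
fixed parameter interval; the degeneration depends on this. -/
theorem abs_le_of_prX_le (h : IsParam H d) {R : ℝ} (hR : R < 1) {s : ℝ} (hs : prX H d s ≤ R) :
    |s| ≤ (1 + R ^ 2) / (1 - R ^ 2) + 1 := by
  have h0 := h.one_le_prC s
  have hx0 := prX_nonneg (H := H) (d := d) s
  have h1 : prX H d s ^ 2 ≤ R ^ 2 := pow_le_pow_left₀ hx0 hs 2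
  rw [h.prX_sq, div_le_iff₀ (by linarith)] at h1
  have h2 : 0 < 1 - R ^ 2 := by nlinarith
  have h3 : prC H d s ≤ (1 + R ^ 2) / (1 - R ^ 2) := by
    rw [le_div_iff₀ h2]; linarith
  have h4 : s ^ 2 ≤ prC H d s := by unfold prC; linarith [h.one_le_neckCosh]
  have h5 : |s| ≤ s ^ 2 + 1 := by
    rw [← sq_abs]; nlinarith [sq_nonneg (|s| - 1)]
  linarith

theorem prX_strictMono (h : IsParam H d) {s s' : ℝ} (hs : s ^ 2 < s' ^ 2) :
    prX H d s < prX H d s' := by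
  have h0 := h.one_le_prC s
  have h1 := h.one_le_prC s'
  have h2 : prC H d s < prC H d s' := by unfold prC; linarith
  refine Real.sqrt_lt_sqrt (div_nonneg (by linarith) (by linarith)) ?_
  rw [div_lt_div_iff₀ (by linarith) (by linarith)]
  nlinarith

theorem prX_le (h : IsParam H d) (s : ℝ) : prX H d 0 ≤ prX H d s := by
  rcases eq_or_ne s 0 with rfl | hs
  · rfl
  · exact (h.prX_strictMono (by rw [zero_pow two_ne_zero]; positivity)).le

theorem isProperHAnnulus_profile (h : IsParam H d) (hd : d ≠ -2 * H) (τ : ℝ) :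
    IsProperHAnnulus τ H (annulus (prX H d) (prT τ H d)) :=
  isProperHAnnulus_annulus (h.isGenerating_profile hd τ) (h.prX_pos hd 0) h.prX_le
    (fun _ hR => ⟨_, fun _ hs => h.abs_le_of_prX_le hR hs⟩) (h.curvJ_profile hd τ)

theorem isRotationalHSurface_profile (h : IsParam H d) (hd : d ≠ -2 * H) (τ : ℝ) :
    IsRotationalHSurface τ H (rotMap (prX H d) (prT τ H d) '' (univ ×ˢ univ)) :=
  (h.isGenerating_profile hd τ).isRotationalHSurface ordConnected_univ univ_nonempty
    (fun s _ e => absurd e (h.prX_pos hd s).ne') fun s _ => h.curvJ_profile hd τ s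

theorem prSlope_pos (h : IsParam H d) (hd : d ≠ -2 * H) (τ : ℝ) {s : ℝ}
    (hs : 0 < 2 * H * prC H d s + d) : 0 < prSlope τ H d s := by
  have h0 := h.one_lt_prC hd s
  have hx := h.prX_pos hd s
  have hq := Real.sqrt_pos.2 (h.prQ_pos s)
  have he := Real.sqrt_pos.2 (ee_pos τ (prX H d s))
  have h1 : 0 < prC H d s + 1 := by linarith
  unfold prSlope
  positivity

theorem prSlope_neg (h : IsParam H d) (hd : d ≠ -2 * H) (τ : ℝ) {s : ℝ}
    (hs : 2 * H * prC H d s + d < 0) : prSlope τ H d s < 0 := by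
  have h0 := h.one_lt_prC hd s
  have hx := h.prX_pos hd s
  have hq := Real.sqrt_pos.2 (h.prQ_pos s)
  have he := Real.sqrt_pos.2 (ee_pos τ (prX H d s))
  have h1 : 0 < prC H d s + 1 := by linarith
  unfold prSlope
  exact div_neg_of_neg_of_pos (by nlinarith) (by positivity)

/-- Here 2Hc + d > 0 because c ≥ 1, so the height is strictly increasing through the neck. -/
theorem prT_injective (h : IsParam H d) (hd : -2 * H < d) (τ : ℝ) :
    Function.Injective (prT τ H d) := by
  refine StrictMono.injective (strictMono_of_hasDerivAt_pos (h.hasDerivAt_prT hd.ne' τ) fun s => ?_)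
  refine h.prSlope_pos hd.ne' τ ?_
  nlinarith [h.one_le_prC s, h.pos]

/-- For large s the slope is at least H/(s + A), so the height grows at least logarithmically; the
estimate covers H = 1/2 as well. -/
theorem tendsto_prT (h : IsParam H d) (hd : d ≠ -2 * H) (τ : ℝ) :
    Tendsto (prT τ H d) atTop atTop := by
  -- Chosen so that `prQ` is at most (s + A)² for s ≥ 0.
  set A := 2 * disc H d + 1
  have hA : 1 < A := by have := h.disc_pos; simp only [A]; linarith
  -- Beyond s0 half of the term 2Hc absorbs d, leaving 2Hc + d ≥ Hc.
  obtain ⟨s0, hs0, hs0'⟩ : ∃ s0, 0 ≤ s0 ∧ ∀ s, s0 ≤ s → -d ≤ H * prC H d s := by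
    refine ⟨|d| / H + 1, by have := h.pos; positivity, fun s hs => ?_⟩
    have h1 : |d| / H ≤ s ^ 2 := by
      have : 0 ≤ |d| / H := div_nonneg (abs_nonneg _) h.pos.le
      nlinarith
    rw [div_le_iff₀ h.pos] at h1
    have h2 : s ^ 2 ≤ prC H d s := by unfold prC; linarith [h.one_le_neckCosh]
    have := neg_abs_le d
    nlinarith [h.pos]
  have hslope : ∀ s, s0 ≤ s → H * (1 / (s + A)) ≤ prSlope τ H d s := by
    intro s hs
    have h0 := h.one_lt_prC hd s
    have hx := h.prX_pos hd s
    have hx1 := h.prX_lt_one s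
    have hq := Real.sqrt_pos.2 (h.prQ_pos s)
    have he : 1 ≤ √(ee τ (prX H d s)) := Real.one_le_sqrt.2 (by unfold ee; nlinarith [mul_nonneg (sq_nonneg τ) (sq_nonneg (prX H d s))])
    have hqA : √(prQ H d s) ≤ s + A := by
      refine Real.sqrt_le_iff.2 ⟨by linarith, ?_⟩
      have h1 := h.disc_pos
      have h2 := mul_nonneg (sq_nonneg H) (sq_nonneg s)
      have h3 : 0 ≤ s := hs0.trans hs
      have h4 := mul_nonneg h3 h1.le
      simp only [prQ, A]
      nlinarith [sq_nonneg (disc H d)]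
    have h1 := hs0' s hs
    have hpos := h.pos
    have hHc : 0 < H * prC H d s := mul_pos hpos (by linarith)
    unfold prSlope
    rw [mul_one_div, div_le_div_iff₀ (by linarith) (by positivity)]
    have a1 : (prC H d s + 1) * prX H d s * √(prQ H d s) ≤ (2 * prC H d s) * 1 * (s + A) := by
      gcongr
      linarith
    have a2 : 2 * (H * prC H d s) * 1 ≤ 2 * (2 * H * prC H d s + d) * √(ee τ (prX H d s)) :=
      mul_le_mul (by linarith) he zero_le_one (by linarith)
    calc H * ((prC H d s + 1) * prX H d s * √(prQ H d s))
        ≤ H * ((2 * prC H d s) * 1 * (s + A)) := by gcongr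
      _ = 2 * (H * prC H d s) * 1 * (s + A) := by ring
      _ ≤ _ := by
        have : 0 ≤ s + A := by linarith
        gcongr
  have hmono : MonotoneOn (fun s => prT τ H d s - H * Real.log (s + A)) (Ici s0) := by
    have hder : ∀ s ∈ Ici s0, HasDerivAt (fun s => prT τ H d s - H * Real.log (s + A))
        (prSlope τ H d s - H * (1 / (s + A))) s := by
      intro s hs
      have hsA : s + A ≠ 0 := by
        have : s0 ≤ s := hs
        linarith
      exact (h.hasDerivAt_prT hd τ s).sub ((((hasDerivAt_id s).add_const A).log hsA).const_mul H)
    refine monotoneOn_of_hasDerivWithinAt_nonneg (convex_Ici s0)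
      (fun y hy => (hder y hy).continuousAt.continuousWithinAt)
      (fun y hy => (hder y (interior_subset hy)).hasDerivWithinAt) fun y hy => ?_
    exact sub_nonneg.2 (hslope y (interior_subset hy))
  have hlim : Tendsto (fun s => (prT τ H d s0 - H * Real.log (s0 + A)) + H * Real.log (s + A))
      atTop atTop := by
    refine tendsto_atTop_add_const_left _ _ (Tendsto.const_mul_atTop h.pos ?_)
    exact Real.tendsto_log_atTop.comp (tendsto_atTop_add_const_right _ _ tendsto_id)
  refine tendsto_atTop_mono' _ ?_ hlim
  filter_upwards [eventually_ge_atTop s0] with s hs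
  have := hmono (mem_Ici.2 le_rfl) (mem_Ici.2 hs) hs
  simp only at this
  linarith

/-- The height starts at 0, decreases while 2Hc + d < 0 and finally tends to infinity, so it returns
to 0 where it is increasing. -/
theorem exists_prT_eq_zero (h : IsParam H d) (hd : d < -2 * H) (τ : ℝ) :
    ∃ s, 0 < s ∧ prT τ H d s = 0 ∧ 0 < prSlope τ H d s := by
  have hH := h.pos
  have hc1 := h.one_lt_neckCosh hd.ne
  -- Otherwise 0 ≤ 2Hc₁ + d ≤ 2H(c₁ − 1) ≤ c₁ − 1, and Q(c₁) = 0 gives c₁² − 1 ≤ (c₁ − 1)²,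
  -- impossible for c₁ > 1.
  have hneg : 2 * H * neckCosh H d + d < 0 := by
    by_contra hcon
    have h1 : 2 * H * neckCosh H d + d ≤ neckCosh H d - 1 := by nlinarith [h.le]
    have h2 := pow_le_pow_left₀ (not_lt.1 hcon) h1 2
    rw [← h.neckCosh_sq] at h2
    nlinarith
  have hy : 0 < -d / (2 * H) - neckCosh H d := by
    rw [sub_pos, lt_div_iff₀ (by positivity)]; linarith
  -- The parameter at which 2Hc + d, and with it the slope, changes sign.
  set s0 := √(-d / (2 * H) - neckCosh H d) with hs0
  have hs0pos : 0 < s0 := Real.sqrt_pos.2 hy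
  have hs0sq : 2 * H * (neckCosh H d + s0 ^ 2) + d = 0 := by
    rw [hs0, Real.sq_sqrt hy.le]; field_simp; ring
  have hanti : StrictAntiOn (prT τ H d) (Icc 0 s0) := by
    refine strictAntiOn_of_deriv_neg (convex_Icc 0 s0)
      (h.contDiff_prT hd.ne τ).continuous.continuousOn fun s hs => ?_
    rw [interior_Icc] at hs
    rw [(h.hasDerivAt_prT hd.ne τ s).deriv]
    refine h.prSlope_neg hd.ne τ ?_
    rw [← hs0sq, prC]
    have : s ^ 2 < s0 ^ 2 := by nlinarith [hs.1, hs.2]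
    nlinarith
  have h1 : prT τ H d s0 < 0 := by
    have := hanti ⟨le_rfl, hs0pos.le⟩ ⟨hs0pos.le, le_rfl⟩ hs0pos
    rwa [prT_zero] at this
  obtain ⟨s2, hs2, hs2'⟩ := (((h.tendsto_prT hd.ne τ).eventually_ge_atTop 0).and
    (eventually_ge_atTop s0)).exists
  obtain ⟨s, hs, hs'⟩ := intermediate_value_Icc hs2'
    (h.contDiff_prT hd.ne τ).continuous.continuousOn ⟨h1.le, hs2⟩
  have hlt : s0 < s := lt_of_le_of_ne hs.1 fun e => by rw [← e] at hs'; linarith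
  refine ⟨s, hs0pos.trans hlt, hs', h.prSlope_pos hd.ne τ ?_⟩
  rw [← hs0sq, prC]
  have : s0 ^ 2 < s ^ 2 := by nlinarith
  nlinarith

end IsParam

/-! ### The family -/

/-- The family of rotational surfaces. -/
def family (τ H d : ℝ) : Set Pt :=
  if d = -2 * H then graphMap (graphFun τ H) '' disk
  else rotMap (prX H d) (prT τ H d) '' (univ ×ˢ univ)

theorem family_self (τ H : ℝ) : family τ H (-2 * H) = graphMap (graphFun τ H) '' disk :=
  if_pos rfl

theorem family_of_ne (τ : ℝ) {H d : ℝ} (hd : d ≠ -2 * H) :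
    family τ H d = rotMap (prX H d) (prT τ H d) '' (univ ×ˢ univ) := if_neg hd

theorem reflect_rotMap (x t : ℝ → ℝ) (q : ℝ × ℝ) :
    reflect (rotMap x t q) = ![x q.1 * Real.cos q.2, x q.1 * Real.sin q.2, -t q.1] := by
  ext i; fin_cases i <;> simp [reflect, rotMap]

theorem exists_polar (a b : ℝ) : ∃ θ : ℝ, √(a ^ 2 + b ^ 2) * Real.cos θ = a ∧
    √(a ^ 2 + b ^ 2) * Real.sin θ = b := by
  refine ⟨Complex.arg ⟨a, b⟩, ?_⟩
  have : ‖(⟨a, b⟩ : ℂ)‖ = √(a ^ 2 + b ^ 2) := by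
    rw [Complex.norm_def, Complex.normSq_mk]
    congr 1; ring
  rw [← this]
  exact ⟨Complex.norm_mul_cos_arg _, Complex.norm_mul_sin_arg _⟩

theorem height_unbounded (τ : ℝ) {H : ℝ} (hpos : 0 < H) (hH : 4 * H ^ 2 ≤ 1) (M : ℝ) :
    ∃ s ∈ Ioo (-1 : ℝ) 1, M < height τ H (s ^ 2) := by
  -- Solves −2H log(1 − w) = |M| + 1, the lower bound of `height_ge`.
  set w := 1 - Real.exp (-(|M| + 1) / (2 * H))
  have h1 : 0 < Real.exp (-(|M| + 1) / (2 * H)) := Real.exp_pos _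
  have h2 : Real.exp (-(|M| + 1) / (2 * H)) ≤ 1 := by
    rw [Real.exp_le_one_iff]
    exact div_nonpos_of_nonpos_of_nonneg (by linarith [abs_nonneg M]) (by positivity)
  have hw0 : 0 ≤ w := by simp only [w]; linarith
  have hw1 : w < 1 := by simp only [w]; linarith
  refine ⟨√w, ⟨by linarith [Real.sqrt_nonneg w], ?_⟩, ?_⟩
  · rw [Real.sqrt_lt' one_pos]; simpa using hw1
  · rw [Real.sq_sqrt hw0]
    have := height_ge (τ := τ) hpos.le hH hw0 hw1
    simp only [w, sub_sub_cancel, Real.log_exp] at this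
    have e : -(2 * H) * (-(|M| + 1) / (2 * H)) = |M| + 1 := by field_simp
    rw [e] at this
    simp only [w]
    linarith [le_abs_self M]

namespace IsParam

variable {H d : ℝ}

theorem isRotationalHSurface_family (h : IsParam H d) (τ : ℝ) :
    IsRotationalHSurface τ H (family τ H d) := by
  rcases eq_or_ne d (-2 * H) with rfl | hd
  · rw [family_self, graphMap_image_eq]
    exact isRotationalHSurface_graph τ h.four_sq_le
  · rw [family_of_ne τ hd]
    exact h.isRotationalHSurface_profile hd τ

theorem family_unbounded (h : IsParam H d) (τ M : ℝ) : ∃ p ∈ family τ H d, M < |p 2| := by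
  rcases eq_or_ne d (-2 * H) with rfl | hd
  · rw [family_self, graphMap_image_eq]
    obtain ⟨s, hs, hM⟩ := height_unbounded τ h.pos h.four_sq_le M
    exact ⟨_, ⟨(s, 0), ⟨hs, mem_univ _⟩, rfl⟩, hM.trans_le (le_abs_self _)⟩
  · rw [family_of_ne τ hd]
    obtain ⟨s, hs⟩ := ((h.tendsto_prT hd τ).eventually_gt_atTop M).exists
    exact ⟨_, ⟨(s, 0), ⟨mem_univ _, mem_univ _⟩, rfl⟩, hs.trans_le (le_abs_self _)⟩

theorem reflect_family (_h : IsParam H d) (hd : d ≠ -2 * H) (τ : ℝ) :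
    reflect '' family τ H d = family τ H d := by
  rw [family_of_ne τ hd]
  have key : ∀ q : ℝ × ℝ, reflect (rotMap (prX H d) (prT τ H d) q)
      = rotMap (prX H d) (prT τ H d) (-q.1, q.2) := by
    intro q
    rw [reflect_rotMap, rotMap, prX_neg, prT_neg]
  ext p
  constructor
  · rintro ⟨_, ⟨q, -, rfl⟩, rfl⟩
    exact ⟨(-q.1, q.2), ⟨mem_univ _, mem_univ _⟩, (key q).symm⟩
  · rintro ⟨q, -, rfl⟩
    refine ⟨_, ⟨(-q.1, q.2), ⟨mem_univ _, mem_univ _⟩, rfl⟩, ?_⟩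
    rw [key, neg_neg]

theorem hasNeckAt_family (h : IsParam H d) (hd : d ≠ -2 * H) (τ : ℝ) :
    HasNeckAt τ (family τ H d) (neckDistance H d) := by
  have e0 : neckDistance H d = hdist (prX H d 0) := by
    rw [neckDistance_eq, ← arcosh_ch (prX_nonneg 0) (h.prX_lt_one 0), h.ch_prX]
    simp [prC]
  have hx0 := h.prX_pos hd 0
  have hmem : ∀ s, prX H d s ∈ Ioo (-1 : ℝ) 1 := fun s => abs_lt.1 (h.abs_prX_lt_one s)
  have hdist' : ∀ q : ℝ × ℝ, distAxis τ (rotMap (prX H d) (prT τ H d) q) = hdist (prX H d q.1) := by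
    intro q
    rw [distAxis_eq τ (rotMap_mem (h.abs_prX_lt_one q.1)), rad_rotMap, abs_of_nonneg (prX_nonneg _)]
  constructor
  · rw [neckDistance_eq]
    exact Real.arcosh_pos (h.one_lt_neckCosh hd)
  · rw [family_of_ne τ hd, e0]
    ext p
    constructor
    · rintro ⟨⟨q, -, rfl⟩, hmin⟩
      have h1 := hmin _ ⟨(0, 0), ⟨mem_univ _, mem_univ _⟩, rfl⟩
      rw [hdist', hdist', strictMonoOn_hdist.le_iff_le (hmem _) (hmem _)] at h1
      have hq : q.1 = 0 := by
        by_contra hne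
        have := h.prX_strictMono (s := 0) (s' := q.1) (by rw [zero_pow two_ne_zero]; positivity)
        exact absurd h1 (not_le.2 this)
      refine ⟨rotMap_mem (h.abs_prX_lt_one q.1), ?_, ?_⟩
      · simp [rotMap, hq, prT_zero]
      · rw [hdist', hq]
    · rintro ⟨hp, hp2, hpd⟩
      rw [distAxis_eq τ hp] at hpd
      have hr : rad p = prX H d 0 := strictMonoOn_hdist.injOn
        ⟨by linarith [rad_nonneg p], rad_lt_one hp⟩ (hmem 0) hpd
      obtain ⟨θ, h1, h2⟩ := exists_polar (p 0) (p 1)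
      change rad p * _ = _ at h1
      change rad p * _ = _ at h2
      rw [hr] at h1 h2
      have hpe : rotMap (prX H d) (prT τ H d) (0, θ) = p := by
        ext i
        fin_cases i
        · exact h1
        · exact h2
        · simp [rotMap, prT_zero, hp2]
      refine ⟨⟨(0, θ), ⟨mem_univ _, mem_univ _⟩, hpe⟩, ?_⟩
      rintro _ ⟨q, -, rfl⟩
      rw [← hpe, hdist', hdist', strictMonoOn_hdist.le_iff_le (hmem _) (hmem _)]
      exact h.prX_le _

theorem isProperlyEmbedded_family (h : IsParam H d) (hd : -2 * H < d) (τ : ℝ) :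
    IsProperlyEmbeddedHAnnulus τ H (family τ H d) :=
  ⟨_, h.isProperHAnnulus_profile hd.ne' τ,
    annulus_injective (fun s => (h.prX_pos hd.ne' s).ne') (h.prT_injective hd τ), by
      rw [range_annulus, family_of_ne τ hd.ne']⟩

/-- At a positive zero s of the height, the parameters s and −s give the same point. The profile
tangents there are (x', t') and (−x', t') with both entries nonzero, so the tangent planes differ.
-/
theorem isProperlyImmersedNonembedded_family (h : IsParam H d) (hd : d < -2 * H) (τ : ℝ) :
    IsProperlyImmersedNonembeddedHAnnulus τ H (family τ H d) := by
  refine ⟨_, h.isProperHAnnulus_profile hd.ne τ, by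
    rw [range_annulus, family_of_ne τ hd.ne], ?_⟩
  obtain ⟨s, hs, hs0, hslope⟩ := h.exists_prT_eq_zero hd τ
  refine ⟨(s, 0), (-s, 0), ?_, ?_⟩
  · rw [lift_annulus, rotMap, rotMap]
    simp only [prX_neg, prT_neg, hs0, neg_zero]
  · rw [lift_annulus]
    intro heq
    have h0 := h.one_lt_prC hd.ne s
    have hx := h.prX_pos hd.ne s
    have hC : prC H d (-s) = prC H d s := by simp [prC]
    have hslope' : prSlope τ H d (-s) = prSlope τ H d s := by
      simp only [prSlope, prX_neg, prC, prQ, neg_sq]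
    set a := 2 * s / ((prC H d s + 1) ^ 2 * prX H d s) with ha
    have hapos : 0 < a := by
      have : 0 < prC H d s + 1 := by linarith
      positivity
    have e1 : ∀ v, fderiv ℝ (rotMap (prX H d) (prT τ H d)) (s, 0) v
        = rot 0 ![a * v.1, prX H d s * v.2, prSlope τ H d s * v.1] := fun v =>
      dX_rotMap (q := (s, 0)) (h.hasDerivAt_prX hd.ne s) (h.hasDerivAt_prT hd.ne τ s) v
    have e2 : ∀ v, fderiv ℝ (rotMap (prX H d) (prT τ H d)) (-s, 0) v
        = rot 0 ![-a * v.1, prX H d s * v.2, prSlope τ H d s * v.1] := by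
      intro v
      have := dX_rotMap (q := (-s, 0)) (h.hasDerivAt_prX hd.ne (-s)) (h.hasDerivAt_prT hd.ne τ (-s)) v
      simp only [prX_neg, hC, hslope'] at this
      rw [dX] at this
      rw [this, ha]
      congr 2
      ring_nf
    have hm : fderiv ℝ (rotMap (prX H d) (prT τ H d)) (s, 0) (1, 0) ∈
        range (fderiv ℝ (rotMap (prX H d) (prT τ H d)) (-s, 0)) := by
      rw [← heq]; exact mem_range_self _
    obtain ⟨v, hv⟩ := hm
    rw [e1, e2] at hv
    have hv := rot_injective 0 hv
    have c0 : -a * v.1 = a * 1 := congrFun hv 0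
    have c2 : prSlope τ H d s * v.1 = prSlope τ H d s * 1 := congrFun hv 2
    rw [mul_left_cancel₀ hslope.ne' c2] at c0
    linarith

end IsParam

/-! ### The degeneration -/

theorem isParam_critical {H : ℝ} (h0 : 0 < H) (h1 : H ≤ 1 / 2) : IsParam H (-2 * H) := by
  refine ⟨h0, h1, ?_⟩
  rcases h1.lt_or_eq with h | h
  · exact Or.inl h
  · exact Or.inr ⟨h, by linarith⟩

theorem disc_critical (H : ℝ) : disc H (-2 * H) = 1 := by
  rw [disc, ← Real.sqrt_one]; congr 1; ring

theorem neckCosh_critical {H : ℝ} (h0 : 0 < H) (h1 : H ≤ 1 / 2) : neckCosh H (-2 * H) = 1 := by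
  rcases h1.lt_or_eq with h | h
  · have h2 := (isParam_critical h0 h1).neckCosh_mul
    rw [disc_critical] at h2
    have h3 : 1 - 4 * H ^ 2 ≠ 0 := by nlinarith
    have : (1 - 4 * H ^ 2) * (neckCosh H (-2 * H) - 1) = 0 := by linear_combination h2
    have := (mul_eq_zero.1 this).resolve_left h3
    linarith
  · rw [neckCosh, if_neg (by linarith), h]; norm_num

theorem eventually_isParam {H : ℝ} (h0 : 0 < H) (h1 : H ≤ 1 / 2) :
    ∀ᶠ d in 𝓝 (-2 * H), IsParam H d := by
  rcases h1.lt_or_eq with h | h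
  · exact Eventually.of_forall fun d => ⟨h0, h1, Or.inl h⟩
  · filter_upwards [isOpen_Iio.mem_nhds (show -2 * H < 0 by linarith)] with d hd
    exact ⟨h0, h1, Or.inr ⟨h, hd⟩⟩

theorem continuous_disc (H : ℝ) : Continuous (disc H) := by unfold disc; fun_prop

theorem continuousAt_neckCosh {H : ℝ} (h1 : H ≤ 1 / 2) :
    ContinuousAt (neckCosh H) (-2 * H) := by
  rcases h1.lt_or_eq with h | h
  · have : neckCosh H = fun d => (2 * d * H + √(1 - 4 * H ^ 2 + d ^ 2)) / (1 - 4 * H ^ 2) := by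
      ext d; rw [neckCosh, if_pos h]
    rw [this]
    fun_prop
  · have : neckCosh H = fun d => (1 + d ^ 2) / (-2 * d) := by
      ext d; rw [neckCosh, if_neg (by linarith)]
    rw [this]
    refine ContinuousAt.div (by fun_prop) (by fun_prop) ?_
    rw [h]; norm_num

/-- `prC_sq` gives |2Hc + d| ≤ √(c² − 1) = (c + 1)x, which cancels the factor 1/x. The bound is
therefore uniform for d near −2H, although the neck closes up. -/
theorem IsParam.abs_prSlope_le {H d : ℝ} (h : IsParam H d) (τ s : ℝ) :
    |prSlope τ H d s| ≤ 2 * √(1 + 4 * τ ^ 2) / √(2 * disc H d) := by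
  have hX0 := IsParam.prX_nonneg (H := H) (d := d) s
  have hC := h.one_le_prC s
  have hb : 0 ≤ 2 * √(1 + 4 * τ ^ 2) / √(2 * disc H d) := by positivity
  -- If the radius is 0, the slope is 0 by the convention for division by zero.
  rcases hX0.eq_or_lt with hx | hx
  · rw [prSlope, ← hx]
    simpa using hb
  have hq := Real.sqrt_pos.2 (h.prQ_pos s)
  have hm : 0 < (prC H d s + 1) * prX H d s := mul_pos (by linarith) hx
  have h1 : |2 * H * prC H d s + d| ≤ (prC H d s + 1) * prX H d s := by
    refine abs_le_of_sq_le_sq ?_ hm.le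
    have h2 := h.prX_sq s
    rw [eq_div_iff (by linarith)] at h2
    have h3 : ((prC H d s + 1) * prX H d s) ^ 2 = prC H d s ^ 2 - 1 := by
      linear_combination (prC H d s + 1) * h2
    rw [h3, h.prC_sq]
    have := mul_nonneg (sq_nonneg s) (h.prQ_pos s).le
    linarith
  have h2 : √(ee τ (prX H d s)) ≤ √(1 + 4 * τ ^ 2) := by
    refine Real.sqrt_le_sqrt ?_
    have : prX H d s ^ 2 ≤ 1 := by nlinarith [h.prX_lt_one s]
    unfold ee
    nlinarith [sq_nonneg τ]
  have h3 : √(2 * disc H d) ≤ √(prQ H d s) := by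
    refine Real.sqrt_le_sqrt ?_
    unfold prQ
    have := mul_nonneg (sub_nonneg.2 h.four_sq_le) (sq_nonneg s)
    linarith
  have h4 : 0 < √(2 * disc H d) := Real.sqrt_pos.2 (by have := h.disc_pos; positivity)
  have e : |prSlope τ H d s| = 2 * √(ee τ (prX H d s)) / √(prQ H d s) *
      (|2 * H * prC H d s + d| / ((prC H d s + 1) * prX H d s)) := by
    rw [prSlope, abs_div, abs_mul, abs_mul, abs_two, abs_of_nonneg (Real.sqrt_nonneg _),
      abs_of_pos (mul_pos hm hq)]
    field_simp
  rw [e]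
  have h5 : |2 * H * prC H d s + d| / ((prC H d s + 1) * prX H d s) ≤ 1 := (div_le_one hm).2 h1
  calc _ ≤ 2 * √(ee τ (prX H d s)) / √(prQ H d s) * 1 := by gcongr
    _ ≤ 2 * √(1 + 4 * τ ^ 2) / √(2 * disc H d) := by rw [mul_one]; gcongr

theorem measurable_prSlope (τ H d : ℝ) : Measurable (prSlope τ H d) := by
  unfold prSlope prX prC prQ ee
  fun_prop

theorem IsParam.intervalIntegrable_prSlope {H d : ℝ} (h : IsParam H d) (τ a b : ℝ) :
    IntervalIntegrable (prSlope τ H d) MeasureTheory.volume a b :=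
  (intervalIntegrable_const (c := 2 * √(1 + 4 * τ ^ 2) / √(2 * disc H d))).mono_fun'
    (measurable_prSlope τ H d).aestronglyMeasurable
    (Eventually.of_forall fun s => h.abs_prSlope_le τ s)

theorem prX_critical_sq {H : ℝ} (h0 : 0 < H) (h1 : H ≤ 1 / 2) (s : ℝ) :
    prX H (-2 * H) s ^ 2 = s ^ 2 / (2 + s ^ 2) := by
  rw [(isParam_critical h0 h1).prX_sq, prC, neckCosh_critical h0 h1]
  congr 1 <;> ring

/-- The profile formulas remain meaningful at d = −2H: the substitution w = s²/(2 + s²) turns them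
into the graph for s ≥ 0. Oddness of the height gives the reflected graph for s ≤ 0, which is why
the limit is a union. -/
theorem prT_critical (τ : ℝ) {H : ℝ} (h0 : 0 < H) (h1 : H ≤ 1 / 2) {s : ℝ} (hs : 0 ≤ s) :
    prT τ H (-2 * H) s = height τ H (prX H (-2 * H) s ^ 2) := by
  have h := isParam_critical h0 h1
  have hH := h.four_sq_le
  set f : ℝ → ℝ := fun y => slope τ H (y ^ 2 / (2 + y ^ 2)) * (4 * y / (2 + y ^ 2) ^ 2) with hf
  have hw : ∀ y : ℝ, y ^ 2 / (2 + y ^ 2) ∈ slopeDom τ H := fun y =>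
    mem_slopeDom τ hH (by positivity) ((div_lt_one (by positivity)).2 (by linarith))
  have heq : ∀ y ∈ uIcc 0 s, prSlope τ H (-2 * H) y = f y := by
    intro y hy
    rw [uIcc_of_le hs] at hy
    rcases hy.1.eq_or_lt with rfl | hy0
    · simp [-neg_mul, hf, prSlope, prC, neckCosh_critical h0 h1, prX]
    · have hX := prX_critical_sq h0 h1 y
      have hXpos : 0 < prX H (-2 * H) y := by
        refine lt_of_le_of_ne (IsParam.prX_nonneg y) fun e => ?_
        rw [← e] at hX
        have : 0 < y ^ 2 / (2 + y ^ 2) := by positivity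
        rw [← hX] at this
        norm_num at this
      have hE : ee τ (prX H (-2 * H) y) = 1 + 4 * τ ^ 2 * (y ^ 2 / (2 + y ^ 2)) := by
        rw [ee, hX]
      have hq := h.prQ_pos y
      have hG : √(1 - 4 * H ^ 2 * (y ^ 2 / (2 + y ^ 2))) = √(prQ H (-2 * H) y) * prX H (-2 * H) y / y := by
        have h2 : 0 ≤ √(prQ H (-2 * H) y) * prX H (-2 * H) y / y := by positivity
        rw [← Real.sqrt_sq h2]
        congr 1
        rw [div_pow, mul_pow, Real.sq_sqrt hq.le, hX, prQ, disc_critical]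
        field_simp
        ring
      simp only [hf, slope, prSlope]
      rw [hG, hE, prC, neckCosh_critical h0 h1]
      have hq' := Real.sqrt_pos.2 hq
      have h3 : 1 - y ^ 2 / (2 + y ^ 2) = 2 / (2 + y ^ 2) := by field_simp; ring
      rw [h3]
      generalize √(1 + 4 * τ ^ 2 * (y ^ 2 / (2 + y ^ 2))) = e
      field_simp
      ring
  have hder : ∀ y, HasDerivAt (fun y => height τ H (y ^ 2 / (2 + y ^ 2))) (f y) y := by
    intro y
    have h2 : HasDerivAt (fun y : ℝ => y ^ 2 / (2 + y ^ 2)) (4 * y / (2 + y ^ 2) ^ 2) y := by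
      refine ((hasDerivAt_pow 2 y).div ((hasDerivAt_pow 2 y).const_add 2)
        (by positivity)).congr_deriv ?_
      norm_num
      ring
    exact HasDerivAt.comp (h₂ := height τ H) (h := fun y => y ^ 2 / (2 + y ^ 2)) y
      (hasDerivAt_height (hw y)) h2
  have hcont : Continuous f := by
    have h2 : Continuous fun y : ℝ => y ^ 2 / (2 + y ^ 2) :=
      Continuous.div (by fun_prop) (by fun_prop) fun y => by positivity
    have h3 : Continuous fun y : ℝ => slope τ H (y ^ 2 / (2 + y ^ 2)) :=
      (contDiffOn_slope τ H).continuousOn.comp_continuous h2 hw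
    exact h3.mul (Continuous.div (by fun_prop) (by fun_prop) fun y => by positivity)
  rw [prT, intervalIntegral.integral_congr heq,
    intervalIntegral.integral_eq_sub_of_hasDerivAt (fun y _ => hder y)
      (hcont.intervalIntegrable _ _), prX_critical_sq h0 h1]
  simp [height_zero]

/-- A point of the profile surface or of its reflection. -/
def profilePt (τ H d σ s θ : ℝ) : Pt :=
  ![prX H d s * Real.cos θ, prX H d s * Real.sin θ, σ * prT τ H d s]

theorem IsParam.profilePt_mem {H d : ℝ} (hd : d ≠ -2 * H) {τ σ : ℝ}
    (hσ : σ = 1 ∨ σ = -1) (s θ : ℝ) : profilePt τ H d σ s θ ∈ family τ H d := by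
  rw [family_of_ne τ hd]
  rcases hσ with rfl | rfl
  · exact ⟨(s, θ), ⟨mem_univ _, mem_univ _⟩, by simp [rotMap, profilePt]⟩
  · exact ⟨(-s, θ), ⟨mem_univ _, mem_univ _⟩, by simp [rotMap, profilePt, prX_neg, prT_neg]⟩

theorem IsParam.exists_profilePt {H d : ℝ} (hd : d ≠ -2 * H) {τ : ℝ} {p : Pt}
    (hp : p ∈ family τ H d) : ∃ σ s θ, (σ = 1 ∨ σ = -1) ∧ 0 ≤ s ∧ p = profilePt τ H d σ s θ := by
  rw [family_of_ne τ hd] at hp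
  obtain ⟨q, -, rfl⟩ := hp
  rcases le_total 0 q.1 with hq | hq
  · exact ⟨1, q.1, q.2, Or.inl rfl, hq, by simp [rotMap, profilePt]⟩
  · exact ⟨-1, -q.1, q.2, Or.inr rfl, by linarith, by simp [rotMap, profilePt, prX_neg, prT_neg]⟩

theorem profilePt_critical_mem {τ H : ℝ} (h0 : 0 < H) (h1 : H ≤ 1 / 2) {σ s : ℝ}
    (hσ : σ = 1 ∨ σ = -1) (hs : 0 ≤ s) (θ : ℝ) :
    profilePt τ H (-2 * H) σ s θ ∈ family τ H (-2 * H) ∪ reflect '' family τ H (-2 * H) := by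
  have h := isParam_critical h0 h1
  have hm : profilePt τ H (-2 * H) 1 s θ ∈ family τ H (-2 * H) := by
    rw [family_self, graphMap_image_eq]
    refine ⟨(prX H (-2 * H) s, θ), ⟨abs_lt.1 (h.abs_prX_lt_one s), mem_univ _⟩, ?_⟩
    simp [-neg_mul, rotMap, profilePt, prT_critical τ h0 h1 hs]
  rcases hσ with rfl | rfl
  · exact Or.inl hm
  · exact Or.inr ⟨_, hm, by simp [reflect, profilePt]⟩

theorem exists_profilePt_critical {τ H : ℝ} (h0 : 0 < H) (h1 : H ≤ 1 / 2) {p : Pt}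
    (hp : p ∈ family τ H (-2 * H) ∪ reflect '' family τ H (-2 * H)) :
    ∃ σ s θ, (σ = 1 ∨ σ = -1) ∧ 0 ≤ s ∧ p = profilePt τ H (-2 * H) σ s θ := by
  have key : ∀ p ∈ family τ H (-2 * H), ∃ s θ, 0 ≤ s ∧ p = profilePt τ H (-2 * H) 1 s θ := by
    intro p hp
    rw [family_self] at hp
    obtain ⟨q, hq, rfl⟩ := hp
    obtain ⟨θ, hθ⟩ := exists_polar q.1 q.2
    set w := q.1 ^ 2 + q.2 ^ 2 with hw
    have hw1 : w < 1 := hq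
    have hw0 : 0 ≤ w := by positivity
    -- The value of s² that solves s²/(2 + s²) = w.
    have hs : 0 ≤ 2 * w / (1 - w) := div_nonneg (by linarith) (by linarith)
    have hX2 : prX H (-2 * H) (√(2 * w / (1 - w))) ^ 2 = w := by
      rw [prX_critical_sq h0 h1, Real.sq_sqrt hs]
      have : 1 - w ≠ 0 := by linarith
      have h2 : 2 + 2 * w / (1 - w) = 2 / (1 - w) := by field_simp; ring
      rw [h2]
      field_simp
    have hX : prX H (-2 * H) (√(2 * w / (1 - w))) = √w := by
      rw [← hX2, Real.sqrt_sq (IsParam.prX_nonneg _), hX2]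
    refine ⟨√(2 * w / (1 - w)), θ, Real.sqrt_nonneg _, ?_⟩
    ext i
    fin_cases i
    · simp [-neg_mul, graphMap, profilePt, hX, hθ.1]
    · simp [-neg_mul, graphMap, profilePt, hX, hθ.2]
    · simp [-neg_mul, graphMap, profilePt, prT_critical τ h0 h1 (Real.sqrt_nonneg _), hX2, graphFun, ← hw]
  rcases hp with hp | ⟨p, hp, rfl⟩
  · obtain ⟨s, θ, hs, rfl⟩ := key p hp
    exact ⟨1, s, θ, Or.inl rfl, hs, rfl⟩
  · obtain ⟨s, θ, hs, rfl⟩ := key p hp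
    exact ⟨-1, s, θ, Or.inr rfl, hs, by simp [reflect, profilePt]⟩

theorem dist_profilePt_lt {τ H d d' σ s θ ε : ℝ} (hσ : σ = 1 ∨ σ = -1)
    (h1 : |prX H d s - prX H d' s| < ε) (h2 : |prT τ H d s - prT τ H d' s| < ε) :
    dist (profilePt τ H d σ s θ) (profilePt τ H d' σ s θ) < ε := by
  have hε : 0 < ε := (abs_nonneg _).trans_lt h1
  rw [dist_pi_lt_iff hε]
  intro i
  fin_cases i
  · simp only [profilePt, Real.dist_eq]
    simp only [Fin.zero_eta, Matrix.cons_val_zero]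
    rw [← sub_mul, abs_mul]
    exact (mul_le_of_le_one_right (abs_nonneg _) (Real.abs_cos_le_one θ)).trans_lt h1
  · simp only [profilePt, Real.dist_eq]
    simp only [Fin.mk_one, Matrix.cons_val_one, Matrix.cons_val_zero]
    rw [← sub_mul, abs_mul]
    exact (mul_le_of_le_one_right (abs_nonneg _) (Real.abs_sin_le_one θ)).trans_lt h1
  · change dist (σ * prT τ H d s) (σ * prT τ H d' s) < ε
    have : |σ| = 1 := by rcases hσ with rfl | rfl <;> simp
    rw [Real.dist_eq, ← mul_sub, abs_mul, this, one_mul]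
    exact h2

/-- For X ≥ X' ≥ 0 one has (X − X')² ≤ X² − X'², and the squared radii differ by at most c₁ − 1. The
estimate is uniform in s even though the limit is not smooth at s = 0. -/
theorem abs_prX_sub_le {H d : ℝ} (h : IsParam H d) (s : ℝ) :
    |prX H d s - prX H (-2 * H) s| ≤ √(neckCosh H d - 1) := by
  have h' := isParam_critical h.pos h.le
  refine Real.abs_le_sqrt ?_
  have hX := h.prX_sq s
  have hX' := h'.prX_sq s
  have hc := h.one_le_prC s
  have hc' := h'.one_le_prC s
  have x0 := IsParam.prX_nonneg (H := H) (d := d) s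
  have x0' := IsParam.prX_nonneg (H := H) (d := -2 * H) s
  have e : prC H d s - prC H (-2 * H) s = neckCosh H d - 1 := by
    rw [prC, prC, neckCosh_critical h.pos h.le]; ring
  have hn := h.one_le_neckCosh
  have hle : prX H (-2 * H) s ≤ prX H d s := by
    refine Real.sqrt_le_sqrt ?_
    rw [div_le_div_iff₀ (by linarith) (by linarith)]
    nlinarith
  have hsub : prX H d s ^ 2 - prX H (-2 * H) s ^ 2 ≤ neckCosh H d - 1 := by
    have : prX H d s ^ 2 - prX H (-2 * H) s ^ 2
        = 2 * (neckCosh H d - 1) / ((prC H d s + 1) * (prC H (-2 * H) s + 1)) := by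
      rw [hX, hX', ← e, div_sub_div _ _ (by linarith) (by linarith)]
      congr 1; ring
    rw [this, div_le_iff₀ (by nlinarith)]
    have h4 : 4 ≤ (prC H d s + 1) * (prC H (-2 * H) s + 1) := by nlinarith
    nlinarith
  nlinarith

/-- The height difference is at most the integral over [0, S] of the difference of slopes, which
tends to 0 by dominated convergence; hence closeness is uniform in s. -/
theorem eventually_profile_close (τ : ℝ) {H : ℝ} (h0 : 0 < H) (h1 : H ≤ 1 / 2) (S : ℝ) {ε : ℝ}
    (hε : 0 < ε) : ∀ᶠ d in 𝓝[≠] (-2 * H), ∀ s ∈ Icc 0 S,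
      |prX H d s - prX H (-2 * H) s| < ε ∧ |prT τ H d s - prT τ H (-2 * H) s| < ε := by
  rcases lt_or_ge S 0 with hS | hS
  · exact Eventually.of_forall fun d s hs => absurd (hs.1.trans hs.2) (not_le.2 hS)
  have hcrit := isParam_critical h0 h1
  have hP : ∀ᶠ d in 𝓝[≠] (-2 * H), IsParam H d := nhdsWithin_le_nhds (eventually_isParam h0 h1)
  -- Makes √(2 `disc`) ≥ 1, so the bound of `IsParam.abs_prSlope_le` becomes a constant.
  have hdisc : ∀ᶠ d in 𝓝[≠] (-2 * H), 1 / 2 < disc H d := by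
    refine nhdsWithin_le_nhds ((continuous_disc H).continuousAt.eventually_const_lt ?_)
    rw [disc_critical]; norm_num
  have hX : ∀ᶠ d in 𝓝[≠] (-2 * H), √(neckCosh H d - 1) < ε := by
    have hc := ((continuousAt_neckCosh h1).sub (continuousAt_const (y := (1 : ℝ)))).sqrt
    refine nhdsWithin_le_nhds (hc.tendsto.eventually_lt_const ?_)
    rw [Pi.sub_apply, neckCosh_critical h0 h1]; simpa using hε
  have hlim : Tendsto (fun d => ∫ s in (0 : ℝ)..S, |prSlope τ H d s - prSlope τ H (-2 * H) s|)
      (𝓝[≠] (-2 * H)) (𝓝 (∫ _ in (0 : ℝ)..S, (0 : ℝ))) := by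
    refine intervalIntegral.tendsto_integral_filter_of_dominated_convergence
      (fun _ => 4 * √(1 + 4 * τ ^ 2)) ?_ ?_ intervalIntegrable_const ?_
    · exact Eventually.of_forall fun d =>
        ((measurable_prSlope τ H d).sub (measurable_prSlope τ H _)).abs.aestronglyMeasurable
    · filter_upwards [hP, hdisc] with d hd hd2
      refine Eventually.of_forall fun s _ => ?_
      have hb : ∀ d, IsParam H d → 1 / 2 < disc H d → |prSlope τ H d s| ≤ 2 * √(1 + 4 * τ ^ 2) := by
        intro d hd hd2
        refine (hd.abs_prSlope_le τ s).trans (div_le_self (by positivity) ?_)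
        exact Real.one_le_sqrt.2 (by linarith)
      rw [Real.norm_eq_abs, abs_abs]
      have := hb d hd hd2
      have := hb _ hcrit (by rw [disc_critical]; norm_num)
      exact (abs_sub _ _).trans (by linarith)
    -- Pointwise convergence is needed only for s > 0, where the limiting radius is nonzero.
    · refine Eventually.of_forall fun s hs => ?_
      rw [uIoc_of_le hS] at hs
      have hXs : prX H (-2 * H) s ≠ 0 := by
        intro e
        have := prX_critical_sq h0 h1 s
        rw [e] at this
        have h2 : 0 < s ^ 2 / (2 + s ^ 2) := by have := hs.1; positivity
        rw [← this] at h2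
        norm_num at h2
      have c1 : ContinuousAt (fun d => prC H d s) (-2 * H) :=
        (continuousAt_neckCosh h1).add continuousAt_const
      have hc0 := hcrit.one_le_prC s
      have c2 : ContinuousAt (fun d => prX H d s) (-2 * H) := by
        refine ContinuousAt.sqrt (ContinuousAt.div (c1.sub continuousAt_const)
          (c1.add continuousAt_const) ?_)
        linarith
      have c3 : ContinuousAt (fun d => √(prQ H d s)) (-2 * H) :=
        (continuousAt_const.add (continuousAt_const.mul (continuous_disc H).continuousAt)).sqrt
      have c4 : ContinuousAt (fun d => √(ee τ (prX H d s))) (-2 * H) :=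
        (continuousAt_const.add (continuousAt_const.mul (c2.pow 2))).sqrt
      have c5 : ContinuousAt (fun d => prSlope τ H d s) (-2 * H) := by
        refine ContinuousAt.div ((continuousAt_const.mul ((continuousAt_const.mul c1).add
          continuousAt_id)).mul c4) (((c1.add continuousAt_const).mul c2).mul c3) ?_
        have := Real.sqrt_pos.2 (hcrit.prQ_pos s)
        exact mul_ne_zero (mul_ne_zero (by linarith) hXs) this.ne'
      have : Tendsto (fun d => |prSlope τ H d s - prSlope τ H (-2 * H) s|) (𝓝 (-2 * H))
          (𝓝 |prSlope τ H (-2 * H) s - prSlope τ H (-2 * H) s|) :=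
        (c5.sub continuousAt_const).abs.tendsto
      rw [sub_self, abs_zero] at this
      exact this.mono_left nhdsWithin_le_nhds
  rw [intervalIntegral.integral_zero] at hlim
  filter_upwards [hP, hX, hlim.eventually_lt_const hε] with d hd hdX hdT s hs
  refine ⟨(abs_prX_sub_le hd s).trans_lt hdX, lt_of_le_of_lt ?_ hdT⟩
  have i1 := fun a b => hd.intervalIntegrable_prSlope τ a b
  have i2 := fun a b => hcrit.intervalIntegrable_prSlope τ a b
  rw [prT, prT, ← intervalIntegral.integral_sub (i1 _ _) (i2 _ _)]
  refine (intervalIntegral.abs_integral_le_integral_abs hs.1).trans ?_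
  exact intervalIntegral.integral_mono_interval le_rfl hs.1 hs.2
    (Eventually.of_forall fun s => abs_nonneg _) ((i1 _ _).sub (i2 _ _)).abs

/-- Points with the same (σ, s, θ) are paired. The compact set confines s to an interval independent
of d, on which the profiles are uniformly close. -/
theorem tendsLocallyHausdorff_family (τ : ℝ) {H : ℝ} (h0 : 0 < H) (h1 : H ≤ 1 / 2) :
    TendsLocallyHausdorff (family τ H) (𝓝[≠] (-2 * H))
      (family τ H (-2 * H) ∪ reflect '' family τ H (-2 * H)) := by
  intro K hKa hK ε hε
  obtain ⟨R, M, hR0, hR, hKc⟩ := exists_subset_cyl hK hKa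
  have hcrit := isParam_critical h0 h1
  have hrad : ∀ d σ s θ, profilePt τ H d σ s θ ∈ K → prX H d s ≤ R := by
    intro d σ s θ hp
    have h2 := (hKc hp).1
    have h3 : rad (profilePt τ H d σ s θ) = |prX H d s| := rad_rotMap (prX H d)
      (fun s => σ * prT τ H d s) (s, θ)
    rw [h3] at h2
    exact (le_abs_self _).trans h2
  filter_upwards [eventually_profile_close τ h0 h1 ((1 + R ^ 2) / (1 - R ^ 2) + 1) hε,
    nhdsWithin_le_nhds (eventually_isParam h0 h1), self_mem_nhdsWithin] with d hclose hd hne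
  constructor
  · rintro p ⟨hp, hpK⟩
    obtain ⟨σ, s, θ, hσ, hs, rfl⟩ := IsParam.exists_profilePt hne hp
    refine ⟨_, profilePt_critical_mem h0 h1 hσ hs θ, ?_⟩
    have h2 := hclose s ⟨hs, (le_abs_self s).trans
      (hd.abs_le_of_prX_le hR (hrad _ _ _ _ hpK))⟩
    exact dist_profilePt_lt hσ h2.1 h2.2
  · rintro q ⟨hq, hqK⟩
    obtain ⟨σ, s, θ, hσ, hs, rfl⟩ := exists_profilePt_critical h0 h1 hq
    refine ⟨_, IsParam.profilePt_mem hne hσ s θ, ?_⟩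
    have h2 := hclose s ⟨hs, (le_abs_self s).trans
      (hcrit.abs_le_of_prX_le hR (hrad _ _ _ _ hqK))⟩
    rw [dist_comm]
    exact dist_profilePt_lt hσ h2.1 h2.2

theorem TendsLocallyHausdorff.mono {F : ℝ → Set Pt} {l l' : Filter ℝ} {S : Set Pt}
    (h : TendsLocallyHausdorff F l S) (hl : l' ≤ l) : TendsLocallyHausdorff F l' S :=
  fun K hKa hK ε hε => hl (h K hKa hK ε hε)

/-! ### Classification of rotational surfaces -/

theorem exists_eq_const_of_hasDerivAt_zero {J : Set ℝ} (hJ : J.OrdConnected) {f : ℝ → ℝ}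
    (h : ∀ s ∈ J, HasDerivAt f 0 s) : ∃ C, ∀ s ∈ J, f s = C := by
  rcases J.eq_empty_or_nonempty with rfl | ⟨a, ha⟩
  · exact ⟨0, by simp⟩
  · refine ⟨f a, fun s hs => ?_⟩
    have := hJ.convex.norm_image_sub_le_of_norm_hasDerivWithin_le (C := 0)
      (fun y hy => (h y hy).hasDerivWithinAt) (by simp) ha hs
    simpa [sub_eq_zero] using this

theorem pos_or_neg_of_continuousOn {J : Set ℝ} (hJ : J.OrdConnected) {f : ℝ → ℝ}
    (hf : ContinuousOn f J) (h0 : ∀ s ∈ J, f s ≠ 0) :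
    ∃ σ : ℝ, (σ = 1 ∨ σ = -1) ∧ ∀ s ∈ J, 0 < σ * f s := by
  rcases hJ.isPreconnected.eq_or_eq_neg_of_sq_eq hf hf.abs (fun s _ => by simp)
    (fun hs => abs_ne_zero.2 (h0 _ hs)) with h | h
  · refine ⟨1, Or.inl rfl, fun s hs => ?_⟩
    have h1 := h hs
    rw [one_mul, h1]; exact abs_pos.2 (h0 s hs)
  · refine ⟨-1, Or.inr rfl, fun s hs => ?_⟩
    have h1 : f s = -|f s| := h hs
    rw [h1]
    have := abs_pos.2 (h0 s hs)
    linarith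

/-- Orthogonality to the angular direction, nonzero as x ≠ 0, expresses n 1 through the connection
form α of n. Orthogonality to the profile direction leaves a single scalar. -/
theorem exists_eq_smul_normalField (τ : ℝ) {I : Set ℝ} {x t : ℝ → ℝ} (h : IsGenerating I x t)
    {s : ℝ} (hs : s ∈ I) (hx : x s ≠ 0) {n : Pt} (hn : IsUnitNormalAt τ (rotMap x t) n (s, 0)) :
    ∃ k : ℝ, n = k • normalField τ x t (s, 0) := by
  have hL := cf_pos (h.lt_one s hs)
  have hW := nsq_pos (τ := τ) (h.lt_one s hs) (h.regular s hs)
  have hW1 := Real.sqrt_pos.2 hW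
  have hrot : ∀ v : Pt, rot 0 v = v := by
    intro v; ext i; fin_cases i <;> simp [rot]
  have hp : rotMap x t (s, 0) = ![x s, 0, t s] := by rw [rotMap_eq_rot, hrot]
  have hdX := dX_rotMap (q := (s, 0)) (hasDerivAt_of_contDiffOn h.isOpen h.smooth_x hs)
    (hasDerivAt_of_contDiffOn h.isOpen h.smooth_t hs)
  have c1 := hn.2 (1, 0)
  have c2 := hn.2 (0, 1)
  rw [hdX, hrot, hp] at c1 c2
  set a := deriv x s
  set b := deriv t s
  set L := cf (x s) with hLdef
  simp only [metric, connForm, lam_vec, ← hLdef] at c1 c2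
  simp at c1 c2
  set α := -(2 * τ * L * (x s * n 1)) + n 2 with hα
  have d2 : L * n 1 = 2 * τ * x s * α := by
    have h2 : L * x s * (L * n 1 - 2 * τ * x s * α) = 0 := by linear_combination c2
    have := (mul_eq_zero.1 h2).resolve_left (mul_ne_zero hL.ne' hx)
    linarith
  have hden : 0 < b ^ 2 + L ^ 2 * a ^ 2 := by
    rcases h.regular s hs with h' | h'
    · have : a ≠ 0 := h'
      positivity
    · have : b ≠ 0 := h'
      positivity
  -- The coefficient of (L·n 0, α) along (−b, La); these vectors are parallel because both are
  -- orthogonal to (La, b).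
  set μ := (-(L * n 0) * b + L * a * α) / (b ^ 2 + L ^ 2 * a ^ 2) with hμ
  have hμm : μ * (b ^ 2 + L ^ 2 * a ^ 2) = -(L * n 0) * b + L * a * α :=
    div_mul_cancel₀ _ hden.ne'
  have e0 : L * n 0 = -μ * b := by
    have : (b ^ 2 + L ^ 2 * a ^ 2) * (L * n 0 + μ * b) = 0 := by
      linear_combination b * hμm + L * a * c1
    have := (mul_eq_zero.1 this).resolve_left hden.ne'
    linarith
  have e1 : α = μ * (L * a) := by
    have : (b ^ 2 + L ^ 2 * a ^ 2) * (α - μ * (L * a)) = 0 := by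
      linear_combination b * c1 - L * a * hμm
    have := (mul_eq_zero.1 this).resolve_left hden.ne'
    linarith
  refine ⟨μ * √(nsq τ (x s) a b), ?_⟩
  rw [normalField, hrot, smul_smul]
  change n = (μ * √(nsq τ (x s) a b) * (1 / √(nsq τ (x s) a b))) • nvec τ (x s) a b
  have : μ * √(nsq τ (x s) a b) * (1 / √(nsq τ (x s) a b)) = μ := by field_simp
  rw [this]
  have f1 : n 1 = μ * (2 * τ * x s * a) := by
    have : L * (n 1 - μ * (2 * τ * x s * a)) = 0 := by rw [e1] at d2; linear_combination d2
    have := (mul_eq_zero.1 this).resolve_left hL.ne'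
    linarith
  ext i
  fin_cases i
  · simp only [nvec, ← hLdef]
    simp
    field_simp
    linarith
  · simpa [nvec] using f1
  · simp only [nvec, ← hLdef, ee]
    simp
    rw [f1, e1] at hα
    linear_combination -hα

theorem continuousOn_metric (τ : ℝ) {γ v w : ℝ → Pt} {S : Set ℝ} (hγ : ContinuousOn γ S)
    (hv : ContinuousOn v S) (hw : ContinuousOn w S) (hmem : ∀ s ∈ S, γ s ∈ ambient) :
    ContinuousOn (fun s => metric τ (γ s) (v s) (w s)) S := by
  have hl : ContinuousOn (fun s => lam (γ s)) S := continuousOn_lam.comp hγ hmem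
  have g : ∀ i, ContinuousOn (fun s => γ s i) S := fun i => (continuousOn_pi.1 hγ) i
  have d : ∀ i, ContinuousOn (fun s => v s i) S := fun i => (continuousOn_pi.1 hv) i
  have e : ∀ i, ContinuousOn (fun s => w s i) S := fun i => (continuousOn_pi.1 hw) i
  exact ((hl.pow 2).mul (((d 0).mul (e 0)).add ((d 1).mul (e 1)))).add
    ((((continuousOn_const.mul hl).mul (((g 1).mul (d 0)).sub ((g 0).mul (d 1)))).add (d 2)).mul
      (((continuousOn_const.mul hl).mul (((g 1).mul (e 0)).sub ((g 0).mul (e 1)))).add (e 2)))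

/-- Meeting the axis orthogonally forces x' ≠ 0 there, so the meeting points are isolated. -/
theorem IsGenerating.eventually_ne_zero {I : Set ℝ} {x t : ℝ → ℝ} (h : IsGenerating I x t)
    (h0 : ∀ s ∈ I, x s = 0 → deriv t s = 0) {s : ℝ} (hs : s ∈ I) : ∀ᶠ y in 𝓝[≠] s, x y ≠ 0 := by
  have hd := hasDerivAt_of_contDiffOn h.isOpen h.smooth_x hs
  by_cases hx : x s = 0
  · have hne := (h.regular s hs).resolve_right (not_not.2 (h0 s hs hx))
    exact hd.eventually_ne hne
  · exact nhdsWithin_le_nhds (hd.continuousAt.eventually_ne hx)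

/-- Along a rotational surface of mean curvature `H`, the first integral is `2H cosh ρ + d`. -/
theorem IsGenerating.exists_firstInt {I : Set ℝ} {x t : ℝ → ℝ} (h : IsGenerating I x t) {τ H : ℝ}
    (hI : I.OrdConnected) (h0 : ∀ s ∈ I, x s = 0 → deriv t s = 0) {N : ℝ × ℝ → Pt}
    (hN : ContinuousOn N (I ×ˢ univ))
    (hNH : ∀ q ∈ I ×ˢ (univ : Set ℝ), IsUnitNormalAt τ (rotMap x t) (N q) q ∧
        (x q.1 ≠ 0 → meanCurvature τ (rotMap x t) (N q) q = H)) :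
    ∃ κ d : ℝ, (κ = 1 ∨ κ = -1) ∧ (∀ s ∈ I, κ * firstInt τ (x s) (deriv x s) (deriv t s)
      = 2 * H * ch (x s) + d) ∧ ∀ s ∈ I, κ * curvJ τ (x s) (deriv x s) (deriv t s)
        (deriv (deriv x) s) (deriv (deriv t) s) = 2 * H * cf (x s) ^ 2 * x s := by
  have hmap : MapsTo (fun s : ℝ => (s, (0 : ℝ))) I (I ×ˢ univ) := fun s hs => ⟨hs, mem_univ _⟩
  have hmc : ContinuousOn (fun s : ℝ => (s, (0 : ℝ))) I := by fun_prop
  -- Compares the given normal with the standard one: k² = 1 off the axis, hence everywhere by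
  -- continuity, and k is a constant sign κ because I is connected.
  set k : ℝ → ℝ := fun s => metric τ (rotMap x t (s, 0)) (N (s, 0)) (normalField τ x t (s, 0))
    with hk
  have hkc : ContinuousOn k I := continuousOn_metric τ
    ((contDiffOn_rotMap h.smooth_x h.smooth_t).continuousOn.comp hmc hmap)
    (hN.comp hmc hmap) ((h.continuousOn_normalField τ).comp hmc hmap)
    fun s hs => rotMap_mem (h.lt_one s hs)
  have hNk : ∀ s ∈ I, x s ≠ 0 → N (s, 0) = k s • normalField τ x t (s, 0) ∧ k s ^ 2 = 1 := by
    intro s hs hx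
    obtain ⟨c, hc⟩ := exists_eq_smul_normalField τ h hs hx (hNH (s, 0) ⟨hs, mem_univ _⟩).1
    have hu := (h.isUnitNormalAt τ (q := (s, 0)) hs).1
    have hu' := (hNH (s, 0) ⟨hs, mem_univ _⟩).1.1
    have hkc : k s = c := by
      simp only [hk]
      rw [hc, metric_symm, metric_smul_right, hu, mul_one]
    rw [hkc]
    refine ⟨hc, ?_⟩
    rw [hc, metric_smul_right, metric_symm, metric_smul_right, hu] at hu'
    linarith
  have hk2 : ∀ s ∈ I, k s ^ 2 = 1 := by
    intro s hs
    have hc : ContinuousAt (fun s => k s ^ 2 - 1) s :=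
      ((hkc.pow 2).sub continuousOn_const).continuousAt (h.isOpen.mem_nhds hs)
    have := eq_zero_of_eventually_punctured hc (by
      filter_upwards [h.eventually_ne_zero h0 hs, nhdsWithin_le_nhds (h.isOpen.mem_nhds hs)]
        with y hy hyI
      rw [(hNk y hyI hy).2, sub_self])
    linarith
  obtain ⟨κ, hκ, hκk⟩ : ∃ κ : ℝ, (κ = 1 ∨ κ = -1) ∧ ∀ s ∈ I, k s = κ := by
    rcases hI.isPreconnected.eq_or_eq_neg_of_sq_eq hkc (continuousOn_const (c := (1 : ℝ)))
      (fun s hs => by simpa using hk2 s hs) (fun _ => one_ne_zero) with e | e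
    · exact ⟨1, Or.inl rfl, fun s hs => e hs⟩
    · exact ⟨-1, Or.inr rfl, fun s hs => e hs⟩
  have hκ2 : κ * κ = 1 := by rcases hκ with rfl | rfl <;> norm_num
  have hJ : ∀ s ∈ I, κ * curvJ τ (x s) (deriv x s) (deriv t s)
        (deriv (deriv x) s) (deriv (deriv t) s) = 2 * H * cf (x s) ^ 2 * x s := by
    intro s hs
    have hc : ContinuousOn (fun s => κ * curvJ τ (x s) (deriv x s) (deriv t s)
        (deriv (deriv x) s) (deriv (deriv t) s) - 2 * H * cf (x s) ^ 2 * x s) I := by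
      have c1 := h.smooth_x.continuousOn
      have c4 := continuousOn_cf c1 h.lt_one
      exact (continuousOn_const.mul (h.continuousOn_curvJ τ)).sub (by fun_prop)
    have := eq_zero_of_eventually_punctured (hc.continuousAt (h.isOpen.mem_nhds hs)) (by
      filter_upwards [h.eventually_ne_zero h0 hs, nhdsWithin_le_nhds (h.isOpen.mem_nhds hs)]
        with y hy hyI
      have hH := (hNH (y, 0) ⟨hyI, mem_univ _⟩).2 hy
      rw [(hNk y hyI hy).1, hκk y hyI, h.meanCurvature_smul τ κ (q := (y, 0)) hyI hy] at hH
      have := cf_pos (h.lt_one y hyI)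
      rw [div_eq_iff (by positivity)] at hH
      simp only at hH
      linarith)
    linarith
  obtain ⟨d, hd⟩ := exists_eq_const_of_hasDerivAt_zero hI
    (f := fun s => κ * firstInt τ (x s) (deriv x s) (deriv t s) - 2 * H * ch (x s)) (by
      intro s hs
      refine (((h.hasDerivAt_firstInt τ hs).const_mul κ).sub ((hasDerivAt_ch
        (hasDerivAt_of_contDiffOn h.isOpen h.smooth_x hs) (h.lt_one s hs)).const_mul
          (2 * H))).congr_deriv ?_
      linear_combination deriv x s * hJ s hs)
  exact ⟨κ, d, hκ, fun s hs => by linarith [hd s hs], hJ⟩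

theorem ch_sub_one {x : ℝ} (hx : |x| < 1) : ch x - 1 = cf x * x ^ 2 := by
  have := (one_sub_sq_pos hx).ne'
  rw [ch, cf]; field_simp; ring

theorem ch_add_one {x : ℝ} (hx : |x| < 1) : ch x + 1 = cf x := by
  have := (one_sub_sq_pos hx).ne'
  rw [ch, cf]; field_simp; ring

/-- The rotational surfaces with `d = -2H` are pieces of the entire graph. -/
theorem IsGenerating.subset_graph {I : Set ℝ} {x t : ℝ → ℝ} (h : IsGenerating I x t) {τ H κ : ℝ}
    (hI : I.OrdConnected) (hH : 4 * H ^ 2 ≤ 1)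
    (h0 : ∀ s ∈ I, x s = 0 → deriv t s = 0) (hκ : κ = 1 ∨ κ = -1)
    (hP : ∀ s ∈ I, κ * firstInt τ (x s) (deriv x s) (deriv t s) = 2 * H * ch (x s) + -2 * H) :
    ∃ φ, IsIsometry τ φ ∧ rotMap x t '' (I ×ˢ univ) ⊆ φ '' family τ H (-2 * H) := by
  have hκ2 : κ * κ = 1 := by rcases hκ with rfl | rfl <;> norm_num
  have hW : ∀ s ∈ I, 0 < nsq τ (x s) (deriv x s) (deriv t s) := fun s hs =>
    nsq_pos (h.lt_one s hs) (h.regular s hs)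
  -- The first integral here is 2H(cosh ρ − 1) = 2Hλx²; division by λx is legitimate off the axis
  -- and extends by continuity.
  have key : ∀ s ∈ I, κ * deriv t s = 2 * H * x s * √(nsq τ (x s) (deriv x s) (deriv t s)) := by
    intro s hs
    have hc : ContinuousOn (fun s => κ * deriv t s
        - 2 * H * x s * √(nsq τ (x s) (deriv x s) (deriv t s))) I := by
      have c1 := h.smooth_x.continuousOn
      have c2 := (contDiffOn_deriv h.isOpen h.smooth_t).continuousOn
      exact (continuousOn_const.mul c2).sub
        ((continuousOn_const.mul c1).mul (h.continuousOn_nsq τ).sqrt)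
    have := eq_zero_of_eventually_punctured (hc.continuousAt (h.isOpen.mem_nhds hs)) (by
      filter_upwards [h.eventually_ne_zero h0 hs, nhdsWithin_le_nhds (h.isOpen.mem_nhds hs)]
        with y hy hyI
      have h1 := hP y hyI
      have h2 := ch_sub_one (h.lt_one y hyI)
      have hL := cf_pos (h.lt_one y hyI)
      have hW1 := Real.sqrt_pos.2 (hW y hyI)
      have h3 : κ * firstInt τ (x y) (deriv x y) (deriv t y) = 2 * H * (cf (x y) * x y ^ 2) := by
        rw [h1, ← h2]; ring
      rw [firstInt, mul_div_assoc', div_eq_iff hW1.ne'] at h3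
      have h4 : cf (x y) * x y * (κ * deriv t y
          - 2 * H * x y * √(nsq τ (x y) (deriv x y) (deriv t y))) = 0 := by
        linear_combination h3
      exact (mul_eq_zero.1 h4).resolve_left (mul_ne_zero hL.ne' hy))
    linarith
  have hJ : ∀ s ∈ I, x s ^ 2 ∈ slopeDom τ H := fun s hs => sq_mem_slopeDom τ hH (h.lt_one s hs)
  have hWeq : ∀ s ∈ I, nsq τ (x s) (deriv x s) (deriv t s) * (1 - 4 * H ^ 2 * x s ^ 2)
      = cf (x s) ^ 2 * deriv x s ^ 2 * ee τ (x s) := by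
    intro s hs
    have h1 := congrArg (fun y => y ^ 2) (key s hs)
    rw [mul_pow _ (√_), Real.sq_sqrt (hW s hs).le] at h1
    have h2 : deriv t s ^ 2 = 4 * H ^ 2 * x s ^ 2 * nsq τ (x s) (deriv x s) (deriv t s) := by
      linear_combination h1 - deriv t s ^ 2 * hκ2
    have h3 : nsq τ (x s) (deriv x s) (deriv t s)
      = deriv t s ^ 2 + cf (x s) ^ 2 * deriv x s ^ 2 * ee τ (x s) := rfl
    linear_combination h3 + h2
  -- The left side of `hWeq` is positive, so the profile is a graph over the radius on all of I, the
  -- axis included.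
  have hx' : ∀ s ∈ I, deriv x s ≠ 0 := by
    intro s hs e
    have h1 := hWeq s hs
    rw [e] at h1
    have h2 := mul_pos (nsq_pos (τ := τ) (h.lt_one s hs) (h.regular s hs)) (hJ s hs).2.2
    rw [e] at h2
    rw [h1] at h2
    norm_num at h2
  obtain ⟨η, hη, hpos⟩ := pos_or_neg_of_continuousOn hI
    (contDiffOn_deriv h.isOpen h.smooth_x).continuousOn hx'
  have hη2 : η * η = 1 := by rcases hη with rfl | rfl <;> norm_num
  obtain ⟨C, hC⟩ := exists_eq_const_of_hasDerivAt_zero hI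
    (f := fun s => t s - κ * η * height τ H (x s ^ 2)) (by
      intro s hs
      have hxd := hasDerivAt_of_contDiffOn h.isOpen h.smooth_x hs
      have hh : HasDerivAt (fun s => height τ H (x s ^ 2))
          (slope τ H (x s ^ 2) * (2 * x s) * deriv x s) s :=
        HasDerivAt.comp (h₂ := fun y => height τ H (y ^ 2)) s (hasDerivAt_height_sq (hJ s hs)) hxd
      refine ((hasDerivAt_of_contDiffOn h.isOpen h.smooth_t hs).sub
        (hh.const_mul (κ * η))).congr_deriv ?_
      have hG := Real.sqrt_pos.2 (hJ s hs).2.2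
      have hG2 := Real.sq_sqrt (hJ s hs).2.2.le
      have hE2 := Real.sq_sqrt (ee_pos τ (x s)).le
      have hL := cf_pos (h.lt_one s hs)
      have hsq : √(nsq τ (x s) (deriv x s) (deriv t s))
          = cf (x s) * (η * deriv x s) * √(ee τ (x s)) / √(1 - 4 * H ^ 2 * x s ^ 2) := by
        have h1 := hpos s hs
        have h2 := Real.sqrt_pos.2 (ee_pos τ (x s))
        rw [← Real.sqrt_sq (show 0 ≤ cf (x s) * (η * deriv x s) * √(ee τ (x s)) /
          √(1 - 4 * H ^ 2 * x s ^ 2) by positivity)]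
        congr 1
        rw [div_pow, hG2, eq_div_iff (hJ s hs).2.2.ne', hWeq s hs, mul_pow, hE2]
        linear_combination -(cf (x s) ^ 2 * deriv x s ^ 2 * ee τ (x s)) * hη2
      have h3 := key s hs
      rw [hsq] at h3
      have h4 : deriv t s = κ * (2 * H * x s * (cf (x s) * (η * deriv x s) * √(ee τ (x s))
          / √(1 - 4 * H ^ 2 * x s ^ 2))) := by
        rw [← h3]; linear_combination -deriv t s * hκ2
      rw [h4, slope, cf, ee]
      have := (one_sub_sq_pos (h.lt_one s hs)).ne'
      generalize √(1 + 4 * τ ^ 2 * x s ^ 2) = e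
      generalize √(1 - 4 * H ^ 2 * x s ^ 2) = G at *
      field_simp
      ring)
  set δ := κ * η with hδ
  have hδ2 : δ * δ = 1 := by rw [hδ]; linear_combination κ * κ * hη2 + hκ2
  have hδ' : δ = 1 ∨ δ = -1 := mul_self_eq_one_iff.1 hδ2
  refine ⟨vertIso δ C, isIsometry_vertIso τ C hδ2, ?_⟩
  rintro _ ⟨⟨s, θ⟩, ⟨hs, -⟩, rfl⟩
  -- When δ = −1 the isometry also reverses y, which the change of angle to δθ undoes.
  refine ⟨rotMap (fun s => s) (fun s => height τ H (s ^ 2)) (x s, δ * θ), ?_, ?_⟩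
  · rw [family_self, graphMap_image_eq]
    exact ⟨_, ⟨abs_lt.1 (h.lt_one s hs), mem_univ _⟩, rfl⟩
  · have ht : t s = δ * height τ H (x s ^ 2) + C := by
      linarith [hC s hs]
    ext i
    fin_cases i
    · rcases hδ' with e | e <;> simp [vertIso, rotMap, e]
    · rcases hδ' with e | e <;> simp [vertIso, rotMap, e]
    · simp [vertIso, rotMap, ht]

/-- The vertical line: a point where the first two derivatives of `x` vanish is impossible. -/
theorem no_vertical_line {τ H κ x t' t'' : ℝ} (hH0 : 0 < H) (hH : H ≤ 1 / 2) (hx0 : 0 < x) (hx1 : x < 1)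
    (ht : t' ≠ 0) (hκ : κ = 1 ∨ κ = -1)
    (hJ : κ * curvJ τ x 0 t' 0 t'' = 2 * H * cf x ^ 2 * x) : False := by
  have hL := cf_pos (x := x) (by rw [abs_of_pos hx0]; exact hx1)
  have hn : √(nsq τ x 0 t') = |t'| := by
    rw [← Real.sqrt_sq_eq_abs]; congr 1; simp [nsq]
  rw [curvJ, hn] at hJ
  have ha := abs_pos.2 ht
  have h1 : κ * (cf x ^ 2 * (1 + x ^ 2) * t' / (2 * |t'|)) = 2 * H * cf x ^ 2 * x := by
    rw [← hJ]; congr 1; simp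
  rw [mul_div_assoc', div_eq_iff (by positivity)] at h1
  have h2 : (1 + x ^ 2) * (κ * t') = 4 * H * x * |t'| := by
    have : cf x ^ 2 * ((1 + x ^ 2) * (κ * t') - 4 * H * x * |t'|) = 0 := by linear_combination h1
    have := (mul_eq_zero.1 this).resolve_left (by positivity)
    linarith
  have h3 := congrArg abs h2
  have hκ1 : |κ| = 1 := by rcases hκ with rfl | rfl <;> simp
  rw [abs_mul, abs_mul, hκ1, one_mul, abs_mul, abs_abs, abs_of_pos (by positivity : 0 < 1 + x ^ 2)]
    at h3
  have h4 := mul_right_cancel₀ ha.ne' h3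
  rw [abs_of_pos (by positivity)] at h4
  -- A vertical cylinder would need 1 + x² = 4Hx ≤ 2x, contradicting (1 − x)² > 0.
  nlinarith [mul_le_mul_of_nonneg_right hH hx0.le, mul_self_pos.2 (sub_ne_zero.2 hx1.ne)]

/-- The second factor of Q equals (1 − 4H²)c + (`disc` − 2Hd), so this makes it positive for every c
≥ 0, also below the neck value. -/
theorem IsParam.two_mul_lt_disc {H d : ℝ} (h : IsParam H d) : 2 * H * d < disc H d := by
  rcases h.adm with h' | ⟨h', hd⟩
  · refine lt_of_le_of_lt (le_abs_self _) (abs_lt_of_sq_lt_sq ?_ h.disc_pos.le)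
    have h1 : 0 < 1 - 4 * H ^ 2 := by nlinarith [h.pos]
    rw [h.disc_sq]
    nlinarith [mul_pos h1 (show 0 < 1 + d ^ 2 by positivity)]
  · nlinarith [h.disc_pos]

/-- The rotational surfaces with `d ≠ -2H` are pieces of the profile surfaces. -/
theorem IsGenerating.subset_profile {I : Set ℝ} {x t : ℝ → ℝ} (h : IsGenerating I x t)
    {τ H κ d : ℝ} (hI : I.OrdConnected) (hne : I.Nonempty) (hH0 : 0 < H) (hH1 : H ≤ 1 / 2)
    (hd : d ≠ -2 * H) (hx : ∀ s ∈ I, 0 < x s) (hκ : κ = 1 ∨ κ = -1)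
    (hP : ∀ s ∈ I, κ * firstInt τ (x s) (deriv x s) (deriv t s) = 2 * H * ch (x s) + d)
    (hJ : ∀ s ∈ I, κ * curvJ τ (x s) (deriv x s) (deriv t s) (deriv (deriv x) s)
      (deriv (deriv t) s) = 2 * H * cf (x s) ^ 2 * x s) :
    Admissible H d ∧
      ∃ φ, IsIsometry τ φ ∧ rotMap x t '' (I ×ˢ univ) ⊆ φ '' family τ H d := by
  have hκ2 : κ * κ = 1 := by rcases hκ with rfl | rfl <;> norm_num
  have hW : ∀ s ∈ I, 0 < nsq τ (x s) (deriv x s) (deriv t s) := fun s hs =>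
    nsq_pos (h.lt_one s hs) (h.regular s hs)
  have hx1 : ∀ s ∈ I, x s < 1 := fun s hs => (abs_lt.1 (h.lt_one s hs)).2
  have hc1 : ∀ s ∈ I, 1 < ch (x s) := by
    intro s hs
    have h1 := ch_sub_one (h.lt_one s hs)
    have := cf_pos (h.lt_one s hs)
    have := hx s hs
    have : 0 < cf (x s) * x s ^ 2 := by positivity
    linarith
  have hcsq : ∀ s ∈ I, ch (x s) ^ 2 - 1 = (cf (x s) * x s) ^ 2 := by
    intro s hs
    have h1 := ch_sub_one (h.lt_one s hs)
    have h2 := ch_add_one (h.lt_one s hs)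
    have : ch (x s) ^ 2 - 1 = (ch (x s) - 1) * (ch (x s) + 1) := by ring
    rw [this, h1, h2]; ring
  have hPt : ∀ s ∈ I, cf (x s) * x s * (κ * deriv t s)
      = (2 * H * ch (x s) + d) * √(nsq τ (x s) (deriv x s) (deriv t s)) := by
    intro s hs
    have hW1 := Real.sqrt_pos.2 (hW s hs)
    have h1 := hP s hs
    rw [firstInt, mul_div_assoc', div_eq_iff hW1.ne'] at h1
    linear_combination h1
  -- The squared first integral with t' eliminated: it forces Q(c) ≥ 0 and relates x' to Q.
  have hQ : ∀ s ∈ I, (ch (x s) ^ 2 - 1 - (2 * H * ch (x s) + d) ^ 2)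
      * nsq τ (x s) (deriv x s) (deriv t s)
      = (cf (x s) ^ 2 * x s * deriv x s) ^ 2 * ee τ (x s) := by
    intro s hs
    have h1 := congrArg (fun y => y ^ 2) (hPt s hs)
    rw [mul_pow _ (√_), Real.sq_sqrt (hW s hs).le] at h1
    have h3 : nsq τ (x s) (deriv x s) (deriv t s)
      = deriv t s ^ 2 + cf (x s) ^ 2 * deriv x s ^ 2 * ee τ (x s) := rfl
    linear_combination nsq τ (x s) (deriv x s) (deriv t s) * hcsq s hs + h1
      + (cf (x s) * x s) ^ 2 * h3 - (cf (x s) * x s) ^ 2 * deriv t s ^ 2 * hκ2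
  have hQ0 : ∀ s ∈ I, 0 ≤ ch (x s) ^ 2 - 1 - (2 * H * ch (x s) + d) ^ 2 := by
    intro s hs
    have h1 : 0 ≤ (cf (x s) ^ 2 * x s * deriv x s) ^ 2 * ee τ (x s) :=
      mul_nonneg (sq_nonneg _) (ee_pos _ _).le
    rw [← hQ s hs] at h1
    exact nonneg_of_mul_nonneg_left h1 (hW s hs)
  -- For H = 1/2 one has Q(c) = −1 − 2cd − d², which can be nonnegative only if d < 0.
  have hpar : IsParam H d := by
    refine ⟨hH0, hH1, ?_⟩
    rcases hH1.lt_or_eq with h' | h'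
    · exact Or.inl h'
    · obtain ⟨s, hs⟩ := hne
      refine Or.inr ⟨h', ?_⟩
      have h1 := hQ0 s hs
      have h2 := hc1 s hs
      rw [h'] at h1
      by_contra hcon
      nlinarith [mul_nonneg (not_lt.1 hcon) (zero_le_one.trans h2.le)]
  refine ⟨hpar.adm, ?_⟩
  have hge : ∀ s ∈ I, neckCosh H d ≤ ch (x s) := by
    intro s hs
    by_contra hcon
    rw [not_le] at hcon
    have h1 := hQ0 s hs
    have e : ch (x s) ^ 2 - 1 - (2 * H * ch (x s) + d) ^ 2 = (ch (x s) - neckCosh H d) *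
        ((1 - 4 * H ^ 2) * (ch (x s) - neckCosh H d) + 2 * disc H d) := by
      linear_combination hpar.neckCosh_sq + 2 * (ch (x s) - neckCosh H d) * hpar.neckCosh_mul
    rw [e] at h1
    have h2 := hpar.neckCosh_mul
    have h3 := hpar.two_mul_lt_disc
    have h4 := mul_nonneg (sub_nonneg.2 hpar.four_sq_le) (zero_le_one.trans (hc1 s hs).le)
    have h5 : 0 < (1 - 4 * H ^ 2) * (ch (x s) - neckCosh H d) + 2 * disc H d := by nlinarith
    nlinarith
  -- The absolute value of the model parameter; its sign is recovered later as σ.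
  set v : ℝ → ℝ := fun s => √(ch (x s) - neckCosh H d) with hv
  have hv0 : ∀ s, 0 ≤ v s := fun s => Real.sqrt_nonneg _
  have hvsq : ∀ s ∈ I, v s ^ 2 = ch (x s) - neckCosh H d := fun s hs =>
    Real.sq_sqrt (sub_nonneg.2 (hge s hs))
  have hprC : ∀ s ∈ I, prC H d (v s) = ch (x s) := by
    intro s hs
    rw [prC, hvsq s hs]; ring
  have hprX : ∀ s ∈ I, prX H d (v s) = x s := by
    intro s hs
    have hL := cf_pos (h.lt_one s hs)
    rw [prX, hprC s hs, ch_sub_one (h.lt_one s hs), ch_add_one (h.lt_one s hs),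
      mul_div_cancel_left₀ _ hL.ne', Real.sqrt_sq (hx s hs).le]
  have hvq : ∀ s ∈ I, v s * √(prQ H d (v s)) * √(nsq τ (x s) (deriv x s) (deriv t s))
      = cf (x s) ^ 2 * x s * |deriv x s| * √(ee τ (x s)) := by
    intro s hs
    have hL := cf_pos (h.lt_one s hs)
    have hxs := hx s hs
    refine (pow_left_inj₀ (mul_nonneg (mul_nonneg (hv0 s) (Real.sqrt_nonneg _)) (Real.sqrt_nonneg _))
      (by positivity) two_ne_zero).1 ?_
    rw [mul_pow, mul_pow, mul_pow _ (√(ee τ (x s))), mul_pow _ |deriv x s|, sq_abs,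
      Real.sq_sqrt (hW s hs).le, Real.sq_sqrt (hpar.prQ_pos _).le, Real.sq_sqrt (ee_pos _ _).le,
      ← mul_pow, ← hQ s hs]
    have := hpar.prC_sq (v s)
    rw [hprC s hs] at this
    rw [this]; ring
  have hvz : ∀ s ∈ I, v s = 0 ↔ deriv x s = 0 := by
    intro s hs
    have h1 := hvq s hs
    have hL := cf_pos (h.lt_one s hs)
    have hxs := hx s hs
    have hq := Real.sqrt_pos.2 (hpar.prQ_pos (v s))
    have hw := Real.sqrt_pos.2 (hW s hs)
    have he := Real.sqrt_pos.2 (ee_pos τ (x s))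
    constructor
    · intro e
      by_contra hne
      rw [e, zero_mul, zero_mul] at h1
      have : 0 < cf (x s) ^ 2 * x s * |deriv x s| * √(ee τ (x s)) := by positivity
      linarith
    · intro e
      by_contra hne
      have h2 : cf (x s) ^ 2 * x s * |deriv x s| * √(ee τ (x s)) = 0 := by rw [e]; simp
      rw [h2] at h1
      have : 0 < v s := lt_of_le_of_ne (hv0 s) (Ne.symm hne)
      have : 0 < v s * √(prQ H d (v s)) * √(nsq τ (x s) (deriv x s) (deriv t s)) := by positivity
      linarith
  have hvx : ∀ s ∈ I, v s = 0 → x s = prX H d 0 := by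
    intro s hs e
    rw [← hprX s hs, e]
  have hxge : ∀ s ∈ I, prX H d 0 ≤ x s := by
    intro s hs
    rw [← hprX s hs]; exact hpar.prX_le _
  -- Every zero of x' lies at the minimal radius. Between two zeros the maximum of x would then also
  -- be that radius, so x would be constant and the curve a vertical line.
  have huniq : ∀ a ∈ I, ∀ b ∈ I, deriv x a = 0 → deriv x b = 0 → ¬a < b := by
    intro a ha b hb ea eb hab
    have hsub : Icc a b ⊆ I := hI.out ha hb
    obtain ⟨m, hm, hmax⟩ := isCompact_Icc.exists_isMaxOn (nonempty_Icc.2 hab.le)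
      (h.smooth_x.continuousOn.mono hsub)
    have xa := hvx a ha ((hvz a ha).2 ea)
    have xb := hvx b hb ((hvz b hb).2 eb)
    have hxm : x m = prX H d 0 := by
      by_cases h1 : m = a
      · rw [h1, xa]
      by_cases h2 : m = b
      · rw [h2, xb]
      have hmI : m ∈ Ioo a b := ⟨lt_of_le_of_ne hm.1 (Ne.symm h1), lt_of_le_of_ne hm.2 h2⟩
      have := (hmax.isLocalMax (Icc_mem_nhds hmI.1 hmI.2)).deriv_eq_zero
      exact hvx m (hsub hm) ((hvz m (hsub hm)).2 this)
    have hxc : ∀ s ∈ Icc a b, x s = prX H d 0 := fun s hs =>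
      le_antisymm (hxm ▸ hmax hs) (hxge s (hsub hs))
    have hder : ∀ s ∈ Ioo a b, deriv x s = 0 := by
      intro s hs
      have : x =ᶠ[𝓝 s] fun _ => prX H d 0 := by
        filter_upwards [Icc_mem_nhds hs.1 hs.2] with y hy using hxc y hy
      rw [this.deriv_eq, deriv_const]
    obtain ⟨s, hs⟩ := exists_between hab
    have hsI := hsub ⟨hs.1.le, hs.2.le⟩
    have hder2 : deriv (deriv x) s = 0 := by
      have : deriv x =ᶠ[𝓝 s] fun _ => 0 := by
        filter_upwards [Ioo_mem_nhds hs.1 hs.2] with y hy using hder y hy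
      rw [this.deriv_eq, deriv_const]
    have hJs := hJ s hsI
    have ht := (h.regular s hsI).resolve_left (not_not.2 (hder s hs))
    rw [hder2, hder s hs] at hJs
    exact no_vertical_line hH0 hH1 (hx s hsI) (hx1 s hsI) ht hκ hJs
  -- Where x' keeps its sign, v is differentiable, and t and T(v) have the same derivative up to the
  -- sign κη.
  have hloc : ∀ J ⊆ I, J.OrdConnected → (∀ s ∈ J, deriv x s ≠ 0) →
      ∃ σ C : ℝ, (σ = 1 ∨ σ = -1) ∧ ∀ s ∈ J, t s = σ * prT τ H d (v s) + C := by
    intro J hJI hJc hJ0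
    obtain ⟨η, hη, hpos⟩ := pos_or_neg_of_continuousOn hJc
      ((contDiffOn_deriv h.isOpen h.smooth_x).continuousOn.mono hJI) hJ0
    have hη2 : η * η = 1 := by rcases hη with rfl | rfl <;> norm_num
    obtain ⟨C, hC⟩ := exists_eq_const_of_hasDerivAt_zero hJc
      (f := fun s => t s - κ * η * prT τ H d (v s)) (by
        intro s hs
        have hsI := hJI hs
        have hxs := hx s hsI
        have hvpos : 0 < v s := lt_of_le_of_ne (hv0 s) fun e => hJ0 s hs ((hvz s hsI).1 e.symm)
        have hvd : HasDerivAt v (cf (x s) ^ 2 * x s * deriv x s / (2 * v s)) s := by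
          refine ((hasDerivAt_ch (hasDerivAt_of_contDiffOn h.isOpen h.smooth_x hsI)
            (h.lt_one s hsI)).sub_const (neckCosh H d)).sqrt ?_
          have := hvsq s hsI
          rw [← this]; positivity
        have hT := HasDerivAt.comp (h₂ := prT τ H d) s (hpar.hasDerivAt_prT hd τ (v s)) hvd
        refine ((hasDerivAt_of_contDiffOn h.isOpen h.smooth_t hsI).sub
          (hT.const_mul (κ * η))).congr_deriv ?_
        have hL := cf_pos (h.lt_one s hsI)
        have hq := Real.sqrt_pos.2 (hpar.prQ_pos (v s))
        have hw := Real.sqrt_pos.2 (hW s hsI)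
        have he := Real.sqrt_pos.2 (ee_pos τ (x s))
        have h1 := hvq s hsI
        have habs : |deriv x s| = η * deriv x s := by
          rw [← abs_of_pos (hpos s hs), abs_mul]
          rcases hη with rfl | rfl <;> simp
        rw [habs] at h1
        have h2 := hPt s hsI
        have hxd := hJ0 s hs
        rw [prSlope, hprX s hsI, hprC s hsI, ch_add_one (h.lt_one s hsI)]
        have h3 : deriv t s = κ * ((2 * H * ch (x s) + d) *
            √(nsq τ (x s) (deriv x s) (deriv t s)) / (cf (x s) * x s)) := by
          rw [← h2]
          field_simp
          linear_combination -deriv t s * hκ2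
        have h4 : √(nsq τ (x s) (deriv x s) (deriv t s))
            = cf (x s) ^ 2 * x s * (η * deriv x s) * √(ee τ (x s)) / (v s * √(prQ H d (v s))) := by
          rw [← h1]; field_simp
        rw [h3, h4]
        field_simp
        ring)
    refine ⟨κ * η, C, ?_, fun s hs => by linarith [hC s hs]⟩
    exact mul_self_eq_one_iff.1 (by linear_combination κ * κ * hη2 + hκ2)
  -- Only C has to be common to all of I. The sign may vary with the point, because the model
  -- surface is symmetric in the slice t = 0.
  obtain ⟨C, hC⟩ : ∃ C, ∀ s ∈ I, ∃ σ : ℝ, (σ = 1 ∨ σ = -1) ∧ t s = σ * prT τ H d (v s) + C := by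
    by_cases hz : ∃ z ∈ I, deriv x z = 0
    · obtain ⟨z, hzI, hz⟩ := hz
      have hvz0 := (hvz z hzI).2 hz
      have hnear := h.isOpen.mem_nhds hzI
      have hcont : ContinuousAt (fun s => prT τ H d (v s)) z := by
        have hch : ContinuousAt (fun s => ch (x s)) z := (hasDerivAt_ch
          (hasDerivAt_of_contDiffOn h.isOpen h.smooth_x hzI) (h.lt_one z hzI)).continuousAt
        exact (hpar.contDiff_prT hd τ).continuous.continuousAt.comp
          (hch.sub continuousAt_const).sqrt
      have hct := (hasDerivAt_of_contDiffOn h.isOpen h.smooth_t hzI).continuousAt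
      -- At the neck T(v) tends to 0, so the constants found on the two sides both equal t(z).
      have hlim : ∀ (J : Set ℝ) (σ C : ℝ), (𝓝[J] z).NeBot →
          (∀ s ∈ I ∩ J, t s = σ * prT τ H d (v s) + C) → C = t z := by
        intro J σ C hnb hs
        have h1 : Tendsto t (𝓝[J] z) (𝓝 (t z)) := hct.tendsto.mono_left nhdsWithin_le_nhds
        have h2 : Tendsto (fun s => σ * prT τ H d (v s) + C) (𝓝[J] z)
            (𝓝 (σ * prT τ H d (v z) + C)) :=
          ((continuousAt_const.mul hcont).add continuousAt_const).tendsto.mono_left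
            nhdsWithin_le_nhds
        rw [hvz0, IsParam.prT_zero, mul_zero, zero_add] at h2
        refine tendsto_nhds_unique h2 (h1.congr' ?_)
        filter_upwards [nhdsWithin_le_nhds hnear, self_mem_nhdsWithin] with s hsI hsJ
        exact hs s ⟨hsI, hsJ⟩
      obtain ⟨σ₁, C₁, hσ₁, h₁⟩ := hloc (I ∩ Ioi z) inter_subset_left
        (hI.inter ordConnected_Ioi) fun s hs e => huniq z hzI s hs.1 hz e hs.2
      obtain ⟨σ₂, C₂, hσ₂, h₂⟩ := hloc (I ∩ Iio z) inter_subset_left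
        (hI.inter ordConnected_Iio) fun s hs e => huniq s hs.1 z hzI e hz hs.2
      have e₁ := hlim (Ioi z) σ₁ C₁ inferInstance h₁
      have e₂ := hlim (Iio z) σ₂ C₂ inferInstance h₂
      refine ⟨t z, fun s hs => ?_⟩
      rcases lt_trichotomy s z with hlt | rfl | hgt
      · exact ⟨σ₂, hσ₂, e₂ ▸ h₂ s ⟨hs, hlt⟩⟩
      · exact ⟨1, Or.inl rfl, by rw [hvz0, IsParam.prT_zero]; ring⟩
      · exact ⟨σ₁, hσ₁, e₁ ▸ h₁ s ⟨hs, hgt⟩⟩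
    · push Not at hz
      obtain ⟨σ, C, hσ, hs⟩ := hloc I le_rfl hI hz
      exact ⟨C, fun s hsI => ⟨σ, hσ, hs s hsI⟩⟩
  refine ⟨vertIso 1 C, isIsometry_vertIso τ C (by norm_num), ?_⟩
  rintro _ ⟨⟨s, θ⟩, ⟨hs, -⟩, rfl⟩
  obtain ⟨σ, hσ, ht⟩ := hC s hs
  refine ⟨profilePt τ H d σ (v s) θ, IsParam.profilePt_mem hd hσ _ _, ?_⟩
  ext i
  fin_cases i
  · simp [vertIso, profilePt, rotMap, hprX s hs]
  · simp [vertIso, profilePt, rotMap, hprX s hs]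
  · simp [vertIso, profilePt, rotMap, ht]

theorem classification {τ H : ℝ} (hH0 : 0 < H) (hH1 : H ≤ 1 / 2) {S : Set Pt}
    (hS : IsRotationalHSurface τ H S) :
    ∃ d, Admissible H d ∧ ∃ φ : Pt → Pt, IsIsometry τ φ ∧ S ⊆ φ '' family τ H d := by
  obtain ⟨I, x, t, hIo, hI, hne, hsx, hst, hlt, hreg, h0, ⟨N, hN, hNH⟩, rfl⟩ := hS
  have h : IsGenerating I x t := ⟨hIo, hsx, hst, hlt, hreg⟩
  obtain ⟨κ, d, hκ, hP, hJ⟩ := h.exists_firstInt hI h0 hN hNH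
  have hcrit := isParam_critical hH0 hH1
  rcases eq_or_ne d (-2 * H) with rfl | hd
  · exact ⟨_, hcrit.adm, h.subset_graph hI hcrit.four_sq_le h0 hκ hP⟩
  -- On the axis the first integral vanishes and cosh ρ = 1, which would give d = −2H.
  · have hx0 : ∀ s ∈ I, x s ≠ 0 := by
      intro s hs e
      have h1 := hP s hs
      rw [e] at h1
      simp only [firstInt, ch] at h1
      norm_num at h1
      exact hd (by linarith)
    obtain ⟨χ, hχ, hpos⟩ := pos_or_neg_of_continuousOn hI hsx.continuousOn hx0
    rcases hχ with rfl | rfl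
    · exact ⟨d, h.subset_profile hI hne hH0 hH1 hd (fun s hs => by simpa using hpos s hs) hκ hP hJ⟩
    -- A profile with x < 0 is replaced by its half-turn image: negating x negates the first
    -- integral and fixes `curvJ`, so κ changes sign, and shifting θ by π recovers the same surface.
    · have hdx : deriv (fun s => -x s) = fun s => -deriv x s := by ext s; exact deriv.fun_neg
      have hdx2 : deriv (fun s => -deriv x s) = fun s => -deriv (deriv x) s := by
        ext s; exact deriv.fun_neg
      have h' : IsGenerating I (fun s => -x s) t := ⟨hIo, hsx.neg, hst, fun s hs => by
        rw [abs_neg]; exact hlt s hs, fun s hs => by rw [hdx]; simpa using hreg s hs⟩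
      have hn : ∀ a b c : ℝ, nsq τ (-a) (-b) c = nsq τ a b c := by
        intro a b c; simp only [nsq, cf, ee, neg_sq]
      obtain ⟨ha, φ, hφ, hsub⟩ := h'.subset_profile (τ := τ) (κ := -κ) (d := d) hI hne hH0 hH1 hd
        (fun s hs => by have := hpos s hs; linarith)
        (by rcases hκ with rfl | rfl <;> simp)
        (fun s hs => by
          have e : firstInt τ (-x s) (-deriv x s) (deriv t s)
              = -firstInt τ (x s) (deriv x s) (deriv t s) := by
            rw [firstInt, firstInt, hn, cf, neg_sq, ← cf]; ring
          have e2 : ch (-x s) = ch (x s) := by simp only [ch, neg_sq]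
          simp only [hdx]
          rw [e, e2, ← hP s hs]; ring)
        (fun s hs => by
          have e : curvJ τ (-x s) (-deriv x s) (deriv t s) (-deriv (deriv x) s)
              (deriv (deriv t) s) = curvJ τ (x s) (deriv x s) (deriv t s) (deriv (deriv x) s)
              (deriv (deriv t) s) := by
            rw [curvJ, curvJ, hn]
            simp only [cf, ee, neg_sq]
            ring
          have e2 : cf (-x s) = cf (x s) := by simp only [cf, neg_sq]
          simp only [hdx, hdx2]
          rw [e, e2]
          linear_combination -hJ s hs)
      refine ⟨d, ha, φ, hφ, Subset.trans ?_ hsub⟩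
      rintro _ ⟨⟨s, θ⟩, hq, rfl⟩
      refine ⟨(s, θ + Real.pi), ⟨hq.1, mem_univ _⟩, ?_⟩
      simp [rotMap, Real.cos_add_pi, Real.sin_add_pi]

end PSL2Tilde

end
open PSL2Tilde in
theorem theorem7p1 (τ H : ℝ) (hH_pos : 0 < H) (hH_le : H ≤ 1 / 2) :
    ∃ F : ℝ → Set Pt,
      -- every member is a rotational surface of mean curvature `H`, unbounded in `t`
      (∀ d, Admissible H d → IsRotationalHSurface τ H (F d) ∧ ∀ M : ℝ, ∃ p ∈ F d, M < |p 2|) ∧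
      -- `d > -2H`
      (∀ d, Admissible H d → -2 * H < d →
        IsProperlyEmbeddedHAnnulus τ H (F d) ∧ reflect '' F d = F d ∧
          HasNeckAt τ (F d) (neckDistance H d)) ∧
      -- `d = -2H`
      (∃ u : ℝ × ℝ → ℝ, IsEntireHGraph τ H u (F (-2 * H)) ∧ (∀ q ∈ disk, 0 ≤ u q) ∧
        u (0, 0) = 0 ∧ fderiv ℝ u (0, 0) = 0) ∧
      -- `d < -2H`
      (∀ d, Admissible H d → d < -2 * H →
        IsProperlyImmersedNonembeddedHAnnulus τ H (F d) ∧ reflect '' F d = F d ∧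
          HasNeckAt τ (F d) (neckDistance H d)) ∧
      -- degeneration as `d → -2H` from either side
      TendsLocallyHausdorff F (𝓝[>] (-2 * H)) (F (-2 * H) ∪ reflect '' F (-2 * H)) ∧
      TendsLocallyHausdorff F (𝓝[<] (-2 * H)) (F (-2 * H) ∪ reflect '' F (-2 * H)) ∧
      -- every rotational surface of mean curvature `H` is part of a member, up to an isometry
      (∀ S : Set Pt, IsRotationalHSurface τ H S →
        ∃ d, Admissible H d ∧ ∃ φ : Pt → Pt, IsIsometry τ φ ∧ S ⊆ φ '' F d) := by
  have hcrit := isParam_critical hH_pos hH_le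
  have hpar : ∀ d, Admissible H d → IsParam H d := fun d hd => ⟨hH_pos, hH_le, hd⟩
  have hlim := tendsLocallyHausdorff_family τ hH_pos hH_le
  refine ⟨family τ H, fun d hd => ⟨(hpar d hd).isRotationalHSurface_family τ,
    (hpar d hd).family_unbounded τ⟩, fun d hd hlt => ⟨(hpar d hd).isProperlyEmbedded_family hlt τ,
    (hpar d hd).reflect_family hlt.ne' τ, (hpar d hd).hasNeckAt_family hlt.ne' τ⟩,
    ⟨graphFun τ H, ?_, fun q hq => height_nonneg hH_pos.le hcrit.four_sq_le (by positivity) hq,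
      by simp [graphFun, height_zero], fderiv_graphFun τ H⟩,
    fun d hd hlt => ⟨(hpar d hd).isProperlyImmersedNonembedded_family hlt τ,
    (hpar d hd).reflect_family hlt.ne τ, (hpar d hd).hasNeckAt_family hlt.ne τ⟩,
    hlim.mono (nhdsWithin_mono _ fun _ h => ne_of_gt h),
    hlim.mono (nhdsWithin_mono _ fun _ h => ne_of_lt h),
    fun S hS => classification hH_pos hH_le hS⟩
  rw [family_self]
  exact isEntireHGraph_graphFun τ hcrit.four_sq_le
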